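/- **Conventions.** Oriented virtual knots are given by diagrams on the sphere with classical and virtual crossings, up to generalized Reidemeister moves (RI, RII, RIII, VRI, VRII, VRIII and the semivirtual move). Let $C(D)$ be the set of classical crossings of $D$. Draw every crossing with both strands running upwards. The sign $\operatorname{sgn}(c)$ of a classical crossing is $+1$ if the strand entering at the bottom left is the over strand, and $-1$ otherwise. Label the edges by integers such that at each classical crossing the strand entering at the bottom left with label $a$ leaves with label $a-1$, the strand entering at the bottom right with label $b$ leaves with label $b+1$, and labels do not change at virtual crossings; put $\operatorname{Ind}(c)=\operatorname{sgn}(c)(a-b-1)$. For $n\in\mathbb Z$ let $J_n(D)=\sum_{\operatorname{Ind}(c)=n}\operatorname{sgn}(c)$ and $\nabla J_n(D)=J_n(D)-J_{-n}(D)$. A crossing $c\in C(D)$ cuts the knot into the over loop, which leaves $c$ along the over strand, and the under loop, which leaves $c$ along the under strand. $D_c$ is the knot diagram obtained by smoothing $c$ against the orientation, where the over loop keeps its orientation and the under loop is reversed. $D^c$ is the ordered 2-component link diagram obtained by smoothing $c$ so that the two loops are separated; its first component is the under loop with its orientation, its second component is the over loop with the reversed orientation. For an ordered 2-component diagram $L=K_1\cup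 K_2$ let $O(L)$ and $U(L)$ be the sets of classical crossings where $K_1$ passes over, respectively under, $K_2$; for such a crossing $c$ let ${}^cL$ be the knot diagram obtained by smoothing $c$ against the orientation, where the component of the over strand at $c$ keeps its orientation. Put $$\operatorname{span}_{k,m}(L)=\sum_{c\in O(L),\ \nabla J_k({}^cL)=m}\operatorname{sgn}(c)-\sum_{c\in U(L),\ \nabla J_k({}^cL)=m}\operatorname{sgn}(c),\qquad \operatorname{fspan}_{k,m}(L)=\operatorname{span}_{k,m}(L)+\operatorname{span}_{k,-m}(L).$$ The F-polynomial is $$F^n_D(t,\ell)=\sum_{c\in C(D)}\operatorname{sgn}(c)\,t^{\operatorname{Ind}(c)}\ell^{\nabla J_n(D_c)}-\sum_{c\in T_n(D)}\operatorname{sgn}(c)\,\ell^{\nabla J_n(D_c)}-\sum_{c\in C(D)\setminus T_n(D)}\operatorname{sgn}(c)\,\ell^{\nabla J_n(D)},$$ where $T_n(D)=\{c\in C(D):\nabla J_n(D_c)=\pm\nabla J_n(D)\}$. For $q\ge 1$ let $VK_q$ be the virtual knot with the following cyclic word of passages through crossings. A letter $x_s^\varepsilon$ is a passage through the crossing $x$;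 $s=L,R$ says whether the passing strand enters at the bottom left or at the bottom right, and $\varepsilon=+,-,\circ$ says that the crossing is positive, negative or virtual. The crossings are $a_0,\dots,a_3$ and $(i,r)$ with $0\le i<q$, $0\le r\le 11$. For fixed $i$ write $r$ for $(i,r)$ and put $M_i=11_R^+\,10_L^\circ\,9_R^+\,8_L^\circ\,5_R^-\,1_L^+\,2_R^\circ\,6_L^\circ\,8_R^\circ\,9_L^+\,10_R^\circ\,11_L^+\,7_R^\circ\,3_L^\circ\,0_R^-\,4_L^+$, $E_i=3_R^\circ\,2_L^\circ\,1_R^+\,0_L^-$ and $U_i=4_R^+\,5_L^-\,6_R^\circ\,7_L^\circ$. The word of $VK_q$ is $$M_{q-1}U_{q-1}\;M_{q-2}E_{q-1}U_{q-2}\;\cdots\;M_0E_1U_0\;\;a_{0,R}^+\,a_{1,L}^\circ\,a_{2,R}^+\,a_{3,L}^\circ\;E_0\;a_{3,R}^\circ\,a_{2,L}^+\,a_{1,R}^\circ\,a_{0,L}^+ .$$ **Theorem 6.** Let $n,k,m\in\mathbb Z$ and $$\widetilde F^{n,k,m}_D(t,\ell,v)=\sum_{c\in C(D)}\operatorname{sgn}(c)\,t^{\operatorname{Ind}(c)}\ell^{\nabla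 J_n(D_c)}v^{\operatorname{fspan}_{k,m}(D^c)}-\sum_{c\in T(D)}\operatorname{sgn}(c)\,\ell^{\nabla J_n(D_c)}v^{\operatorname{fspan}_{k,m}(D^c)}-\sum_{c\in C(D)\setminus T(D)}\operatorname{sgn}(c)\,\ell^{\nabla J_n(D)}v^{\operatorname{fspan}_{k,m}(D^c)},$$ where $T(D)=\{c\in C(D):\nabla J_n(D_c)=\pm\nabla J_n(D)\text{ and }\operatorname{fspan}_{k,m}(D^c)=0\}$. (i) $\widetilde F^{n,k,m}$ is an invariant of oriented virtual knots: it takes the same value on any two diagrams of the same oriented virtual knot. (ii) The polynomials $\widetilde F^{n,k,m}$ are stronger than the F-polynomials: - for every diagram $D$ and all $n,k,m$, $$\widetilde F^{n,k,m}_D(t,\ell,1)=F^n_D(t,\ell)+\sum_{c}\operatorname{sgn}(c)\left(\ell^{\nabla J_n(D_c)}-\ell^{\nabla J_n(D)}\right),$$ where $c$ runs over the classical crossings with $\nabla J_n(D_c)=-\nabla J_n(D)$ and $\operatorname{fspan}_{k,m}(D^c)\ne0$ (in particular, $v=1$ gives back $F^n_D$ if $\nabla J_n(D)=0$ or if there is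 no such crossing); - for all $n,k,m$ and all diagrams $D,D'$: if $F^n_D\neq F^n_{D'}$, then $\widetilde F^{n,k,m}_D\ne\widetilde F^{n,k,m}_{D'}$; - $F^n_{VK_3}=F^n_{VK_4}$ for all $n$ (in particular for $n=2,4,6$), but $\widetilde F^{2,2,0}_{VK_3}\ne\widetilde F^{2,2,0}_{VK_4}$ and $\widetilde F^{2,2,2}_{VK_3}\neq\widetilde F^{2,2,2}_{VK_4}$. -/

import Mathlib

namespace VirtualKnot

/-! ### Oriented virtual knot diagrams

A diagram is an oriented closed curve in the plane (or on the sphere) whose only singularities are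
transversal double points, each of which is a classical or a virtual crossing.  It is recorded by
the cyclic word of the passages of the curve through its crossings. -/

/-- The kind of a crossing of two oriented strands.  Draw the crossing with both strands running
upwards.  It is positive if the strand that enters at the bottom left (and leaves at the top
right) is the over strand, negative if that strand is the under strand, and virtual if neither
strand is over. -/
inductive CrossingKind
  | pos
  | neg
  | virt
  deriving DecidableEq

/-- Positive and negative are exchanged. -/
def CrossingKind.mirror : CrossingKind → CrossingKind
  | .pos => .neg
  | .neg => .pos
  | .virt => .virt

/-- The sign of a classical crossing (`0` for virtual crossings). -/
def CrossingKind.sign : CrossingKind → ℤ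
  | .pos => 1
  | .neg => -1
  | .virt => 0

/-- A passage of the curve through a crossing: the name of the crossing, whether the passing
strand enters from the left (that is, from the left-hand side of the other strand: at the bottom
left when both strands run upwards), and the kind of the crossing. -/
structure Pass where
  label : ℕ
  left : Bool
  kind : CrossingKind
  deriving DecidableEq

namespace Pass

/-- The other passage through the same crossing. -/
def partner (p : Pass) : Pass := ⟨p.label, !p.left, p.kind⟩

/-- The same passage after the orientation of exactly one of the two strands of the crossing has
been reversed: the sides are exchanged and the sign changes, over and under do not. -/
def flip (p : Pass) : Pass := ⟨p.label, !p.left, p.kind.mirror⟩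

/-- The crossing is classical. -/
def classical (p : Pass) : Bool := decide (p.kind ≠ CrossingKind.virt)

/-- The strand passes over, at a classical crossing. -/
def isOver (p : Pass) : Bool :=
  match p.kind with
  | .pos => p.left
  | .neg => !p.left
  | .virt => false

/-- The sign of the crossing. -/
def sgn (p : Pass) : ℤ := p.kind.sign

/-- The passage through the over strand of the classical crossing of `p`. -/
def overPass (p : Pass) : Pass := if p.isOver then p else p.partner

/-- The passage through the under strand of the classical crossing of `p`. -/
def underPass (p : Pass) : Pass := if p.isOver then p.partner else p

/-- Change of the name of a crossing. -/
def relabel (f : ℕ → ℕ) (p : Pass) : Pass := ⟨f p.label, p.left, p.kind⟩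

/-- The change of the integer label along the strand at a crossing: at a classical crossing with
incoming labels `a` on the left and `b` on the right, the strand entering from the left leaves
with `a - 1` and the strand entering from the right leaves with `b + 1`.  Labels do not change at
virtual crossings. -/
def jump (p : Pass) : ℤ := if p.classical then (if p.left then -1 else 1) else 0

end Pass

/-- The cyclic word `w`, read from just after `p` until just before `p`. -/
def after (w : List Pass) (p : Pass) : List Pass :=
  (w.dropWhile (fun x => decide (x ≠ p))).tail ++ w.takeWhile (fun x => decide (x ≠ p))

/-- The part of the cyclic word `w` strictly between `p` and `q`. -/
def arc (w : List Pass) (p q : Pass) : List Pass :=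
  (after w p).takeWhile (fun x => decide (x ≠ q))

/-- The passage that follows `p` in the cyclic word `w`. -/
def next (w : List Pass) (p : Pass) : Pass := (after w p).headD p

/-- The word of a closed curve: every crossing that occurs is passed exactly twice, once by the
strand entering from the left and once by the strand entering from the right. -/
def WellFormed (w : List Pass) : Prop :=
  w.Nodup ∧ ∀ p ∈ w, p.partner ∈ w ∧ ∀ q ∈ w, q.label = p.label → q = p ∨ q = p.partner

/-- The word of a closed curve on the sphere.  The edge that ends at the passage `p` has a region
`regL p` on its left and a region `regR p` on its right.  At every crossing, let `a` and `b` be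
the passages of the strands entering from the left and from the right; the western, southern,
eastern and northern corners give the four equalities of regions below.  The word is planar if
and only if the resulting number of regions satisfies Euler's formula for the sphere
(regions = crossings + 2; a value of `crossings + 2` is the largest one that is possible).
The empty word is a circle without crossings. -/
def Planar (w : List Pass) : Prop :=
  w = [] ∨ ∃ regL regR : Pass → ℕ,
    (∀ a ∈ w, a.left = true →
      regL a = regL (next w a.partner) ∧
      regR a = regL a.partner ∧
      regR a.partner = regR (next w a) ∧
      regL (next w a) = regR (next w a.partner)) ∧
    (w.map regL ++ w.map regR).toFinset.card = w.length / 2 + 2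

/-- An oriented virtual knot diagram. -/
structure Diagram where
  word : List Pass
  wellFormed : WellFormed word
  planar : Planar word

/-! ### Generalized Reidemeister moves -/

/-- Two consecutive passages, in the given order or in the opposite order. -/
def ordered (b : Bool) (p q : Pass) : List Pass := if b then [p, q] else [q, p]

/-- Three strands `1`, `2`, `3` form a triangle; `x` is the passage of strand `1` at its crossing
with strand `2`, `y` the passage of strand `1` at its crossing with strand `3`, and `z` the
passage of strand `2` at its crossing with strand `3`.  The order in which the three strands run
through their crossings is determined by the sides from which they enter and by the side `e` of
the triangle on which they lie.  The list contains the passages along strand `1`. -/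
def triangle1 (e : Bool) (x y z : Pass) : List Pass := ordered (z.left == e) x y

/-- The passages along strand `2` of a triangle, see `triangle1`. -/
def triangle2 (e : Bool) (x y z : Pass) : List Pass := ordered ((!y.left) == e) z x.partner

/-- The passages along strand `3` of a triangle, see `triangle1`. -/
def triangle3 (e : Bool) (x y z : Pass) : List Pass := ordered (x.left == e) y.partner z.partner

/-- The crossings of a triangle that admits a third move.  Either all three are classical and
strand `1` is above strand `2`, which is above strand `3` (move RIII), or strand `1` has virtual
crossings with strands `2` and `3`, whose own crossing is virtual (move VRIII) or classical (the
semivirtual move SV). -/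
def TriangleKinds (x y z : Pass) : Prop :=
  (x.isOver = true ∧ y.isOver = true ∧ z.isOver = true) ∨
    (x.kind = CrossingKind.virt ∧ y.kind = CrossingKind.virt)

/-- The elementary moves, for all orientations of the strands.  A word is cyclic and the names of
the crossings are irrelevant, which gives the first two constructors. -/
inductive Move : List Pass → List Pass → Prop
  | rotate (u v : List Pass) : Move (u ++ v) (v ++ u)
  | relabel (f : ℕ → ℕ) (hf : Function.Injective f) (w : List Pass) :
      Move w (w.map (Pass.relabel f))
  /-- RI and VRI: a kink with a classical or virtual crossing is created. -/
  | first (p : Pass) (w : List Pass) : Move w (p :: p.partner :: w)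
  /-- RII and VRII for two parallel strands.  The two new crossings are both virtual, or both
  classical with the same strand above and of opposite signs. -/
  | secondParallel (p q : Pass) (hl : q.left = !p.left) (hk : q.kind = p.kind.mirror)
      (u v : List Pass) :
      Move (u ++ v) ([p, q] ++ u ++ [p.partner, q.partner] ++ v)
  /-- RII and VRII for two antiparallel strands. -/
  | secondAntiparallel (p q : Pass) (hl : q.left = !p.left) (hk : q.kind = p.kind.mirror)
      (u v : List Pass) :
      Move (u ++ v) ([p, q] ++ u ++ [q.partner, p.partner] ++ v)
  /-- RIII, VRIII and SV, when the curve runs through the strands in the cyclic order 1, 2, 3. -/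
  | third (e : Bool) (x y z : Pass) (h : TriangleKinds x y z) (u v w : List Pass) :
      Move (triangle1 e x y z ++ u ++ triangle2 e x y z ++ v ++ triangle3 e x y z ++ w)
        (triangle1 (!e) x y z ++ u ++ triangle2 (!e) x y z ++ v ++ triangle3 (!e) x y z ++ w)
  /-- RIII, VRIII and SV, when the curve runs through the strands in the cyclic order 1, 3, 2. -/
  | third' (e : Bool) (x y z : Pass) (h : TriangleKinds x y z) (u v w : List Pass) :
      Move (triangle1 e x y z ++ u ++ triangle3 e x y z ++ v ++ triangle2 e x y z ++ w)
        (triangle1 (!e) x y z ++ u ++ triangle3 (!e) x y z ++ v ++ triangle2 (!e) x y z ++ w)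

/-- Two diagrams represent the same oriented virtual knot: they are connected by a finite sequence
of diagrams in which neighbours differ by a generalized Reidemeister move or its inverse. -/
def Diagram.Equivalent : Diagram → Diagram → Prop :=
  Relation.EqvGen (fun D D' => Move D.word D'.word)

/-! ### Index and writhes -/

/-- The classical crossings of a word, each represented by its passage entering from the left. -/
def crossings (w : List Pass) : Finset Pass :=
  (w.filter (fun p => p.left && p.classical)).toFinset

/-- The integer label of the edge that ends at `p`, where the edge that ends at the first passage
of the word has label `0`. -/
def edgeLabel (w : List Pass) (p : Pass) : ℤ :=
  ((w.takeWhile (fun x => decide (x ≠ p))).map Pass.jump).sum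

/-- The index `sgn(c) (a - b - 1)` of a classical crossing with incoming label `a` on the left and
`b` on the right. -/
def ind (w : List Pass) (c : Pass) : ℤ :=
  c.sgn * (edgeLabel w c - edgeLabel w c.partner - 1)

/-- The `n`-th writhe. -/
def writhe (n : ℤ) (w : List Pass) : ℤ :=
  ∑ c ∈ crossings w with ind w c = n, c.sgn

/-- The `n`-th difference writhe. -/
def dwrithe (n : ℤ) (w : List Pass) : ℤ := writhe n w - writhe (-n) w

/-! ### Smoothings -/

/-- Update of a passage at a crossing between the strings `u` and `v` when exactly one of these
strings is reversed. -/
def flipMixed (u v : List Pass) (p : Pass) : Pass :=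
  if (p ∈ u ∧ p.partner ∈ v) ∨ (p ∈ v ∧ p.partner ∈ u) then p.flip else p

/-- The strings `u` and `v` after the orientation of `v` has been reversed. -/
def reverseSecond (u v : List Pass) : List Pass × List Pass :=
  (u.map (flipMixed u v), (v.map (flipMixed u v)).reverse)

/-- The part of the knot that leaves the crossing `c` along the over strand and returns along the
under strand. -/
def overLoop (w : List Pass) (c : Pass) : List Pass := arc w c.overPass c.underPass

/-- The part of the knot that leaves the crossing `c` along the under strand and returns along the
over strand. -/
def underLoop (w : List Pass) (c : Pass) : List Pass := arc w c.underPass c.overPass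

/-- The smoothing of type 1 at `c` (against the orientation): a knot, in which the over loop keeps
its orientation and the under loop is reversed. -/
def smooth1 (w : List Pass) (c : Pass) : List Pass :=
  (reverseSecond (overLoop w c) (underLoop w c)).1 ++
    (reverseSecond (overLoop w c) (underLoop w c)).2

/-- The smoothing of type 2 at `c`: an ordered link whose first component is the under loop with
its orientation and whose second component is the over loop with the reversed orientation. -/
def smooth2 (w : List Pass) (c : Pass) : List Pass × List Pass :=
  reverseSecond (underLoop w c) (overLoop w c)

/-- The smoothing of type 3 (against the orientation) of a two-component link at the crossing of
the passage `p` of the first component with the second component: a knot, in which the component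
of the over strand keeps its orientation and the other one is reversed. -/
def smooth3 (L : List Pass × List Pass) (p : Pass) : List Pass :=
  if p.isOver then
    (reverseSecond (after L.1 p) (after L.2 p.partner)).1 ++
      (reverseSecond (after L.1 p) (after L.2 p.partner)).2
  else
    (reverseSecond (after L.2 p.partner) (after L.1 p)).1 ++
      (reverseSecond (after L.2 p.partner) (after L.1 p)).2

/-! ### Spans of ordered two-component links -/

/-- The classical crossings where the first component passes over the second one, each represented
by its passage on the first component. -/
def overCrossings (L : List Pass × List Pass) : Finset Pass :=
  (L.1.filter (fun p => p.classical && p.isOver && decide (p.partner ∈ L.2))).toFinset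

/-- The classical crossings where the first component passes under the second one, each
represented by its passage on the first component. -/
def underCrossings (L : List Pass × List Pass) : Finset Pass :=
  (L.1.filter (fun p => p.classical && !p.isOver && decide (p.partner ∈ L.2))).toFinset

/-- The `(n, k)`-span. -/
def span (n k : ℤ) (L : List Pass × List Pass) : ℤ :=
  (∑ c ∈ overCrossings L with dwrithe n (smooth3 L c) = k, c.sgn) -
    ∑ c ∈ underCrossings L with dwrithe n (smooth3 L c) = k, c.sgn

/-- The flat `(n, k)`-span. -/
def fspan (n k : ℤ) (L : List Pass × List Pass) : ℤ := span n k L + span n (-k) L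

/-! ### The polynomials -/

/-- Integer Laurent polynomials in the variables `t`, `ℓ`. -/
abbrev Laurent2 : Type := AddMonoidAlgebra ℤ (ℤ × ℤ)

/-- Integer Laurent polynomials in the variables `t`, `ℓ`, `v`. -/
abbrev Laurent3 : Type := AddMonoidAlgebra ℤ (ℤ × ℤ × ℤ)

/-- The monomial `t ^ a * ℓ ^ b`. -/
noncomputable def mono2 (a b : ℤ) : Laurent2 := AddMonoidAlgebra.single (a, b) 1

/-- The monomial `t ^ a * ℓ ^ b * v ^ c`. -/
noncomputable def mono3 (a b c : ℤ) : Laurent3 := AddMonoidAlgebra.single (a, b, c) 1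

/-- The substitution `v = 1`. -/
noncomputable def setVOne : Laurent3 →+* Laurent2 :=
  AddMonoidAlgebra.mapDomainRingHom ℤ
    ((AddMonoidHom.fst ℤ (ℤ × ℤ)).prod
      ((AddMonoidHom.fst ℤ ℤ).comp (AddMonoidHom.snd ℤ (ℤ × ℤ))))

/-- The condition that defines `T_n(D)`. -/
def InTF (n : ℤ) (w : List Pass) (c : Pass) : Prop :=
  dwrithe n (smooth1 w c) = dwrithe n w ∨ dwrithe n (smooth1 w c) = -dwrithe n w

instance (n : ℤ) (w : List Pass) (c : Pass) : Decidable (InTF n w c) :=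
  inferInstanceAs (Decidable (_ ∨ _))

/-- The condition that defines the set `T(D)` of the three-variable polynomial. -/
def InT (n k m : ℤ) (w : List Pass) (c : Pass) : Prop :=
  InTF n w c ∧ fspan k m (smooth2 w c) = 0

instance (n k m : ℤ) (w : List Pass) (c : Pass) : Decidable (InT n k m w c) :=
  inferInstanceAs (Decidable (_ ∧ _))

/-- The `n`-th F-polynomial of a diagram. -/
noncomputable def fPoly (n : ℤ) (D : Diagram) : Laurent2 :=
  (∑ c ∈ crossings D.word,
      c.sgn • mono2 (ind D.word c) (dwrithe n (smooth1 D.word c))) -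
  (∑ c ∈ crossings D.word with InTF n D.word c,
      c.sgn • mono2 0 (dwrithe n (smooth1 D.word c))) -
  ∑ c ∈ crossings D.word with ¬ InTF n D.word c,
      c.sgn • mono2 0 (dwrithe n D.word)

/-- The three-variable polynomial of a diagram. -/
noncomputable def fTilde (n k m : ℤ) (D : Diagram) : Laurent3 :=
  (∑ c ∈ crossings D.word,
      c.sgn • mono3 (ind D.word c) (dwrithe n (smooth1 D.word c))
        (fspan k m (smooth2 D.word c))) -
  (∑ c ∈ crossings D.word with InT n k m D.word c,
      c.sgn • mono3 0 (dwrithe n (smooth1 D.word c)) (fspan k m (smooth2 D.word c))) -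
  ∑ c ∈ crossings D.word with ¬ InT n k m D.word c,
      c.sgn • mono3 0 (dwrithe n D.word) (fspan k m (smooth2 D.word c))

/-! ### The virtual knots `VK_q`

The diagram of `VK_q` consists of an initial block with crossings `0, …, 3` and of `q` equal blocks
with `12` crossings each; it has `4 + 12 * q` crossings, of which `2 + 6 * q` are classical. -/

/-- The passage through crossing `r` of block `i`. -/
def blockPass (i r : ℕ) (left : Bool) (kind : CrossingKind) : Pass := ⟨4 + 12 * i + r, left, kind⟩

/-- The strand that enters block `i` at its upper right corner, up to its vertical line through
the crossings `4, 5, 6, 7`. -/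
def blockMain (i : ℕ) : List Pass :=
  [blockPass i 11 false .pos, blockPass i 10 true .virt, blockPass i 9 false .pos,
   blockPass i 8 true .virt, blockPass i 5 false .neg, blockPass i 1 true .pos,
   blockPass i 2 false .virt, blockPass i 6 true .virt, blockPass i 8 false .virt,
   blockPass i 9 true .pos, blockPass i 10 false .virt, blockPass i 11 true .pos,
   blockPass i 7 false .virt, blockPass i 3 true .virt, blockPass i 0 false .neg,
   blockPass i 4 true .pos]

/-- The vertical line of block `i` through the crossings `0, 1, 2, 3`, running downwards. -/
def blockDown (i : ℕ) : List Pass :=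
  [blockPass i 3 false .virt, blockPass i 2 true .virt, blockPass i 1 false .pos,
   blockPass i 0 true .neg]

/-- The vertical line of block `i` through the crossings `4, 5, 6, 7`, running upwards. -/
def blockUp (i : ℕ) : List Pass :=
  [blockPass i 4 false .pos, blockPass i 5 true .neg, blockPass i 6 false .virt,
   blockPass i 7 true .virt]

/-- The word of the diagram of `VK_q`, which runs through the blocks from the last to the first
and ends in the initial block. -/
def vkWord (q : ℕ) : List Pass :=
  (List.range q).reverse.flatMap
    (fun i => blockMain i ++ (if i + 1 < q then blockDown (i + 1) else []) ++ blockUp i) ++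
  [⟨0, false, .pos⟩, ⟨1, true, .virt⟩, ⟨2, false, .pos⟩, ⟨3, true, .virt⟩] ++
  blockDown 0 ++
  [⟨3, false, .virt⟩, ⟨2, true, .pos⟩, ⟨1, false, .virt⟩, ⟨0, true, .pos⟩]

/-- Regions to the left of the edges of the diagram of $VK_3$, in the order of its word. -/
def regionsLeft3 : List ℕ :=
   [2, 0, 2, 4, 2, 6, 8, 10, 1, 4, 1, 0, 1, 10, 8, 6, 2, 6, 7, 10, 12, 15, 12, 18, 12, 20,
    22, 24, 16, 18, 16, 15, 16, 24, 22, 20, 12, 10, 7, 6, 2, 20, 21, 24, 25, 27, 25, 30, 25,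
    32, 34, 36, 28, 30, 28, 27, 28, 36, 34, 32, 25, 24, 21, 20, 2, 32, 33, 36, 37, 39, 37,
    41, 37, 36, 33, 32, 2, 41, 2, 39]

/-- Regions to the right of the edges of the diagram of $VK_3$, in the order of its word. -/
def regionsRight3 : List ℕ :=
   [11, 1, 3, 1, 5, 7, 9, 7, 5, 2, 3, 2, 11, 12, 13, 2, 14, 2, 5, 1, 11, 16, 17, 16, 19, 21,
    23, 21, 19, 12, 17, 12, 11, 25, 26, 2, 13, 8, 9, 8, 13, 12, 19, 16, 11, 28, 29, 28, 31,
    33, 35, 33, 31, 25, 29, 25, 11, 37, 38, 2, 26, 22, 23, 22, 26, 25, 31, 28, 11, 2, 40, 2,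
    38, 34, 35, 34, 38, 37, 40, 37]

/-- Regions to the left of the edges of the diagram of $VK_4$, in the order of its word. -/
def regionsLeft4 : List ℕ :=
   [2, 0, 2, 4, 2, 6, 8, 10, 1, 4, 1, 0, 1, 10, 8, 6, 2, 6, 7, 10, 12, 15, 12, 18, 12, 20,
    22, 24, 16, 18, 16, 15, 16, 24, 22, 20, 12, 10, 7, 6, 2, 20, 21, 24, 25, 27, 25, 30, 25,
    32, 34, 36, 28, 30, 28, 27, 28, 36, 34, 32, 25, 24, 21, 20, 2, 32, 33, 36, 37, 39, 37,
    42, 37, 44, 46, 48, 40, 42, 40, 39, 40, 48, 46, 44, 37, 36, 33, 32, 2, 44, 45, 48, 49,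
    51, 49, 53, 49, 48, 45, 44, 2, 53, 2, 51]

/-- Regions to the right of the edges of the diagram of $VK_4$, in the order of its word. -/
def regionsRight4 : List ℕ :=
   [11, 1, 3, 1, 5, 7, 9, 7, 5, 2, 3, 2, 11, 12, 13, 2, 14, 2, 5, 1, 11, 16, 17, 16, 19, 21,
    23, 21, 19, 12, 17, 12, 11, 25, 26, 2, 13, 8, 9, 8, 13, 12, 19, 16, 11, 28, 29, 28, 31,
    33, 35, 33, 31, 25, 29, 25, 11, 37, 38, 2, 26, 22, 23, 22, 26, 25, 31, 28, 11, 40, 41,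
    40, 43, 45, 47, 45, 43, 37, 41, 37, 11, 49, 50, 2, 38, 34, 35, 34, 38, 37, 43, 40, 11, 2,
    52, 2, 50, 46, 47, 46, 50, 49, 52, 49]

instance (w : List Pass) : Decidable (WellFormed w) := inferInstanceAs (Decidable (_ ∧ _))

/-- The diagram of `VK_3`. -/
def VK3 : Diagram where
  word := vkWord 3
  wellFormed := by decide +kernel
  planar := Or.inr
    ⟨fun p => regionsLeft3.getD ((vkWord 3).idxOf p) 0,
     fun p => regionsRight3.getD ((vkWord 3).idxOf p) 0, by decide +kernel, by decide +kernel⟩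

/-- The diagram of `VK_4`. -/
def VK4 : Diagram where
  word := vkWord 4
  wellFormed := by decide +kernel
  planar := Or.inr
    ⟨fun p => regionsLeft4.getD ((vkWord 4).idxOf p) 0,
     fun p => regionsRight4.getD ((vkWord 4).idxOf p) 0, by decide +kernel, by decide +kernel⟩

end VirtualKnot

/-!
The polynomials are rewritten in terms of *flat* data, in which the over and under information
enters only through the sign of a crossing and the choice of its over passage.  Every passage
carries a jump `±1` (zero at virtual crossings), opposite at the two passages of a crossing.  The
index of a crossing is the flat index (`flatInd`) of its over passage, the difference writhe is a
sum over all passages (`flatWrithe`), and both smoothings become operations on cyclic words: if `A`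
and `B` are the loops that leave the crossing along the two strands, `smoothWrithe` is the flat
writhe of `A ++ B.reverse` with the jumps negated at the crossings between `A` and `B`, and
`smoothSpan` adds up, over the crossings `d` between `A` and `B`, jumps weighted by the flat writhe
of the knot `smoothTwo` in which both crossings are smoothed along the orientation.  The two changes
of orientation in the smoothings of types 2 and 3 cancel there, up to a reversal of the whole knot,
which only changes the sign of the writhe (`dwrithe_smooth3`, `fspan_smooth2`).  Reversal also shows
that `smoothWrithe` and `smoothSpan` change sign if the two passages of the crossing are exchanged.

*Invariance.*  Passages through virtual crossings have jump zero and may be deleted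
(`sum_crossings_eq`), so only the classical moves remain.  A kink has flat index zero and span zero,
and its smoothing reproduces the knot up to orientation, so that it contributes zero.  The two
crossings of a bigon have equal data and opposite signs.  A crossing outside a triangle sees the
triangle, or its image after a smoothing, on both sides of the move.  If a crossing `a` of the
triangle itself is smoothed, the other two crossings either form a bigon or exchange their names;
which of the two occurs for one smoothing and for two smoothings depends on the order of the
crossings along the strands (`sameAt`).  Altogether every crossing keeps its data (`third_move`),
and `flatPoly_move` follows.

*Comparison with the F-polynomial.*  The substitution `v = 1` is computed crossing by crossing.
Conversely, for `ℓ = v = 1` the coefficient of `t ^ i`, `i ≠ 0`, is the writhe of index `i`, so the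
three-variable polynomial determines the difference writhe `J` of the knot.  If `J ≠ 0`, its terms
`ℓ ^ (-J) * v ^ s` with `s ≠ 0` come only from crossings with `∇J_n(D_c) = -J` and nonzero flat span,
and they determine the correction term (`fPoly_eq_of_fTilde_eq`).

*The example.*  All difference writhes of `VK_3` and `VK_4` vanish.  The writhes of all orders of a
smoothed knot are read off from one list, its chord profile; up to pairs of crossings of opposite
signs the crossings of `VK_3` and `VK_4` have the same indices and writhes, which gives equal
F-polynomials.  The coefficient of `t ^ 2 * ℓ ^ (-3)` comes from a single crossing, whose flat spans
in `VK_3` and `VK_4` differ.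
-/

namespace VirtualKnot

open List

section

/-! ### Passages and closed words -/

@[simp] theorem Pass.partner_partner (p : Pass) : p.partner.partner = p := by
  cases p; simp [Pass.partner]

@[simp] theorem Pass.partner_ne (p : Pass) : p.partner ≠ p := by
  cases p; simp [Pass.partner]

@[simp] theorem Pass.ne_partner (p : Pass) : p ≠ p.partner := p.partner_ne.symm

@[simp] theorem Pass.partner_inj {p q : Pass} : p.partner = q.partner ↔ p = q :=
  ⟨fun h => by simpa using congrArg Pass.partner h, fun h => h ▸ rfl⟩

theorem Pass.partner_eq_comm {p q : Pass} : p.partner = q ↔ p = q.partner :=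
  ⟨fun h => by simp [← h], fun h => by simp [h]⟩

/-- A repetition-free word that contains the partner of each of its passages. -/
def Closed (w : List Pass) : Prop := w.Nodup ∧ ∀ p ∈ w, p.partner ∈ w

theorem WellFormed.closed {w : List Pass} (h : WellFormed w) : Closed w :=
  ⟨h.1, fun p hp => (h.2 p hp).1⟩

theorem Closed.mem_partner {w : List Pass} (h : Closed w) {p : Pass} : p.partner ∈ w ↔ p ∈ w :=
  ⟨fun hp => by simpa using h.2 _ hp, h.2 p⟩

theorem Closed.perm {w w' : List Pass} (h : Closed w) (hw : w ~ w') : Closed w' :=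
  ⟨hw.nodup_iff.1 h.1, fun p hp => hw.mem_iff.1 (h.2 p (hw.mem_iff.2 hp))⟩

theorem Closed.remove {w l : List Pass} {c : Pass} (h : Closed w)
    (hw : w ~ c :: c.partner :: l) : Closed l := by
  have h' := h.perm hw
  have hn := h'.1
  simp only [nodup_cons, mem_cons, not_or] at hn
  refine ⟨hn.2.2, fun p hp => ?_⟩
  have := h'.2 p (by simp [hp])
  simp only [mem_cons] at this
  rcases this with h1 | h1 | h1
  · rw [Pass.partner_eq_comm] at h1
    exact absurd hp (h1 ▸ hn.2.1)
  · rw [Pass.partner_inj] at h1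
    exact absurd hp (h1 ▸ hn.1.2)
  · exact h1

/-- The two passages of every crossing carry opposite values. -/
def IsJump (j : Pass → ℤ) : Prop := ∀ p, j p.partner = -j p

theorem isJump_jump : IsJump Pass.jump := by
  intro p
  rcases p with ⟨l, _ | _, _ | _ | _⟩ <;> rfl

/-- The two passages of a crossing cancel. -/
theorem Closed.sum_eq_zero {w : List Pass} (h : Closed w) {j : Pass → ℤ} (hj : IsJump j) :
    (w.map j).sum = 0 := by
  rw [← List.sum_toFinset _ h.1]
  have h1 : ∑ p ∈ w.toFinset, j p = ∑ p ∈ w.toFinset, j p.partner :=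
    Finset.sum_nbij' Pass.partner Pass.partner (by simpa using h.2) (by simpa using h.2)
      (by simp) (by simp) (by simp)
  have h2 : ∑ p ∈ w.toFinset, j p.partner = -∑ p ∈ w.toFinset, j p := by
    rw [← Finset.sum_neg_distrib]
    exact Finset.sum_congr rfl fun p _ => hj p
  linarith

/-! ### Flat indices and flat writhes -/

/-- The sum of the jumps of the passages of `w` before `p`. -/
def height (j : Pass → ℤ) (w : List Pass) (p : Pass) : ℤ :=
  ((w.takeWhile (fun x => decide (x ≠ p))).map j).sum

/-- The flat index of the passage `p`: the difference of the labels of the incoming edges at its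
crossing, corrected by the jump of `p`.  It does not depend on which strand is above, and for the
over passage of a classical crossing it is the index of the crossing. -/
def flatInd (j : Pass → ℤ) (w : List Pass) (p : Pass) : ℤ :=
  height j w p - height j w p.partner + j p

/-- The `n`-th flat writhe of a word.  Both passages of a crossing enter, with opposite jumps and
opposite flat indices; for the actual jumps the sum is therefore the `n`-th difference writhe. -/
def flatWrithe (n : ℤ) (j : Pass → ℤ) (w : List Pass) : ℤ :=
  -∑ p ∈ w.toFinset, if flatInd j w p = n then j p else 0

variable {j : Pass → ℤ} {n : ℤ}

@[simp] theorem height_cons (a : Pass) (w : List Pass) (p : Pass) :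
    height j (a :: w) p = if a = p then 0 else j a + height j w p := by
  unfold height
  by_cases h : a = p <;> simp [h]

theorem height_append (u v : List Pass) (p : Pass) :
    height j (u ++ v) p = if p ∈ u then height j u p else (u.map j).sum + height j v p := by
  induction u with
  | nil => simp
  | cons a u ih =>
    by_cases h : a = p
    · simp [h]
    · have h' : p ≠ a := Ne.symm h
      simp only [cons_append, height_cons, h, if_false, ih, mem_cons, h', false_or, map_cons,
        sum_cons]
      split_ifs <;> ring

theorem height_append_of_mem {u v : List Pass} {p : Pass} (h : p ∈ u) :
    height j (u ++ v) p = height j u p := by simp [height_append, h]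

theorem height_append_of_not_mem {u v : List Pass} {p : Pass} (h : p ∉ u) :
    height j (u ++ v) p = (u.map j).sum + height j v p := by simp [height_append, h]

theorem height_congr {j' : Pass → ℤ} {w : List Pass} (h : ∀ p ∈ w, j p = j' p) (p : Pass) :
    height j w p = height j' w p := by
  unfold height
  congr 1
  refine map_congr_left fun x hx => h x ?_
  exact (takeWhile_subset _ hx)

theorem height_map {φ : Pass → Pass} {w : List Pass} {p : Pass}
    (h : ∀ x ∈ w, φ x = φ p → x = p) : height j (w.map φ) (φ p) = height (j ∘ φ) w p := by
  induction w with
  | nil => rfl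
  | cons a w ih =>
    have h1 : φ a = φ p ↔ a = p := ⟨h a (by simp), fun e => e ▸ rfl⟩
    simp [h1, ih fun x hx => h x (by simp [hx])]

theorem height_reverse {w : List Pass} (hw : w.Nodup) {p : Pass} (hp : p ∈ w) :
    height j w.reverse p = (w.map j).sum - height j w p - j p := by
  obtain ⟨u, v, rfl⟩ := append_of_mem hp
  simp only [nodup_append, nodup_cons, mem_cons] at hw
  have h1 : p ∉ u := fun h => hw.2.2 p h p (by simp) rfl
  have h2 : p ∉ v := hw.2.1.1
  simp [height_append, h1, h2]

theorem flatInd_partner (hj : IsJump j) (w : List Pass) (p : Pass) :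
    flatInd j w p.partner = -flatInd j w p := by
  simp [flatInd, hj p]; ring

theorem flatWrithe_congr_ind {w w' : List Pass} (h : w ~ w')
    (hi : ∀ p ∈ w, j p ≠ 0 → flatInd j w p = flatInd j w' p) :
    flatWrithe n j w = flatWrithe n j w' := by
  unfold flatWrithe
  rw [toFinset_eq_of_perm _ _ h]
  congr 1
  refine Finset.sum_congr rfl fun p hp => ?_
  by_cases h0 : j p = 0
  · simp [h0]
  · rw [hi p (h.mem_iff.2 (by simpa using hp)) h0]

theorem flatInd_append_comm (hj : IsJump j) {u v : List Pass} (h : Closed (u ++ v)) {p : Pass}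
    (hp : p ∈ u ++ v) : flatInd j (u ++ v) p = flatInd j (v ++ u) p := by
  have hp' := h.2 p hp
  have hs := h.sum_eq_zero hj
  rw [map_append, sum_append] at hs
  have hd := (nodup_append'.1 h.1).2.2
  have key : ∀ q ∈ u ++ v, height j (v ++ u) q = height j (u ++ v) q + (v.map j).sum := by
    intro q hq
    rcases mem_append.1 hq with h1 | h1
    · rw [height_append_of_mem h1, height_append_of_not_mem (hd h1)]; ring
    · rw [height_append_of_mem h1, height_append_of_not_mem (fun h2 => hd h2 h1)]; omega
  unfold flatInd
  rw [key p hp, key _ hp']; ring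

theorem flatWrithe_append_comm (hj : IsJump j) {u v : List Pass} (h : Closed (u ++ v)) :
    flatWrithe n j (u ++ v) = flatWrithe n j (v ++ u) :=
  flatWrithe_congr_ind perm_append_comm fun _ hp _ => flatInd_append_comm hj h hp

theorem flatInd_isRotated (hj : IsJump j) {w w' : List Pass} (h : Closed w) (hr : w ~r w')
    {p : Pass} (hp : p ∈ w) : flatInd j w p = flatInd j w' p := by
  obtain ⟨k, hk, rfl⟩ := isRotated_iff_mod.1 hr
  rw [rotate_eq_drop_append_take hk]
  conv_lhs => rw [← take_append_drop k w]
  exact flatInd_append_comm hj (by simpa using h) (by simpa using hp)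

/-- The flat writhe belongs to the cyclic word, since the jumps of a closed word sum up to zero. -/
theorem flatWrithe_isRotated (hj : IsJump j) {w w' : List Pass} (h : Closed w) (hr : w ~r w') :
    flatWrithe n j w = flatWrithe n j w' :=
  flatWrithe_congr_ind hr.perm fun _ hp _ => flatInd_isRotated hj h hr hp

theorem flatInd_reverse (hj : IsJump j) {w : List Pass} (h : Closed w) {p : Pass} (hp : p ∈ w) :
    flatInd j w.reverse p = -flatInd j w p := by
  unfold flatInd
  rw [height_reverse h.1 hp, height_reverse h.1 (h.2 p hp), hj p]; ring

theorem sum_partner {w : List Pass} (h : Closed w) (f : Pass → ℤ) :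
    ∑ p ∈ w.toFinset, f p.partner = ∑ p ∈ w.toFinset, f p :=
  Finset.sum_nbij' Pass.partner Pass.partner (by simpa using h.2) (by simpa using h.2)
    (by simp) (by simp) (by simp)

theorem flatWrithe_reverse (hj : IsJump j) {w : List Pass} (h : Closed w) :
    flatWrithe n j w.reverse = -flatWrithe n j w := by
  unfold flatWrithe
  rw [← sum_partner h fun p => if flatInd j w p = n then j p else 0, toFinset_reverse, neg_neg,
    ← Finset.sum_neg_distrib]
  refine Finset.sum_congr rfl fun p hp => ?_
  rw [flatInd_reverse hj h (by simpa using hp), flatInd_partner hj, hj p]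
  split_ifs <;> simp

/-- A change of names that respects the crossings does not change the flat indices. -/
theorem flatInd_map {φ : Pass → Pass} {w : List Pass} (hw : ∀ p ∈ w, p.partner ∈ w)
    (hφ : ∀ p ∈ w, ∀ q ∈ w, φ p = φ q → p = q) (hp : ∀ p ∈ w, φ p.partner = (φ p).partner)
    {j' : Pass → ℤ} (hj : ∀ p ∈ w, j' (φ p) = j p) {p : Pass} (hpw : p ∈ w) :
    flatInd j' (w.map φ) (φ p) = flatInd j w p := by
  have key : ∀ q ∈ w, height j' (w.map φ) (φ q) = height j w q := fun q hq => by
    rw [height_map fun x hx => hφ x hx q hq]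
    exact height_congr (fun x hx => hj x hx) q
  unfold flatInd
  rw [← hp p hpw, key p hpw, key _ (hw p hpw), hj p hpw]

theorem flatWrithe_map {φ : Pass → Pass} {w : List Pass} (hw : ∀ p ∈ w, p.partner ∈ w)
    (hφ : ∀ p ∈ w, ∀ q ∈ w, φ p = φ q → p = q) (hp : ∀ p ∈ w, φ p.partner = (φ p).partner)
    {j' : Pass → ℤ} (hj : ∀ p ∈ w, j' (φ p) = j p) :
    flatWrithe n j' (w.map φ) = flatWrithe n j w := by
  unfold flatWrithe
  congr 1
  symm
  refine Finset.sum_bij (fun p _ => φ p) ?_ ?_ ?_ ?_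
  · intro p hp'
    simp only [mem_toFinset, mem_map] at hp' ⊢
    exact ⟨p, hp', rfl⟩
  · intro p h1 q h2
    exact hφ p (by simpa using h1) q (by simpa using h2)
  · intro q hq
    simpa using hq
  · intro p h1
    have h1' : p ∈ w := by simpa using h1
    rw [flatInd_map hw hφ hp hj h1', hj p h1']

theorem flatWrithe_congr {j' : Pass → ℤ} {w : List Pass} (hw : ∀ p ∈ w, p.partner ∈ w)
    (h : ∀ p ∈ w, j p = j' p) : flatWrithe n j w = flatWrithe n j' w := by
  simpa using flatWrithe_map (n := n) (φ := id) hw (by simp) (by simp) h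

/-! ### Local replacements -/

/-- The word `w'` arises from `w` by the replacement of the string `s` by `s'`. -/
def Repl (s s' w w' : List Pass) : Prop := ∃ u v, w = u ++ s ++ v ∧ w' = u ++ s' ++ v

/-- The word `w'` arises from `w` by the deletion of two neighbouring passages `p`, `q`. -/
def Del (p q : Pass) (w w' : List Pass) : Prop := ∃ s, s ~ [p, q] ∧ Repl s [] w w'

/-- The word `w'` arises from `w` by the exchange of the neighbouring passages `x`, `y`; in `w`
the passage `x` comes first if `o = 1`, and `y` comes first if `o = -1`. -/
def Swap (o : ℤ) (x y : Pass) (w w' : List Pass) : Prop :=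
  ∃ s s', (o = 1 ∧ s = [x, y] ∧ s' = [y, x] ∨ o = -1 ∧ s = [y, x] ∧ s' = [x, y]) ∧ Repl s s' w w'

theorem perm_pair {s : List Pass} {p q : Pass} : s ~ [p, q] ↔ s = [p, q] ∨ s = [q, p] := by
  constructor
  · intro h
    match s, h.length_eq with
    | [a, b], _ =>
      have h1 := h.mem_iff (a := a)
      have h2 := h.mem_iff (a := b)
      have h3 := h.mem_iff (a := p)
      have h4 := h.mem_iff (a := q)
      simp at *
      rcases h1 with rfl | rfl <;> rcases h2 with rfl | rfl <;> simp_all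
  · rintro (rfl | rfl)
    · rfl
    · exact Perm.swap _ _ _

theorem Del.perm {p q : Pass} {w w' : List Pass} (h : Del p q w w') : w ~ p :: q :: w' := by
  obtain ⟨s, hs, u, v, rfl, rfl⟩ := h
  have h1 : u ++ s ++ v ~ s ++ (u ++ v) := by
    rw [← append_assoc]; exact perm_append_comm.append_right v
  simpa using h1.trans (hs.append_right (u ++ v))

theorem Del.nodup {p q : Pass} {w w' : List Pass} (h : Del p q w w') (hw : w.Nodup) :
    w'.Nodup := by
  have := h.perm.nodup_iff.1 hw
  simp only [nodup_cons] at this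
  exact this.2.2

theorem Swap.perm {o : ℤ} {x y : Pass} {w w' : List Pass} (h : Swap o x y w w') : w ~ w' := by
  obtain ⟨s, s', ho, u, v, rfl, rfl⟩ := h
  refine Perm.append_right _ (Perm.append_left _ ?_)
  rcases ho with ⟨-, rfl, rfl⟩ | ⟨-, rfl, rfl⟩ <;> exact Perm.swap _ _ _

theorem Repl.append_left {s s' w w' : List Pass} (h : Repl s s' w w') (z : List Pass) :
    Repl s s' (z ++ w) (z ++ w') := by
  obtain ⟨u, v, rfl, rfl⟩ := h
  exact ⟨z ++ u, v, by simp, by simp⟩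

theorem Repl.append_right {s s' w w' : List Pass} (h : Repl s s' w w') (z : List Pass) :
    Repl s s' (w ++ z) (w' ++ z) := by
  obtain ⟨u, v, rfl, rfl⟩ := h
  exact ⟨u, v ++ z, by simp, by simp⟩

theorem Repl.reverse {s s' w w' : List Pass} (h : Repl s s' w w') :
    Repl s.reverse s'.reverse w.reverse w'.reverse := by
  obtain ⟨u, v, rfl, rfl⟩ := h
  exact ⟨v.reverse, u.reverse, by simp, by simp⟩

theorem Repl.mem_iff {s s' w w' : List Pass} (h : Repl s s' w w') {p : Pass} (hp : p ∉ s)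
    (hp' : p ∉ s') : p ∈ w ↔ p ∈ w' := by
  obtain ⟨u, v, rfl, rfl⟩ := h
  simp [hp, hp']

theorem Del.height {p q : Pass} {w w' : List Pass} (h : Del p q w w') (hq : j q = -j p)
    {r : Pass} (h1 : r ≠ p) (h2 : r ≠ q) : height j w' r = height j w r := by
  obtain ⟨s, hs, u, v, rfl, rfl⟩ := h
  have e : (s.map j).sum = 0 := by rw [(hs.map j).sum_eq]; simp [hq]
  have hr : r ∉ s := by rw [hs.mem_iff]; simp [h1, h2]
  by_cases h : r ∈ u
  · simp [height_append, h]
  · simp [height_append, h, hr, e]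

theorem Del.height_self {p q : Pass} {w w' : List Pass} (h : Del p q w w') (hq : j q = -j p)
    (hw : w.Nodup) : VirtualKnot.height j w q = VirtualKnot.height j w p + j p := by
  obtain ⟨s, hs, u, v, rfl, rfl⟩ := h
  rcases perm_pair.1 hs with rfl | rfl
  all_goals
    have h1 : p ∉ u := fun h => by simp [nodup_append] at hw; grind
    have h2 : q ∉ u := fun h => by simp [nodup_append] at hw; grind
    have h3 : p ≠ q := fun h => by simp [nodup_append, h] at hw
    have h4 : q ≠ p := h3.symm
    simp [height_append, h1, h2, h3, h4, hq]

theorem Swap.height {o : ℤ} {x y : Pass} {w w' : List Pass} (h : Swap o x y w w')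
    (hw : w.Nodup) (r : Pass) : VirtualKnot.height j w' r = VirtualKnot.height j w r +
      (if r = x then o * j y else 0) - (if r = y then o * j x else 0) := by
  obtain ⟨s, s', ho, u, v, rfl, rfl⟩ := h
  rcases ho with ⟨rfl, rfl, rfl⟩ | ⟨rfl, rfl, rfl⟩
  all_goals
    have h1 : x ∉ u := fun h => by simp [nodup_append] at hw; grind
    have h2 : y ∉ u := fun h => by simp [nodup_append] at hw; grind
    have h3 : x ≠ y := fun h => by simp [nodup_append, h] at hw
    have h4 : y ≠ x := h3.symm
    by_cases hx : r = x
    · subst hx; simp [height_append, h1, h3, h4]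
    by_cases hy : r = y
    · subst hy; simp [height_append, h2, h3, h4]
    have hx' := Ne.symm hx
    have hy' := Ne.symm hy
    simp only [height_append, hx, hy, mem_append, mem_cons, not_mem_nil, or_self, or_false]
    simp [hx', hy']
    split_ifs <;> ring

theorem flatWrithe_eq_sum {w : List Pass} (hw : w.Nodup) :
    flatWrithe n j w = -(w.map fun p => if flatInd j w p = n then j p else 0).sum := by
  rw [flatWrithe, List.sum_toFinset _ hw]

theorem Del.flatInd_kink (hj : IsJump j) {p : Pass} {w w' : List Pass} (h : Del p p.partner w w')
    {r : Pass} (h1 : r ≠ p) (h2 : r ≠ p.partner) : flatInd j w' r = flatInd j w r := by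
  have h3 : r.partner ≠ p := by rwa [ne_eq, Pass.partner_eq_comm]
  unfold flatInd
  rw [h.height (hj p) h1 h2, h.height (hj p) h3 (by simpa using h1)]

theorem Del.flatInd_kink_self (hj : IsJump j) {p : Pass} {w w' : List Pass}
    (h : Del p p.partner w w') (hw : w.Nodup) : flatInd j w p = 0 := by
  unfold flatInd
  rw [h.height_self (hj p) hw]; ring

theorem Del.flatWrithe_kink (hj : IsJump j) {p : Pass} {w w' : List Pass}
    (h : Del p p.partner w w') (hw : w.Nodup) : flatWrithe n j w = flatWrithe n j w' := by
  rw [flatWrithe_eq_sum hw, flatWrithe_eq_sum (h.nodup hw), (h.perm.map _).sum_eq]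
  have hn := h.perm.nodup_iff.1 hw
  simp only [nodup_cons, mem_cons, not_or] at hn
  have h0 := h.flatInd_kink_self hj hw
  have : ∀ r ∈ w', (if flatInd j w r = n then j r else 0)
      = if flatInd j w' r = n then j r else 0 := fun r hr => by
    rw [h.flatInd_kink hj (fun e => hn.1.2 (e ▸ hr)) (fun e => hn.2.1 (e ▸ hr))]
  rw [map_cons, map_cons, map_congr_left this, flatInd_partner hj, h0, hj p]
  simp only [neg_zero, sum_cons]
  split_ifs <;> ring

/-- The deletion of a bigon does not change the other flat indices. -/
theorem Del.flatInd_bigon (hj : IsJump j) {p q : Pass} {w w₁ w₂ : List Pass} (h : Del p q w w₁)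
    (h' : Del p.partner q.partner w₁ w₂) (hq : j q = -j p) {r : Pass} (h1 : r ≠ p) (h2 : r ≠ q)
    (h3 : r ≠ p.partner) (h4 : r ≠ q.partner) : flatInd j w₂ r = flatInd j w r := by
  have hq' : j q.partner = -j p.partner := by rw [hj, hj, hq]
  have h5 : r.partner ≠ p := by rwa [ne_eq, Pass.partner_eq_comm]
  have h6 : r.partner ≠ q := by rwa [ne_eq, Pass.partner_eq_comm]
  unfold flatInd
  rw [h'.height hq' h3 h4, h'.height hq' (by simpa using h1) (by simpa using h2),
    h.height hq h1 h2, h.height hq h5 h6]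

/-- The two crossings of a bigon have equal flat indices. -/
theorem Del.flatInd_bigon_self (hj : IsJump j) {p q : Pass} {w w₁ w₂ : List Pass}
    (h : Del p q w w₁) (h' : Del p.partner q.partner w₁ w₂) (hq : j q = -j p) (hw : w.Nodup) :
    flatInd j w q = flatInd j w p := by
  have hq' : j q.partner = -j p.partner := by rw [hj, hj, hq]
  have hn := (h.perm.trans ((h'.perm.cons q).cons p)).nodup_iff.1 hw
  simp only [nodup_cons, mem_cons, not_or] at hn
  have e := h'.height_self hq' (h.nodup hw)
  rw [h.height hq (Ne.symm hn.1.2.2.1) (by simp), h.height hq (by simp) (Ne.symm hn.2.1.1)] at e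
  unfold flatInd
  rw [h.height_self hq hw, e, hj, hq]; ring

/-- The two crossings of a bigon have opposite jumps and equal flat indices, so they cancel. -/
theorem Del.flatWrithe_bigon (hj : IsJump j) {p q : Pass} {w w₁ w₂ : List Pass}
    (h : Del p q w w₁) (h' : Del p.partner q.partner w₁ w₂) (hq : j q = -j p) (hw : w.Nodup) :
    flatWrithe n j w = flatWrithe n j w₂ := by
  have hp := h.perm.trans ((h'.perm.cons q).cons p)
  rw [flatWrithe_eq_sum hw, flatWrithe_eq_sum (h'.nodup (h.nodup hw)), (hp.map _).sum_eq]
  have hn := hp.nodup_iff.1 hw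
  simp only [nodup_cons, mem_cons, not_or] at hn
  have h0 := h.flatInd_bigon_self hj h' hq hw
  have : ∀ r ∈ w₂, (if flatInd j w r = n then j r else 0)
      = if flatInd j w₂ r = n then j r else 0 := fun r hr => by
    rw [h.flatInd_bigon hj h' hq] <;> grind
  rw [map_cons, map_cons, map_cons, map_cons, map_congr_left this, flatInd_partner hj,
    flatInd_partner hj, h0, hj p, hj q, hq]
  simp only [sum_cons]
  split_ifs <;> ring

/-- Three crossings `a`, `b`, `c` of three strands that form a triangle: the strands carry the
neighbouring passages `a` and `c.partner`, `b` and `a.partner`, `c` and `b.partner`, and `w'`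
arises from `w` by the exchange of these three pairs.  The orders `o₁`, `o₂`, `o₃` in which the
strands run through their crossings are proportional to the jumps of `b`, `c`, `a`. -/
structure Triangle (j : Pass → ℤ) (a b c : Pass) (o₁ o₂ o₃ : ℤ) (w w' : List Pass) : Prop where
  swaps : ∃ w₁ w₂, Swap o₁ a c.partner w w₁ ∧ Swap o₂ b a.partner w₁ w₂ ∧
    Swap o₃ c b.partner w₂ w'
  h₁₂ : o₁ * j c = o₂ * j b
  h₂₃ : o₂ * j a = o₃ * j c
  h₃₁ : o₃ * j b = o₁ * j a
  ab : a ≠ b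
  ab' : a ≠ b.partner
  bc : b ≠ c
  bc' : b ≠ c.partner
  ca : c ≠ a
  ca' : c ≠ a.partner

theorem Triangle.perm {a b c : Pass} {o₁ o₂ o₃ : ℤ} {w w' : List Pass}
    (h : Triangle j a b c o₁ o₂ o₃ w w') : w ~ w' := by
  obtain ⟨w₁, w₂, s₁, s₂, s₃⟩ := h.swaps
  exact s₁.perm.trans (s₂.perm.trans s₃.perm)

/-- At each of the three crossings the two exchanges that involve it shift the labels of both
incoming edges by the same amount. -/
theorem Triangle.flatInd (hj : IsJump j) {a b c : Pass} {o₁ o₂ o₃ : ℤ} {w w' : List Pass}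
    (h : Triangle j a b c o₁ o₂ o₃ w w') (hw : w.Nodup) (r : Pass) :
    flatInd j w' r = flatInd j w r := by
  obtain ⟨⟨w₁, w₂, s₁, s₂, s₃⟩, h₁₂, h₂₃, h₃₁, ab, ab', bc, bc', ca, ca'⟩ := h
  have n₁ := s₁.perm.nodup_iff.1 hw
  have n₂ := s₂.perm.nodup_iff.1 n₁
  have key : ∀ r, VirtualKnot.height j w' r - VirtualKnot.height j w r =
      (if r = a then o₁ * j c.partner else 0) - (if r = c.partner then o₁ * j a else 0) +
      (if r = b then o₂ * j a.partner else 0) - (if r = a.partner then o₂ * j b else 0) +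
      (if r = c then o₃ * j b.partner else 0) - (if r = b.partner then o₃ * j c else 0) := by
    intro r
    rw [s₃.height n₂, s₂.height n₁, s₁.height hw]; ring
  have k1 := key r
  have k2 := key r.partner
  have sym : ∀ x y : Pass, x.partner = y ↔ x = y.partner := fun _ _ => Pass.partner_eq_comm
  simp only [sym, Pass.partner_partner] at k1 k2
  have : VirtualKnot.height j w' r - VirtualKnot.height j w r
      = VirtualKnot.height j w' r.partner - VirtualKnot.height j w r.partner := by
    rw [k1, k2]
    have e1 : a ≠ c.partner := fun e => ca' (by rw [e]; simp)
    have e2 : b ≠ a.partner := fun e => ab' (by rw [e]; simp)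
    have e3 : c ≠ b.partner := fun e => bc' (by rw [e]; simp)
    by_cases ra : r = a
    · subst ra; simp [ab, ab', ca.symm, e1, hj c]; linarith
    by_cases rb : r = b
    · subst rb; simp [ab.symm, e2, bc, bc', hj a]; linarith
    by_cases rc : r = c
    · subst rc; simp [ca, ca', bc.symm, e3, hj b]; linarith
    by_cases ra' : r = a.partner
    · subst ra'; simp [e2.symm, ab, ca'.symm, ca.symm, hj c]; linarith
    by_cases rb' : r = b.partner
    · subst rb'; simp [ab.symm, ab'.symm, e3.symm, bc, hj a]; linarith
    by_cases rc' : r = c.partner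
    · subst rc'; simp [ca, e1.symm, bc'.symm, bc.symm, hj b]; linarith
    simp [*]
  unfold VirtualKnot.flatInd
  linarith

theorem Triangle.flatWrithe (hj : IsJump j) {a b c : Pass} {o₁ o₂ o₃ : ℤ} {w w' : List Pass}
    (h : Triangle j a b c o₁ o₂ o₃ w w') (hw : w.Nodup) :
    flatWrithe n j w = flatWrithe n j w' :=
  flatWrithe_congr_ind h.perm fun p _ _ => (h.flatInd hj hw p).symm

end

section

variable {j : Pass → ℤ} {n k m : ℤ}

/-! ### Arcs of cyclic words -/

theorem after_append_cons {u v : List Pass} {c : Pass} (hc : c ∉ u) :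
    after (u ++ c :: v) c = v ++ u := by
  have h1 : ∀ x ∈ u, decide (x ≠ c) = true := fun x hx => by
    simp only [ne_eq, decide_eq_true_eq]
    rintro rfl
    exact hc hx
  simp only [after]
  rw [dropWhile_append_of_pos h1, takeWhile_append_of_pos h1]
  simp

theorem after_append_comm {u v : List Pass} {c : Pass} (h : (u ++ v).Nodup) (hc : c ∈ u ++ v) :
    after (u ++ v) c = after (v ++ u) c := by
  have hd := (nodup_append'.1 h)
  rcases mem_append.1 hc with h1 | h1
  · have h2 : c ∉ v := hd.2.2 h1
    obtain ⟨u₁, u₂, rfl⟩ := append_of_mem h1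
    have h3 : c ∉ u₁ := fun h3 => by
      have := hd.1; simp [nodup_append] at this; grind
    rw [append_assoc, cons_append, after_append_cons h3, ← append_assoc v,
      after_append_cons (by simp [h2, h3])]
    simp
  · have h2 : c ∉ u := fun h2 => hd.2.2 h2 h1
    obtain ⟨u₁, u₂, rfl⟩ := append_of_mem h1
    have h3 : c ∉ u₁ := fun h3 => by
      have := hd.2.1; simp [nodup_append] at this; grind
    rw [append_assoc, cons_append, after_append_cons h3, ← append_assoc u,
      after_append_cons (by simp [h2, h3])]
    simp

theorem after_isRotated {w w' : List Pass} {c : Pass} (hw : w.Nodup) (hr : w ~r w')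
    (hc : c ∈ w) : after w c = after w' c := by
  obtain ⟨i, hi, rfl⟩ := isRotated_iff_mod.1 hr
  rw [rotate_eq_drop_append_take hi]
  conv_lhs => rw [← take_append_drop i w]
  exact after_append_comm (by simpa using hw) (by simpa using hc)

theorem after_eq {w l : List Pass} {c : Pass} (hw : w.Nodup) (hr : w ~r c :: l) :
    after w c = l := by
  rw [after_isRotated hw hr (hr.mem_iff.2 (by simp))]
  simpa using after_append_cons (u := []) (v := l) (c := c) (by simp)

theorem isRotated_append_of_eq {w w' : List Pass} (u v : List Pass) (h : w = u ++ v)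
    (h' : w' = v ++ u) : w ~r w' := by
  rw [h, h']; exact isRotated_append

theorem isRotated_cons_after {w : List Pass} {c : Pass} (hw : w.Nodup) (hc : c ∈ w) :
    w ~r c :: after w c := by
  obtain ⟨u, v, rfl⟩ := append_of_mem hc
  have h3 : c ∉ u := fun h3 => by simp [nodup_append] at hw; grind
  rw [after_append_cons h3]
  exact isRotated_append_of_eq u (c :: v) rfl rfl

theorem arc_isRotated {w w' : List Pass} {c : Pass} (hw : w.Nodup) (hr : w ~r w')
    (hc : c ∈ w) (d : Pass) : arc w c d = arc w' c d := by
  rw [arc, after_isRotated hw hr hc, arc]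

theorem arc_eq {w A B : List Pass} {c d : Pass} (hw : w.Nodup) (hr : w ~r c :: (A ++ d :: B)) :
    arc w c d = A := by
  have hn := hr.nodup_iff.1 hw
  have h1 : ∀ x ∈ A, decide (x ≠ d) = true := fun x hx => by
    simp [nodup_append] at hn ⊢; grind
  rw [arc, after_eq hw hr, takeWhile_append_of_pos h1]
  simp

theorem arc_eq' {w A B : List Pass} {c d : Pass} (hw : w.Nodup) (hr : w ~r c :: (A ++ d :: B)) :
    arc w d c = B :=
  arc_eq (B := A) hw (hr.trans (isRotated_append_of_eq (c :: A) (d :: B) (by simp) (by simp)))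

theorem isRotated_arcs {w : List Pass} {c d : Pass} (hw : w.Nodup) (hc : c ∈ w) (hd : d ∈ w)
    (h : c ≠ d) : w ~r c :: (arc w c d ++ d :: arc w d c) := by
  have h1 := isRotated_cons_after hw hc
  have h2 : d ∈ after w c := by
    have := h1.mem_iff.1 hd
    simpa [h.symm] using this
  obtain ⟨A, B, hAB⟩ := append_of_mem h2
  rw [hAB] at h1
  rwa [arc_eq hw h1, arc_eq' hw h1]

theorem nodup_after {w : List Pass} {c : Pass} (hw : w.Nodup) (hc : c ∈ w) :
    (c :: after w c).Nodup := (isRotated_cons_after hw hc).nodup_iff.1 hw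

theorem after_repl {w w' s s' : List Pass} {c : Pass} (hw : w.Nodup) (hw' : w'.Nodup)
    (h : Repl s s' w w') (hc : c ∈ w) (hs : c ∉ s) : Repl s s' (after w c) (after w' c) := by
  obtain ⟨u, v, rfl, rfl⟩ := h
  have h0 : c ∈ u ∨ c ∈ v := by simpa [hs] using hc
  rcases h0 with h0 | h0
  · obtain ⟨u₁, u₂, rfl⟩ := append_of_mem h0
    refine ⟨u₂, v ++ u₁, ?_, ?_⟩
    · exact after_eq hw (isRotated_append_of_eq u₁ (c :: u₂ ++ s ++ v) (by simp) (by simp))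
    · exact after_eq hw' (isRotated_append_of_eq u₁ (c :: u₂ ++ s' ++ v) (by simp) (by simp))
  · obtain ⟨u₁, u₂, rfl⟩ := append_of_mem h0
    refine ⟨u₂ ++ u, u₁, ?_, ?_⟩
    · exact after_eq hw (isRotated_append_of_eq (u ++ s ++ u₁) (c :: u₂) (by simp) (by simp))
    · exact after_eq hw' (isRotated_append_of_eq (u ++ s' ++ u₁) (c :: u₂) (by simp) (by simp))

/-- A local replacement takes place in one of the two arcs between `c` and `d`. -/
theorem arc_repl {w w' s s' : List Pass} {c d : Pass} (hw : w.Nodup) (hw' : w'.Nodup)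
    (h : Repl s s' w w') (hc : c ∈ w) (hd : d ∈ w) (hcd : c ≠ d) (hs : c ∉ s) (hs' : d ∉ s) :
    (Repl s s' (arc w c d) (arc w' c d) ∧ arc w d c = arc w' d c) ∨
      (arc w c d = arc w' c d ∧ Repl s s' (arc w d c) (arc w' d c)) := by
  obtain ⟨u, v, rfl, rfl⟩ := h
  have r : u ++ s ++ v ~r s ++ (v ++ u) :=
    isRotated_append_of_eq u (s ++ v) (by simp) (by simp)
  have r' : u ++ s' ++ v ~r s' ++ (v ++ u) :=
    isRotated_append_of_eq u (s' ++ v) (by simp) (by simp)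
  have hc' : c ∈ v ++ u := by simpa [hs] using r.mem_iff.1 hc
  have hd' : d ∈ v ++ u := by simpa [hs'] using r.mem_iff.1 hd
  obtain ⟨x, y, hxy⟩ := append_of_mem hc'
  rw [hxy] at r r' hd'
  have hd2 : d ∈ x ∨ d ∈ y := by simpa [hcd.symm] using hd'
  rcases hd2 with h0 | h0
  · obtain ⟨x₁, x₂, rfl⟩ := append_of_mem h0
    left
    have q := r.trans (isRotated_append_of_eq (w' := c :: ((y ++ s ++ x₁) ++ d :: x₂))
      (s ++ (x₁ ++ d :: x₂)) (c :: y) (by simp) (by simp))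
    have q' := r'.trans (isRotated_append_of_eq (w' := c :: ((y ++ s' ++ x₁) ++ d :: x₂))
      (s' ++ (x₁ ++ d :: x₂)) (c :: y) (by simp) (by simp))
    rw [arc_eq hw q, arc_eq hw' q', arc_eq' hw q, arc_eq' hw' q']
    exact ⟨⟨y, x₁, rfl, rfl⟩, rfl⟩
  · obtain ⟨x₁, x₂, rfl⟩ := append_of_mem h0
    right
    have q := r.trans (isRotated_append_of_eq (w' := c :: (x₁ ++ d :: (x₂ ++ s ++ x)))
      (s ++ x) (c :: x₁ ++ d :: x₂) (by simp) (by simp))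
    have q' := r'.trans (isRotated_append_of_eq (w' := c :: (x₁ ++ d :: (x₂ ++ s' ++ x)))
      (s' ++ x) (c :: x₁ ++ d :: x₂) (by simp) (by simp))
    rw [arc_eq hw q, arc_eq hw' q', arc_eq' hw q, arc_eq' hw' q']
    exact ⟨rfl, ⟨x₂, x, rfl, rfl⟩⟩

/-! ### Smoothings without change of names -/

/-- The jumps after the orientation of exactly one of the strings `A` and `B` has been reversed. -/
def mixedSign (A B : List Pass) (j : Pass → ℤ) (p : Pass) : ℤ :=
  if (p ∈ A ∧ p.partner ∈ B) ∨ (p ∈ B ∧ p.partner ∈ A) then -j p else j p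

theorem isJump_mixedSign (hj : IsJump j) (A B : List Pass) : IsJump (mixedSign A B j) := by
  intro p
  unfold mixedSign
  have : ((p.partner ∈ A ∧ p.partner.partner ∈ B) ∨ (p.partner ∈ B ∧ p.partner.partner ∈ A)) ↔
    ((p ∈ A ∧ p.partner ∈ B) ∨ (p ∈ B ∧ p.partner ∈ A)) := by simp; tauto
  simp only [this, hj p]
  split_ifs <;> rfl

theorem mixedSign_comm (A B : List Pass) (j : Pass → ℤ) : mixedSign A B j = mixedSign B A j := by
  funext p; unfold mixedSign; simp only [or_comm]

theorem mixedSign_congr {A B A' B' : List Pass} (hA : ∀ p, p ∈ A ↔ p ∈ A')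
    (hB : ∀ p, p ∈ B ↔ p ∈ B') : mixedSign A B j = mixedSign A' B' j := by
  funext p; simp only [mixedSign, hA, hB]

/-- The flat writhe of the knot that results from smoothing the crossing of `c` against the
orientation, where the loop that leaves along `c` keeps its orientation. -/
def smoothWrithe (n : ℤ) (j : Pass → ℤ) (w : List Pass) (c : Pass) : ℤ :=
  flatWrithe n (mixedSign (arc w c c.partner) (arc w c.partner c) j)
    (arc w c c.partner ++ (arc w c.partner c).reverse)

/-- The knot that results from smoothing the interlaced crossings of `c` and `d` along the
orientation. -/
def smoothTwo (w : List Pass) (c d : Pass) : List Pass :=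
  after (arc w c.partner c) d ++ after (arc w c c.partner) d.partner

/-- The crossings of `c` and `d` are interlaced, and `d` lies on the loop that ends at `c`. -/
def Linked (w : List Pass) (c d : Pass) : Prop :=
  d ∈ arc w c.partner c ∧ d.partner ∈ arc w c c.partner

instance (w : List Pass) (c d : Pass) : Decidable (Linked w c d) :=
  inferInstanceAs (Decidable (_ ∧ _))

/-- The weight with which a knot of writhe `x` enters the flat span. -/
def weight (m x : ℤ) : ℤ := (if x = m then 1 else 0) + (if x = -m then 1 else 0)

theorem weight_neg (m x : ℤ) : weight m (-x) = weight m x := by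
  unfold weight
  have h1 : -x = m ↔ x = -m := by omega
  have h2 : -x = -m ↔ x = m := by omega
  simp only [h1, h2]; ring

/-- The contribution of the crossing of `d` to the flat span of the link that results from
smoothing the crossing of `c`. -/
def spanTerm (k m : ℤ) (j : Pass → ℤ) (w : List Pass) (c d : Pass) : ℤ :=
  if Linked w c d then j d * weight m (flatWrithe k j (smoothTwo w c d)) else 0

/-- The flat span of the two-component link that results from smoothing the crossing of `c`. -/
def smoothSpan (k m : ℤ) (j : Pass → ℤ) (w : List Pass) (c : Pass) : ℤ :=
  ∑ d ∈ w.toFinset, spanTerm k m j w c d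

theorem perm_arcs {w : List Pass} (h : Closed w) {c : Pass} (hc : c ∈ w) :
    w ~ c :: c.partner :: (arc w c c.partner ++ arc w c.partner c) :=
  (isRotated_arcs h.1 hc (h.2 c hc) c.ne_partner).perm.trans
    (perm_middle.cons c)

theorem closed_arcs {w : List Pass} (h : Closed w) {c : Pass} (hc : c ∈ w) :
    Closed (arc w c c.partner ++ arc w c.partner c) := h.remove (perm_arcs h hc)

theorem closed_smooth {w : List Pass} (h : Closed w) {c : Pass} (hc : c ∈ w) :
    Closed (arc w c c.partner ++ (arc w c.partner c).reverse) :=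
  (closed_arcs h hc).perm ((reverse_perm _).symm.append_left _)

theorem nodup_arcs {w : List Pass} (hw : w.Nodup) {c d : Pass} (hc : c ∈ w) (hd : d ∈ w)
    (h : c ≠ d) : (arc w c d).Nodup ∧ (arc w d c).Nodup ∧ Disjoint (arc w c d) (arc w d c) ∧
      c ∉ arc w c d ∧ c ∉ arc w d c := by
  have := (isRotated_arcs hw hc hd h).nodup_iff.1 hw
  simp only [nodup_cons, nodup_append', mem_append, mem_cons, not_or, disjoint_cons_right] at this
  tauto

theorem perm_cons_after {w : List Pass} {c : Pass} (hw : w.Nodup) (hc : c ∈ w) :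
    w ~ c :: after w c := (isRotated_cons_after hw hc).perm

theorem nodup_arc {w : List Pass} (h : Closed w) {c : Pass} (hc : c ∈ w) :
    (arc w c c.partner).Nodup ∧ (arc w c.partner c).Nodup := by
  have := (closed_arcs h hc).1
  exact ⟨this.of_append_left, this.of_append_right⟩

theorem perm_smoothTwo {w : List Pass} (h : Closed w) {c d : Pass} (hc : c ∈ w)
    (hd : Linked w c d) : w ~ c :: c.partner :: d :: d.partner :: smoothTwo w c d := by
  refine (perm_arcs h hc).trans ((Perm.cons _ (Perm.cons _ ?_)))
  have h1 := perm_cons_after (nodup_arc h hc).1 hd.2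
  have h2 := perm_cons_after (nodup_arc h hc).2 hd.1
  refine perm_append_comm.trans ((h2.append h1).trans ?_)
  exact (perm_middle.cons d)

theorem closed_smoothTwo {w : List Pass} (h : Closed w) {c d : Pass} (hc : c ∈ w)
    (hd : Linked w c d) : Closed (smoothTwo w c d) :=
  (closed_arcs h hc).remove ((perm_cons _).1 ((perm_cons _).1
    ((perm_arcs h hc).symm.trans (perm_smoothTwo h hc hd))))

theorem Linked.ne {w : List Pass} (h : Closed w) {c d : Pass} (hc : c ∈ w) (hd : Linked w c d) :
    d ≠ c ∧ d ≠ c.partner := by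
  have hn := (perm_smoothTwo h hc hd).nodup_iff.1 h.1
  simp only [nodup_cons, mem_cons, not_or] at hn
  exact ⟨Ne.symm hn.1.2.1, Ne.symm hn.2.1.1⟩

theorem linked_partner {w : List Pass} {c d : Pass} :
    Linked w c.partner d.partner ↔ Linked w c d := by
  simp [Linked, and_comm]

/-- The interlaced crossings `c` and `d` in a normal form of the cyclic word. -/
theorem Linked.exists_arcs {w : List Pass} (h : Closed w) {c d : Pass} (hc : c ∈ w)
    (hd : Linked w c d) : ∃ a₁ a₂ b₁ b₂, w ~r c :: (a₁ ++ d.partner :: a₂ ++ c.partner ::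
      (b₁ ++ d :: b₂)) ∧ smoothTwo w c d = b₂ ++ b₁ ++ (a₂ ++ a₁) := by
  have h0 := isRotated_arcs h.1 hc (h.2 c hc) c.ne_partner
  obtain ⟨n1, n2⟩ := nodup_arc h hc
  obtain ⟨hd1, hd2⟩ := hd
  obtain ⟨a₁, a₂, ha⟩ := append_of_mem hd2
  obtain ⟨b₁, b₂, hb⟩ := append_of_mem hd1
  refine ⟨a₁, a₂, b₁, b₂, ?_, ?_⟩
  · rwa [ha, hb] at h0
  · rw [smoothTwo, after_eq n2 (l := b₂ ++ b₁), after_eq n1 (l := a₂ ++ a₁)]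
    · exact isRotated_append_of_eq a₁ (d.partner :: a₂) (by simp [ha]) (by simp)
    · exact isRotated_append_of_eq b₁ (d :: b₂) (by simp [hb]) (by simp)

/-- Smoothing of two interlaced crossings in a normal form of the cyclic word. -/
theorem smoothTwo_eq {w a₁ a₂ b₁ b₂ : List Pass} (hw : w.Nodup) {c d : Pass}
    (hr : w ~r c :: (a₁ ++ d.partner :: a₂ ++ c.partner :: (b₁ ++ d :: b₂))) :
    Linked w c d ∧ smoothTwo w c d = b₂ ++ b₁ ++ (a₂ ++ a₁) := by
  have e1 := arc_eq hw hr
  have e2 := arc_eq' hw hr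
  have hn := hr.nodup_iff.1 hw
  have n1 : (a₁ ++ d.partner :: a₂).Nodup := by
    simp only [nodup_cons, nodup_append'] at hn ⊢; tauto
  have n2 : (b₁ ++ d :: b₂).Nodup := by
    simp only [nodup_cons, nodup_append'] at hn ⊢; tauto
  refine ⟨⟨by simp [e2], by simp [e1]⟩, ?_⟩
  rw [smoothTwo, e1, e2, after_eq n1 (l := a₂ ++ a₁), after_eq n2 (l := b₂ ++ b₁)]
  · exact isRotated_append_of_eq b₁ (d :: b₂) (by simp) (by simp)
  · exact isRotated_append_of_eq a₁ (d.partner :: a₂) (by simp) (by simp)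

/-- Interlacement is symmetric, and so is the smoothing of both crossings. -/
theorem Linked.symm (hj : IsJump j) {w : List Pass} (h : Closed w) {c d : Pass} (hc : c ∈ w)
    (hd : Linked w c d) : Linked w d c.partner ∧
      flatWrithe n j (smoothTwo w c d) = flatWrithe n j (smoothTwo w d c.partner) := by
  obtain ⟨a₁, a₂, b₁, b₂, hr, he⟩ := hd.exists_arcs h hc
  have hr' : w ~r d :: (b₂ ++ c.partner.partner :: a₁ ++ d.partner :: (a₂ ++ c.partner :: b₁)) :=
    hr.trans (isRotated_append_of_eq (c :: (a₁ ++ d.partner :: a₂ ++ c.partner :: b₁)) (d :: b₂)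
      (by simp) (by simp))
  obtain ⟨l, e⟩ := smoothTwo_eq h.1 hr'
  refine ⟨l, ?_⟩
  have hcl := closed_smoothTwo h hc hd
  rw [e]
  rw [he] at hcl ⊢
  exact flatWrithe_isRotated hj hcl
    (isRotated_append_of_eq b₂ (b₁ ++ (a₂ ++ a₁)) (by simp) (by simp))

theorem flatWrithe_smoothTwo_partner (hj : IsJump j) {w : List Pass} (h : Closed w) {c d : Pass}
    (hc : c ∈ w) (hd : Linked w c d) :
    flatWrithe n j (smoothTwo w c.partner d.partner) = flatWrithe n j (smoothTwo w c d) := by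
  have hcl := closed_smoothTwo h hc hd
  unfold smoothTwo at hcl ⊢
  simp only [Pass.partner_partner]
  exact (flatWrithe_append_comm hj hcl).symm

theorem smoothWrithe_partner (hj : IsJump j) {w : List Pass} (h : Closed w) {c : Pass}
    (hc : c ∈ w) : smoothWrithe n j w c.partner = -smoothWrithe n j w c := by
  unfold smoothWrithe
  rw [Pass.partner_partner, mixedSign_comm,
    ← flatWrithe_reverse (isJump_mixedSign hj _ _) (closed_smooth h hc)]
  simp

theorem spanTerm_partner (hj : IsJump j) {w : List Pass} (h : Closed w) {c d : Pass}
    (hc : c ∈ w) : spanTerm k m j w c.partner d.partner = -spanTerm k m j w c d := by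
  unfold spanTerm
  by_cases hl : Linked w c d
  · rw [if_pos hl, if_pos (linked_partner.2 hl), flatWrithe_smoothTwo_partner hj h hc hl, hj]
    ring
  · rw [if_neg hl, if_neg (mt linked_partner.1 hl), neg_zero]

theorem smoothSpan_partner (hj : IsJump j) {w : List Pass} (h : Closed w) {c : Pass}
    (hc : c ∈ w) : smoothSpan k m j w c.partner = -smoothSpan k m j w c := by
  unfold smoothSpan
  rw [← sum_partner h, ← Finset.sum_neg_distrib]
  exact Finset.sum_congr rfl fun d _ => spanTerm_partner hj h hc

theorem smoothWrithe_isRotated {w w' : List Pass} (h : Closed w) (hr : w ~r w') {c : Pass}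
    (hc : c ∈ w) : smoothWrithe n j w c = smoothWrithe n j w' c := by
  unfold smoothWrithe
  rw [arc_isRotated h.1 hr hc, arc_isRotated h.1 hr (h.2 c hc)]

theorem spanTerm_isRotated {w w' : List Pass} (h : Closed w) (hr : w ~r w') {c : Pass}
    (hc : c ∈ w) (d : Pass) : spanTerm k m j w c d = spanTerm k m j w' c d := by
  have e1 : Linked w c d ↔ Linked w' c d := by
    simp only [Linked, arc_isRotated h.1 hr hc, arc_isRotated h.1 hr (h.2 c hc)]
  have e2 : smoothTwo w c d = smoothTwo w' c d := by
    simp only [smoothTwo, arc_isRotated h.1 hr hc, arc_isRotated h.1 hr (h.2 c hc)]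
  simp only [spanTerm, e1, e2]

theorem smoothSpan_isRotated {w w' : List Pass} (h : Closed w) (hr : w ~r w') {c : Pass}
    (hc : c ∈ w) : smoothSpan k m j w c = smoothSpan k m j w' c := by
  unfold smoothSpan
  rw [toFinset_eq_of_perm _ _ hr.perm]
  exact Finset.sum_congr rfl fun d _ => spanTerm_isRotated h hr hc d

end

section

variable {j : Pass → ℤ} {n k m : ℤ}

/-! ### Local replacements away from the smoothed crossings -/

theorem Repl.arc_mem_iff {w w' s s' : List Pass} {c d : Pass} (hw : w.Nodup) (hw' : w'.Nodup)
    (h : Repl s s' w w') (hc : c ∈ w) (hd : d ∈ w) (hcd : c ≠ d) (hs : c ∉ s) (hs' : d ∉ s)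
    {r : Pass} (hr : r ∉ s) (hr' : r ∉ s') : r ∈ arc w c d ↔ r ∈ arc w' c d := by
  rcases arc_repl hw hw' h hc hd hcd hs hs' with h1 | h1
  · exact h1.1.mem_iff hr hr'
  · rw [h1.1]

/-- A local replacement persists if another crossing is smoothed; it is reversed if it takes place
on the loop that is reversed. -/
theorem Repl.smooth {w w' s s' : List Pass} {c d : Pass} (hw : w.Nodup) (hw' : w'.Nodup)
    (h : Repl s s' w w') (hc : c ∈ w) (hd : d ∈ w) (hcd : c ≠ d) (hs : c ∉ s) (hs' : d ∉ s) :
    (s ⊆ arc w c d ∧ Repl s s' (arc w c d ++ (arc w d c).reverse)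
        (arc w' c d ++ (arc w' d c).reverse)) ∨
      (s ⊆ arc w d c ∧ Repl s.reverse s'.reverse (arc w c d ++ (arc w d c).reverse)
        (arc w' c d ++ (arc w' d c).reverse)) := by
  have sub : ∀ {x y : List Pass}, Repl s s' x y → s ⊆ x := by
    rintro x y ⟨u, v, rfl, -⟩ r hr
    simp [hr]
  rcases arc_repl hw hw' h hc hd hcd hs hs' with h1 | h1
  · left
    rw [h1.2]
    exact ⟨sub h1.1, h1.1.append_right _⟩
  · right
    rw [h1.1]
    exact ⟨sub h1.2, h1.2.reverse.append_left _⟩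

theorem Repl.smoothTwo {w w' s s' : List Pass} {c d : Pass} (hw : w.Nodup) (hw' : w'.Nodup)
    (h : Repl s s' w w') (hc : c ∈ w) (hc' : c.partner ∈ w) (hs : c ∉ s) (hs' : c.partner ∉ s)
    (hss : c ∉ s') (hss' : c.partner ∉ s')
    (hl : Linked w c d) (hd : d ∉ s) (hd' : d.partner ∉ s) :
    Repl s s' (smoothTwo w c d) (smoothTwo w' c d) := by
  have hn := nodup_arcs hw hc hc' c.ne_partner
  have hn' := nodup_arcs hw' ((h.mem_iff hs hss).1 hc) ((h.mem_iff hs' hss').1 hc') c.ne_partner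
  unfold VirtualKnot.smoothTwo
  rcases arc_repl hw hw' h hc hc' c.ne_partner hs hs' with h1 | h1
  · rw [h1.2]
    exact (after_repl hn.1 hn'.1 h1.1 hl.2 hd').append_left _
  · rw [h1.1]
    exact (after_repl hn.2.1 hn'.2.1 h1.2 hl.1 hd).append_right _

theorem Del.not_mem {p q : Pass} {w w' : List Pass} (h : Del p q w w') (hw : w.Nodup) :
    p ∉ w' ∧ q ∉ w' := by
  have hn := h.perm.nodup_iff.1 hw
  simp only [nodup_cons, mem_cons, not_or] at hn
  exact ⟨hn.1.2, hn.2.1⟩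

theorem Del.arc_mem_iff {p q : Pass} {w w' : List Pass} {c d : Pass} (hw : w.Nodup)
    (h : Del p q w w') (hc : c ∈ w') (hd : d ∈ w') (hcd : c ≠ d) {r : Pass} (hp : r ≠ p)
    (hq : r ≠ q) : r ∈ arc w c d ↔ r ∈ arc w' c d := by
  obtain ⟨n1, n2⟩ := h.not_mem hw
  have hw' := h.nodup hw
  have hm : w' ⊆ w := fun x hx => h.perm.mem_iff.2 (by simp [hx])
  obtain ⟨s, hs, h⟩ := h
  refine h.arc_mem_iff hw hw' (hm hc) (hm hd) hcd ?_ ?_ ?_ (by simp)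
  all_goals rw [hs.mem_iff]; simp; grind

theorem Del.smooth {p q : Pass} {w w' : List Pass} {c d : Pass} (hw : w.Nodup)
    (h : Del p q w w') (hc : c ∈ w') (hd : d ∈ w') (hcd : c ≠ d) :
    Del p q (arc w c d ++ (arc w d c).reverse) (arc w' c d ++ (arc w' d c).reverse) ∧
      (p ∈ arc w c d ↔ q ∈ arc w c d) ∧ (p ∈ arc w d c ↔ q ∈ arc w d c) := by
  obtain ⟨n1, n2⟩ := h.not_mem hw
  have hw' := h.nodup hw
  have hm : w' ⊆ w := fun x hx => h.perm.mem_iff.2 (by simp [hx])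
  obtain ⟨-, -, hdis, -⟩ := nodup_arcs hw (hm hc) (hm hd) hcd
  obtain ⟨s, hs, h⟩ := h
  have hp : p ∈ s := by rw [hs.mem_iff]; simp
  have hq : q ∈ s := by rw [hs.mem_iff]; simp
  have hcs : c ∉ s := by rw [hs.mem_iff]; simp; grind
  have hds : d ∉ s := by rw [hs.mem_iff]; simp; grind
  rcases h.smooth hw hw' (hm hc) (hm hd) hcd hcs hds with ⟨h1, h2⟩ | ⟨h1, h2⟩
  · exact ⟨⟨s, hs, h2⟩, iff_of_true (h1 hp) (h1 hq),
      iff_of_false (hdis (h1 hp)) (hdis (h1 hq))⟩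
  · exact ⟨⟨s.reverse, (reverse_perm s).trans hs, h2⟩,
      iff_of_false (fun h => hdis h (h1 hp)) (fun h => hdis h (h1 hq)),
      iff_of_true (h1 hp) (h1 hq)⟩

theorem Del.linked_iff {p q : Pass} {w w' : List Pass} {c d : Pass} (hw : w.Nodup)
    (h : Del p q w w') (hc : c ∈ w') (hc' : c.partner ∈ w') (h1 : d ≠ p) (h2 : d ≠ q)
    (h3 : d.partner ≠ p) (h4 : d.partner ≠ q) : Linked w c d ↔ Linked w' c d := by
  unfold Linked
  rw [h.arc_mem_iff hw hc' hc c.partner_ne h1 h2, h.arc_mem_iff hw hc hc' c.ne_partner h3 h4]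

theorem Del.smoothTwo {p q : Pass} {w w' : List Pass} {c d : Pass} (hw : w.Nodup)
    (h : Del p q w w') (hc : c ∈ w') (hc' : c.partner ∈ w') (hl : Linked w c d) (h1 : d ≠ p)
    (h2 : d ≠ q) (h3 : d.partner ≠ p) (h4 : d.partner ≠ q) :
    Del p q (smoothTwo w c d) (smoothTwo w' c d) := by
  obtain ⟨n1, n2⟩ := h.not_mem hw
  have hw' := h.nodup hw
  have hm : w' ⊆ w := fun x hx => h.perm.mem_iff.2 (by simp [hx])
  obtain ⟨s, hs, h⟩ := h
  refine ⟨s, hs, h.smoothTwo hw hw' (hm hc) (hm hc') ?_ ?_ (by simp) (by simp) hl ?_ ?_⟩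
  all_goals rw [hs.mem_iff]; simp; grind

theorem Swap.nodup {o : ℤ} {x y : Pass} {w w' : List Pass} (h : Swap o x y w w')
    (hw : w.Nodup) : w'.Nodup := h.perm.nodup_iff.1 hw

theorem Swap.exists_repl {o : ℤ} {x y : Pass} {w w' : List Pass} (h : Swap o x y w w') :
    ∃ s s', s ~ [x, y] ∧ s' ~ [x, y] ∧ Repl s s' w w' := by
  obtain ⟨s, s', ho, h⟩ := h
  refine ⟨s, s', ?_, ?_, h⟩
  · rcases ho with ⟨-, rfl, rfl⟩ | ⟨-, rfl, rfl⟩ <;> simp [perm_pair]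
  · rcases ho with ⟨-, rfl, rfl⟩ | ⟨-, rfl, rfl⟩ <;> simp [perm_pair]

theorem Swap.arc_mem_iff {o : ℤ} {x y : Pass} {w w' : List Pass} {c d : Pass} (hw : w.Nodup)
    (h : Swap o x y w w') (hc : c ∈ w) (hd : d ∈ w) (hcd : c ≠ d)
    (h1 : c ≠ x) (h2 : c ≠ y) (h3 : d ≠ x) (h4 : d ≠ y) {r : Pass} :
    r ∈ arc w c d ↔ r ∈ arc w' c d := by
  have hw' := h.nodup hw
  obtain ⟨s, s', hs, hs', h⟩ := h.exists_repl
  have e1 : c ∉ s := by rw [hs.mem_iff]; simp [h1, h2]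
  have e2 : d ∉ s := by rw [hs.mem_iff]; simp [h3, h4]
  rcases arc_repl hw hw' h hc hd hcd e1 e2 with ⟨⟨u, v, e, e'⟩, -⟩ | e
  · rw [e, e']; simp [hs.mem_iff, hs'.mem_iff]
  · rw [e.1]

theorem Swap.smooth {o : ℤ} {x y : Pass} {w w' : List Pass} {c d : Pass} (hw : w.Nodup)
    (h : Swap o x y w w') (hc : c ∈ w) (hd : d ∈ w) (hcd : c ≠ d)
    (h1 : c ≠ x) (h2 : c ≠ y) (h3 : d ≠ x) (h4 : d ≠ y) :
    (x ∈ arc w c d ∧ y ∈ arc w c d ∧ Swap o x y (arc w c d ++ (arc w d c).reverse)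
        (arc w' c d ++ (arc w' d c).reverse)) ∨
      (x ∈ arc w d c ∧ y ∈ arc w d c ∧ Swap (-o) x y (arc w c d ++ (arc w d c).reverse)
        (arc w' c d ++ (arc w' d c).reverse)) := by
  have hw' := h.nodup hw
  obtain ⟨s, s', ho, h⟩ := h
  have hs : s ~ [x, y] := by
    rcases ho with ⟨-, rfl, rfl⟩ | ⟨-, rfl, rfl⟩ <;> simp [perm_pair]
  have e1 : c ∉ s := by rw [hs.mem_iff]; simp [h1, h2]
  have e2 : d ∉ s := by rw [hs.mem_iff]; simp [h3, h4]
  have hx : x ∈ s := by rw [hs.mem_iff]; simp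
  have hy : y ∈ s := by rw [hs.mem_iff]; simp
  rcases h.smooth hw hw' hc hd hcd e1 e2 with ⟨h1, h2⟩ | ⟨h1, h2⟩
  · exact Or.inl ⟨h1 hx, h1 hy, s, s', ho, h2⟩
  · refine Or.inr ⟨h1 hx, h1 hy, s.reverse, s'.reverse, ?_, h2⟩
    rcases ho with ⟨rfl, rfl, rfl⟩ | ⟨rfl, rfl, rfl⟩ <;> simp

theorem Swap.linked_iff {o : ℤ} {x y : Pass} {w w' : List Pass} {c d : Pass} (hw : w.Nodup)
    (h : Swap o x y w w') (hc : c ∈ w) (hc' : c.partner ∈ w) (h1 : c ≠ x) (h2 : c ≠ y)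
    (h3 : c.partner ≠ x) (h4 : c.partner ≠ y) : Linked w c d ↔ Linked w' c d := by
  unfold Linked
  rw [h.arc_mem_iff hw hc' hc c.partner_ne h3 h4 h1 h2,
    h.arc_mem_iff hw hc hc' c.ne_partner h1 h2 h3 h4]

theorem Swap.smoothTwo {o : ℤ} {x y : Pass} {w w' : List Pass} {c d : Pass} (hw : w.Nodup)
    (h : Swap o x y w w') (hc : c ∈ w) (hc' : c.partner ∈ w) (h1 : c ≠ x) (h2 : c ≠ y)
    (h3 : c.partner ≠ x) (h4 : c.partner ≠ y) (hl : Linked w c d) (h5 : d ≠ x) (h6 : d ≠ y)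
    (h7 : d.partner ≠ x) (h8 : d.partner ≠ y) :
    Swap o x y (smoothTwo w c d) (smoothTwo w' c d) := by
  have hw' := h.nodup hw
  obtain ⟨s, s', ho, h⟩ := h
  have hs : s ~ [x, y] := by
    rcases ho with ⟨-, rfl, rfl⟩ | ⟨-, rfl, rfl⟩ <;> simp [perm_pair]
  have hs' : s' ~ [x, y] := by
    rcases ho with ⟨-, rfl, rfl⟩ | ⟨-, rfl, rfl⟩ <;> simp [perm_pair]
  refine ⟨s, s', ho, h.smoothTwo hw hw' hc hc' ?_ ?_ ?_ ?_ hl ?_ ?_⟩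
  all_goals first | rw [hs.mem_iff]; simp [*] | rw [hs'.mem_iff]; simp [*]

/-! ### Kinks -/

theorem Del.closed_kink {p : Pass} {w w' : List Pass} (hw : Closed w)
    (h : Del p p.partner w w') : Closed w' := hw.remove h.perm

theorem Del.smoothWrithe_kink (hj : IsJump j) {p : Pass} {w w' : List Pass} (hw : Closed w)
    (h : Del p p.partner w w') {c : Pass} (hc : c ∈ w') :
    smoothWrithe n j w c = smoothWrithe n j w' c := by
  have hw' := h.closed_kink hw
  have hc' := hw'.2 c hc
  have hm : w' ⊆ w := fun x hx => h.perm.mem_iff.2 (by simp [hx])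
  obtain ⟨h1, -, -⟩ := h.smooth hw.1 hc hc' c.ne_partner
  have hcl := closed_smooth hw' hc
  unfold smoothWrithe
  rw [h1.flatWrithe_kink (isJump_mixedSign hj _ _) (closed_smooth hw (hm hc)).1]
  refine flatWrithe_congr hcl.2 fun r hr => ?_
  have n1 := h1.not_mem (closed_smooth hw (hm hc)).1
  have e1 : r ≠ p := fun e => n1.1 (e ▸ hr)
  have e2 : r ≠ p.partner := fun e => n1.2 (e ▸ hr)
  have e3 : r.partner ≠ p := fun e => e2 (by simp [← e])
  have e4 : r.partner ≠ p.partner := by simpa using e1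
  simp only [mixedSign, h.arc_mem_iff hw.1 hc hc' c.ne_partner e1 e2,
    h.arc_mem_iff hw.1 hc hc' c.ne_partner e3 e4, h.arc_mem_iff hw.1 hc' hc c.partner_ne e1 e2,
    h.arc_mem_iff hw.1 hc' hc c.partner_ne e3 e4]

theorem sum_toFinset_perm {w w' : List Pass} (hw : w.Nodup) (h : w ~ w') (f : Pass → ℤ) :
    ∑ d ∈ w.toFinset, f d = (w'.map f).sum := by
  rw [List.sum_toFinset f hw, (h.map f).sum_eq]

theorem Del.smoothSpan_kink (hj : IsJump j) {p : Pass} {w w' : List Pass} (hw : Closed w)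
    (h : Del p p.partner w w') {c : Pass} (hc : c ∈ w') :
    smoothSpan k m j w c = smoothSpan k m j w' c := by
  have hw' := h.closed_kink hw
  have hc' := hw'.2 c hc
  have hm : w' ⊆ w := fun x hx => h.perm.mem_iff.2 (by simp [hx])
  obtain ⟨-, h2, h3⟩ := h.smooth hw.1 hc hc' c.ne_partner
  have hdis := (nodup_arcs hw.1 (hm hc) (hm hc') c.ne_partner).2.2.1
  have l1 : ¬ Linked w c p := fun hl => hdis hl.2 (h3.1 hl.1)
  have l2 : ¬ Linked w c p.partner := fun hl => hdis (h2.1 (by simpa using hl.2)) hl.1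
  unfold smoothSpan
  rw [sum_toFinset_perm hw.1 h.perm, List.sum_toFinset _ hw'.1, map_cons, map_cons]
  simp only [sum_cons]
  rw [spanTerm, if_neg l1, spanTerm, if_neg l2, zero_add, zero_add]
  congr 1
  refine map_congr_left fun r hr => ?_
  have n1 := h.not_mem hw.1
  have e1 : r ≠ p := fun e => n1.1 (e ▸ hr)
  have e2 : r ≠ p.partner := fun e => n1.2 (e ▸ hr)
  have e3 : r.partner ≠ p := fun e => e2 (by simp [← e])
  have e4 : r.partner ≠ p.partner := by simpa using e1
  have hl := h.linked_iff hw.1 hc hc' e1 e2 e3 e4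
  unfold spanTerm
  by_cases l : Linked w c r
  · rw [if_pos l, if_pos (hl.1 l),
      (h.smoothTwo hw.1 hc hc' l e1 e2 e3 e4).flatWrithe_kink hj (closed_smoothTwo hw (hm hc) l).1]
  · rw [if_neg l, if_neg (mt hl.2 l)]

/-- Smoothing the crossing of a kink reverses the orientation of the rest or does nothing, and
separates a circle without crossings. -/
theorem Del.kink_self (hj : IsJump j) {p : Pass} {w w' : List Pass} (hw : Closed w)
    (h : Del p p.partner w w') : (smoothWrithe n j w p = flatWrithe n j w' ∨
      smoothWrithe n j w p = -flatWrithe n j w') ∧ smoothSpan k m j w p = 0 := by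
  -- By symmetry the kink may be assumed to run from `p` to its partner.
  have key : ∀ p : Pass, ∀ u v : List Pass, Closed (u ++ [p, p.partner] ++ v) →
      smoothWrithe n j (u ++ [p, p.partner] ++ v) p = -flatWrithe n j (u ++ v) ∧
        smoothSpan k m j (u ++ [p, p.partner] ++ v) p = 0 := by
    intro p u v hc
    have hr : u ++ [p, p.partner] ++ v ~r p :: ([] ++ p.partner :: (v ++ u)) :=
      isRotated_append_of_eq u ([p, p.partner] ++ v) (by simp) (by simp)
    have e1 := arc_eq hc.1 hr
    have e2 := arc_eq' hc.1 hr
    have hcl : Closed (v ++ u) := hc.remove (c := p) (hr.perm.trans (by simp))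
    have hm : ∀ A : List Pass, mixedSign [] A j = j := fun A => by funext r; simp [mixedSign]
    constructor
    · rw [smoothWrithe, e1, e2, nil_append, hm, flatWrithe_reverse hj hcl,
        flatWrithe_append_comm hj hcl]
    · unfold smoothSpan
      refine Finset.sum_eq_zero fun d _ => ?_
      rw [spanTerm, if_neg]
      rintro ⟨-, hl⟩
      rw [e1] at hl
      simp at hl
  obtain ⟨s, hs, u, v, rfl, rfl⟩ := h
  rw [append_nil]
  have hp : p ∈ u ++ s ++ v := by simp [hs.mem_iff]
  rcases perm_pair.1 hs with rfl | rfl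
  · exact ⟨Or.inr (key p u v hw).1, (key p u v hw).2⟩
  · have := key p.partner u v (by simpa using hw)
    rw [Pass.partner_partner, smoothWrithe_partner hj hw hp, smoothSpan_partner hj hw hp] at this
    exact ⟨Or.inl (by omega), by omega⟩

end

section

variable {j : Pass → ℤ} {n k m : ℤ}

/-! ### Exchange of the names of two crossings -/

/-- The exchange of the names `x` and `y`, and accordingly of their partners. -/
def exch (x y p : Pass) : Pass :=
  if p = x then y else if p = y then x else if p = x.partner then y.partner
  else if p = y.partner then x.partner else p

@[simp] theorem exch_left (x y : Pass) : exch x y x = y := by simp [exch]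

@[simp] theorem exch_right (x y : Pass) : exch x y y = x := by
  by_cases h : y = x <;> simp [exch, h]

theorem exch_partner (x y p : Pass) : exch x y p.partner = (exch x y p).partner := by
  unfold exch
  simp only [Pass.partner_inj]
  have h1 : p.partner = x ↔ p = x.partner := Pass.partner_eq_comm
  have h2 : p.partner = y ↔ p = y.partner := Pass.partner_eq_comm
  simp only [h1, h2]
  by_cases a1 : p = x <;> by_cases a2 : p = y <;> by_cases a3 : p = x.partner <;>
    by_cases a4 : p = y.partner <;> simp_all

@[simp] theorem exch_left' (x y : Pass) : exch x y x.partner = y.partner := by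
  rw [exch_partner, exch_left]

@[simp] theorem exch_right' (x y : Pass) : exch x y y.partner = x.partner := by
  rw [exch_partner, exch_right]

theorem exch_of_ne {x y p : Pass} (h1 : p ≠ x) (h2 : p ≠ y) (h3 : p ≠ x.partner)
    (h4 : p ≠ y.partner) : exch x y p = p := by simp [exch, *]

theorem exch_exch (x y p : Pass) : exch x y (exch x y p) = p := by
  by_cases h1 : p = x
  · simp [h1]
  by_cases h2 : p = y
  · simp [h2]
  by_cases h3 : p = x.partner
  · simp [h3]
  by_cases h4 : p = y.partner
  · simp [h4]
  rw [exch_of_ne h1 h2 h3 h4, exch_of_ne h1 h2 h3 h4]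

theorem map_exch {x y : Pass} {w : List Pass} (h1 : x ∉ w) (h2 : y ∉ w) (h3 : x.partner ∉ w)
    (h4 : y.partner ∉ w) : w.map (exch x y) = w := by
  refine (map_congr_left fun p hp => ?_).trans (map_id' w)
  exact exch_of_ne (fun e => h1 (e ▸ hp)) (fun e => h2 (e ▸ hp)) (fun e => h3 (e ▸ hp))
    (fun e => h4 (e ▸ hp))

/-- The exchange of the names `x` and `y` preserves the flat writhe if the jumps are exchanged
accordingly. -/
theorem flatWrithe_exch {j' : Pass → ℤ} (hj : IsJump j) (hj' : IsJump j') {w : List Pass}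
    (hw : Closed w) {x y : Pass} (hx : x ∈ w → j' y = j x) (hy : y ∈ w → j' x = j y)
    (h : ∀ p ∈ w, p ≠ x → p ≠ y → p ≠ x.partner → p ≠ y.partner → j' p = j p) :
    flatWrithe n j' (w.map (exch x y)) = flatWrithe n j w := by
  refine flatWrithe_map hw.2 (fun p _ q _ e => ?_) (fun p _ => exch_partner x y p) ?_
  · simpa [exch_exch] using congrArg (exch x y) e
  · intro p hp
    by_cases h1 : p = x
    · subst h1; simpa using hx hp
    by_cases h2 : p = y
    · subst h2; simpa using hy hp
    by_cases h3 : p = x.partner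
    · subst h3; simp [hj x, hj' y, hx (hw.mem_partner.1 hp)]
    by_cases h4 : p = y.partner
    · subst h4; simp [hj y, hj' x, hy (hw.mem_partner.1 hp)]
    rw [exch_of_ne h1 h2 h3 h4, h p hp h1 h2 h3 h4]

/-! ### Bigons -/

/-- A bigon with the crossings of `p` and `q`: these have opposite jumps, and `w'` arises from `w`
by the deletion of the neighbouring passages `p`, `q` and of the neighbouring passages
`p.partner`, `q.partner`. -/
def Bigon (j : Pass → ℤ) (p q : Pass) (w w' : List Pass) : Prop :=
  j q = -j p ∧ ∃ w₁, Del p q w w₁ ∧ Del p.partner q.partner w₁ w'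

theorem Bigon.flatWrithe (hj : IsJump j) {p q : Pass} {w w' : List Pass} (h : Bigon j p q w w')
    (hw : w.Nodup) : flatWrithe n j w = flatWrithe n j w' := by
  obtain ⟨hq, w₁, h1, h2⟩ := h
  exact h1.flatWrithe_bigon hj h2 hq hw

theorem Bigon.perm {p q : Pass} {w w' : List Pass} (h : Bigon j p q w w') :
    w ~ p :: q :: p.partner :: q.partner :: w' := by
  obtain ⟨-, w₁, h1, h2⟩ := h
  exact h1.perm.trans ((h2.perm.cons q).cons p)

theorem Bigon.perm' {p q : Pass} {w w' : List Pass} (h : Bigon j p q w w') :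
    w ~ p :: p.partner :: q :: q.partner :: w' := h.perm.trans ((Perm.swap _ _ _).cons p)

theorem Bigon.closed {p q : Pass} {w w' : List Pass} (h : Bigon j p q w w') (hw : Closed w) :
    Closed w' :=
  (hw.remove h.perm').remove (Perm.refl _)

theorem Bigon.flatInd (hj : IsJump j) {p q : Pass} {w w' : List Pass} (h : Bigon j p q w w')
    (hw : w.Nodup) {r : Pass} (hr : r ∈ w') : flatInd j w r = flatInd j w' r := by
  have hn := h.perm.nodup_iff.1 hw
  simp only [nodup_cons, mem_cons, not_or] at hn
  obtain ⟨hq, w₁, h1, h2⟩ := h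
  rw [h1.flatInd_bigon hj h2 hq] <;> grind

theorem Bigon.flatInd_self (hj : IsJump j) {p q : Pass} {w w' : List Pass}
    (h : Bigon j p q w w') (hw : w.Nodup) : VirtualKnot.flatInd j w q = VirtualKnot.flatInd j w p := by
  obtain ⟨hq, w₁, h1, h2⟩ := h
  exact h1.flatInd_bigon_self hj h2 hq hw

theorem Bigon.ne {p q : Pass} {w w' : List Pass} (h : Bigon j p q w w') (hw : Closed w) {r : Pass}
    (hr : r ∈ w') : r ≠ p ∧ r ≠ q ∧ r ≠ p.partner ∧ r ≠ q.partner ∧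
      r.partner ≠ p ∧ r.partner ≠ q ∧ r.partner ≠ p.partner ∧ r.partner ≠ q.partner := by
  have hr' := (h.closed hw).2 r hr
  have hn := h.perm.nodup_iff.1 hw.1
  simp only [nodup_cons, mem_cons, not_or] at hn
  refine ⟨?_, ?_, ?_, ?_, ?_, ?_, ?_, ?_⟩ <;> (intro e; simp only [e] at hr hr'; tauto)

theorem Bigon.arc_mem_iff {p q : Pass} {w w' : List Pass} (h : Bigon j p q w w') (hw : Closed w)
    {c d : Pass} (hc : c ∈ w') (hd : d ∈ w') (hcd : c ≠ d) {r : Pass} (hr : r ∈ w') :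
    r ∈ arc w c d ↔ r ∈ arc w' c d := by
  obtain ⟨e1, e2, e3, e4, -⟩ := h.ne hw hr
  obtain ⟨-, w₁, h1, h2⟩ := h
  have hm : w' ⊆ w₁ := fun x hx => h2.perm.mem_iff.2 (by simp [hx])
  rw [h1.arc_mem_iff hw.1 (hm hc) (hm hd) hcd e1 e2,
    h2.arc_mem_iff (h1.nodup hw.1) hc hd hcd e3 e4]

/-- The neighbouring passages of a bigon lie on the same arc. -/
theorem Bigon.arc_mem_self {p q : Pass} {w w' : List Pass} (h : Bigon j p q w w') (hw : Closed w)
    {c d : Pass} (hc : c ∈ w') (hd : d ∈ w') (hcd : c ≠ d) :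
    (p ∈ arc w c d ↔ q ∈ arc w c d) ∧ (p.partner ∈ arc w c d ↔ q.partner ∈ arc w c d) := by
  have hn := h.perm.nodup_iff.1 hw.1
  simp only [nodup_cons, mem_cons, not_or] at hn
  obtain ⟨-, w₁, h1, h2⟩ := h
  have hm : w' ⊆ w₁ := fun x hx => h2.perm.mem_iff.2 (by simp [hx])
  refine ⟨(h1.smooth hw.1 (hm hc) (hm hd) hcd).2.1, ?_⟩
  rw [h1.arc_mem_iff hw.1 (hm hc) (hm hd) hcd (by simp) (Ne.symm hn.2.1.1),
    h1.arc_mem_iff hw.1 (hm hc) (hm hd) hcd (Ne.symm hn.1.2.2.1) (by simp)]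
  exact (h2.smooth (h1.nodup hw.1) hc hd hcd).2.1

/-- A bigon remains a bigon if another crossing is smoothed: the reversal of a strand changes the
jumps of both of its crossings or of neither. -/
theorem Bigon.smoothWrithe (hj : IsJump j) {p q : Pass} {w w' : List Pass}
    (h : Bigon j p q w w') (hw : Closed w) {c : Pass} (hc : c ∈ w') :
    smoothWrithe n j w c = smoothWrithe n j w' c := by
  have hw' := h.closed hw
  have hc' := hw'.2 c hc
  have hm' : w' ⊆ w := fun x hx => h.perm.mem_iff.2 (by simp [hx])
  have hcl := closed_smooth hw' hc
  have a1 := h.arc_mem_self hw hc hc' c.ne_partner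
  have a2 := h.arc_mem_self hw hc' hc c.partner_ne
  have hb : Bigon (mixedSign (arc w c c.partner) (arc w c.partner c) j) p q
      (arc w c c.partner ++ (arc w c.partner c).reverse)
      (arc w' c c.partner ++ (arc w' c.partner c).reverse) := by
    obtain ⟨hq, w₁, h1, h2⟩ := h
    have hm : w' ⊆ w₁ := fun x hx => h2.perm.mem_iff.2 (by simp [hx])
    refine ⟨?_, _, (h1.smooth hw.1 (hm hc) (hm hc') c.ne_partner).1,
      (h2.smooth (h1.nodup hw.1) hc hc' c.ne_partner).1⟩
    simp only [mixedSign, a1.1, a1.2, a2.1, a2.2, hq]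
    split_ifs <;> rfl
  unfold VirtualKnot.smoothWrithe
  rw [hb.flatWrithe (isJump_mixedSign hj _ _) (closed_smooth hw (hm' hc)).1]
  refine flatWrithe_congr hcl.2 fun r hr => ?_
  have hr1 : r ∈ w' := (perm_arcs hw' hc).mem_iff.2 (by
    have : r ∈ arc w' c c.partner ∨ r ∈ arc w' c.partner c := by simpa using hr
    simp [this])
  have hr2 := hw'.2 r hr1
  simp only [mixedSign, h.arc_mem_iff hw hc hc' c.ne_partner hr1,
    h.arc_mem_iff hw hc hc' c.ne_partner hr2, h.arc_mem_iff hw hc' hc c.partner_ne hr1,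
    h.arc_mem_iff hw hc' hc c.partner_ne hr2]

theorem Bigon.spanTerm (hj : IsJump j) {p q : Pass} {w w' : List Pass}
    (h : Bigon j p q w w') (hw : Closed w) {c d : Pass} (hc : c ∈ w') (hd : d ∈ w') :
    spanTerm k m j w c d = spanTerm k m j w' c d := by
  have hw' := h.closed hw
  have hc' := hw'.2 c hc
  have hd' := hw'.2 d hd
  have hm' : w' ⊆ w := fun x hx => h.perm.mem_iff.2 (by simp [hx])
  have hl : Linked w c d ↔ Linked w' c d := by
    unfold Linked
    rw [h.arc_mem_iff hw hc' hc c.partner_ne hd, h.arc_mem_iff hw hc hc' c.ne_partner hd']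
  unfold VirtualKnot.spanTerm
  by_cases l : Linked w c d
  · rw [if_pos l, if_pos (hl.1 l)]
    obtain ⟨e1, e2, e3, e4, e5, e6, e7, e8⟩ := h.ne hw hd
    obtain ⟨hq, w₁, h1, h2⟩ := h
    have hm : w' ⊆ w₁ := fun x hx => h2.perm.mem_iff.2 (by simp [hx])
    have l1 := (h1.linked_iff hw.1 (hm hc) (hm hc') e1 e2 e5 e6).1 l
    have hb : Bigon j p q (smoothTwo w c d) (smoothTwo w' c d) :=
      ⟨hq, _, h1.smoothTwo hw.1 (hm hc) (hm hc') l e1 e2 e5 e6,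
        h2.smoothTwo (h1.nodup hw.1) hc hc' l1 e3 e4 e7 e8⟩
    rw [hb.flatWrithe hj (closed_smoothTwo hw (hm' hc) l).1]
  · rw [if_neg l, if_neg (mt hl.2 l)]

/-- The two shapes of a bigon in a cyclic word: the strands are parallel or antiparallel. -/
def BigonShape (p q : Pass) (u v w : List Pass) : Prop :=
  w ~r p :: q :: (u ++ [p.partner, q.partner] ++ v) ∨
    w ~r p :: q :: (u ++ [q.partner, p.partner] ++ v)

/-- Another crossing that is interlaced with one crossing of a bigon is interlaced with both, and
after smoothing it together with either of them the same knot remains up to a kink or a name. -/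
theorem BigonShape.linked (hj : IsJump j) {p q : Pass} {u v w : List Pass}
    (hw : Closed w) (hs : BigonShape p q u v w) (hq : j q = -j p) {d : Pass}
    (hd : Linked w p d) (h1 : d ≠ q) (h2 : d ≠ q.partner) : Linked w q d ∧
      flatWrithe n j (smoothTwo w p d) = flatWrithe n j (smoothTwo w q d) := by
  rcases hs with hr | hr
  · have hn := hr.nodup_iff.1 hw.1
    have hr' : w ~r p :: ((q :: u) ++ p.partner :: (q.partner :: v)) := by simpa using hr
    have e1 := arc_eq hw.1 hr'
    have e2 := arc_eq' hw.1 hr'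
    have hdv : d ∈ v := by simpa [e2, h2] using hd.1
    have hdu : d.partner ∈ u := by
      have := hd.2
      rw [e1, mem_cons, Pass.partner_eq_comm] at this
      exact this.resolve_left h2
    obtain ⟨v₁, v₂, rfl⟩ := append_of_mem hdv
    obtain ⟨u₁, u₂, rfl⟩ := append_of_mem hdu
    have f1 := smoothTwo_eq (c := p) (d := d) (a₁ := q :: u₁) (a₂ := u₂) (b₁ := q.partner :: v₁)
      (b₂ := v₂) hw.1 (by simpa using hr)
    have f2 := smoothTwo_eq (c := q) (d := d) (a₁ := u₁) (a₂ := u₂ ++ [p.partner]) (b₁ := v₁)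
      (b₂ := v₂ ++ [p]) hw.1 (hr.trans (isRotated_append_of_eq [p]
        (q :: (u₁ ++ d.partner :: u₂ ++ [p.partner, q.partner] ++ (v₁ ++ d :: v₂)))
        (by simp) (by simp)))
    refine ⟨f2.1, ?_⟩
    have hcl := closed_smoothTwo hw (hr.mem_iff.2 (by simp)) hd
    rw [f1.2] at hcl ⊢
    rw [f2.2, ← flatWrithe_exch hj hj hcl (x := q) (y := p.partner) (by simp [hj p, hq])
      (by simp [hj p, hq]) (by simp)]
    simp only [nodup_cons, nodup_append, mem_append, mem_cons] at hn
    congr 1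
    simp only [map_append, map_cons, exch_left, exch_left', Pass.partner_partner]
    rw [map_exch (w := u₁), map_exch (w := u₂), map_exch (w := v₁), map_exch (w := v₂)]
    · simp
    all_goals grind [Pass.partner_partner]
  · have hn := hr.nodup_iff.1 hw.1
    have hr' : w ~r p :: ((q :: u ++ [q.partner]) ++ p.partner :: v) := by simpa using hr
    have e1 := arc_eq hw.1 hr'
    have e2 := arc_eq' hw.1 hr'
    have hdv : d ∈ v := by simpa [e2] using hd.1
    have hdu : d.partner ∈ u := by
      have := hd.2
      rw [e1] at this
      simpa [Pass.partner_eq_comm (q := q), h1, h2] using this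
    obtain ⟨v₁, v₂, rfl⟩ := append_of_mem hdv
    obtain ⟨u₁, u₂, rfl⟩ := append_of_mem hdu
    have f1 := smoothTwo_eq (c := p) (d := d) (a₁ := q :: u₁) (a₂ := u₂ ++ [q.partner]) (b₁ := v₁)
      (b₂ := v₂) hw.1 (by simpa using hr)
    have f2 := smoothTwo_eq (c := q) (d := d) (a₁ := u₁) (a₂ := u₂) (b₁ := p.partner :: v₁)
      (b₂ := v₂ ++ [p]) hw.1 (hr.trans (isRotated_append_of_eq [p]
        (q :: (u₁ ++ d.partner :: u₂ ++ [q.partner, p.partner] ++ (v₁ ++ d :: v₂)))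
        (by simp) (by simp)))
    refine ⟨f2.1, ?_⟩
    have c1 := closed_smoothTwo hw (hr.mem_iff.2 (by simp)) hd
    have c2 := closed_smoothTwo hw (hr.mem_iff.2 (by simp)) f2.1
    rw [f1.2] at c1 ⊢
    rw [f2.2] at c2 ⊢
    have k1 : Del q q.partner (v₂ ++ v₁ ++ (u₂ ++ [q.partner] ++ q :: u₁))
        (v₂ ++ v₁ ++ u₂ ++ u₁) := ⟨[q.partner, q], Perm.swap _ _ _, v₂ ++ v₁ ++ u₂, u₁, by simp, by simp⟩
    have k2 : Del p p.partner (v₂ ++ [p] ++ p.partner :: v₁ ++ (u₂ ++ u₁))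
        (v₂ ++ v₁ ++ u₂ ++ u₁) := ⟨[p, p.partner], Perm.refl _, v₂, v₁ ++ u₂ ++ u₁, by simp, by simp⟩
    rw [k1.flatWrithe_kink hj c1.1, k2.flatWrithe_kink hj c2.1]

/-- The smoothings of the two crossings of a bigon give knots of equal writhe. -/
theorem BigonShape.smoothWrithe (hj : IsJump j) {p q : Pass} {u v w : List Pass}
    (hw : Closed w) (hs : BigonShape p q u v w) (hq : j q = -j p) :
    smoothWrithe n j w p = smoothWrithe n j w q := by
  rcases hs with hr | hr
  -- For parallel strands the other crossing becomes a kink; for antiparallel strands both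
  -- smoothings differ only in the name of the other crossing.
  · have hn := hr.nodup_iff.1 hw.1
    have hp : w ~r p :: ((q :: u) ++ p.partner :: (q.partner :: v)) := by simpa using hr
    have hq : w ~r q :: ((u ++ [p.partner]) ++ q.partner :: (v ++ [p])) :=
      hr.trans (isRotated_append_of_eq [p] (q :: (u ++ [p.partner, q.partner] ++ v))
        (by simp) (by simp))
    have c1 := closed_smooth hw (c := p) (hr.mem_iff.2 (by simp))
    have c2 := closed_smooth hw (c := q) (hr.mem_iff.2 (by simp))
    unfold VirtualKnot.smoothWrithe
    rw [arc_eq hw.1 hp, arc_eq' hw.1 hp] at c1 ⊢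
    rw [arc_eq hw.1 hq, arc_eq' hw.1 hq] at c2 ⊢
    have r1 : q :: u ++ (q.partner :: v).reverse ~r [q.partner, q] ++ (u ++ v.reverse) :=
      isRotated_append_of_eq (q :: u ++ v.reverse) [q.partner] (by simp) (by simp)
    have c1' := c1.perm r1.perm
    have k1 : Del q q.partner ([q.partner, q] ++ (u ++ v.reverse)) (u ++ v.reverse) :=
      ⟨[q.partner, q], Perm.swap _ _ _, [], u ++ v.reverse, by simp, by simp⟩
    have k2 : Del p p.partner (u ++ [p.partner] ++ (v ++ [p]).reverse) (u ++ v.reverse) :=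
      ⟨[p.partner, p], Perm.swap _ _ _, u, v.reverse, by simp, by simp⟩
    rw [flatWrithe_isRotated (isJump_mixedSign hj _ _) c1 r1,
      k1.flatWrithe_kink (isJump_mixedSign hj _ _) c1'.1,
      k2.flatWrithe_kink (isJump_mixedSign hj _ _) c2.1]
    refine flatWrithe_congr (k1.closed_kink c1').2 fun r hr => ?_
    have hr' := (k1.closed_kink c1').2 r hr
    simp only [mem_append, mem_reverse] at hr hr'
    simp only [nodup_cons, nodup_append, mem_append, mem_cons] at hn
    have e1 : r ≠ q := by grind
    have e2 : r ≠ q.partner := by grind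
    have e3 : r ≠ p := by grind
    have e4 : r ≠ p.partner := by grind
    simp [mixedSign, e1, e2, e3, e4, Pass.partner_eq_comm]
  · have hn := hr.nodup_iff.1 hw.1
    have e1 : w ~r p :: ((q :: u ++ [q.partner]) ++ p.partner :: v) := by simpa using hr
    have e2 : w ~r q :: (u ++ q.partner :: (p.partner :: v ++ [p])) :=
      hr.trans (isRotated_append_of_eq [p] (q :: (u ++ [q.partner, p.partner] ++ v))
        (by simp) (by simp))
    have c1 := closed_smooth hw (c := p) (hr.mem_iff.2 (by simp))
    have c2 := closed_smooth hw (c := q) (hr.mem_iff.2 (by simp))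
    unfold VirtualKnot.smoothWrithe
    rw [arc_eq hw.1 e1, arc_eq' hw.1 e1] at c1 ⊢
    rw [arc_eq hw.1 e2, arc_eq' hw.1 e2] at c2 ⊢
    rw [flatWrithe_isRotated (isJump_mixedSign hj _ _) c2 (w' := p.partner :: u ++ [p] ++ v.reverse)
      (isRotated_append_of_eq (u ++ p :: v.reverse) [p.partner] (by simp) (by simp))]
    simp only [nodup_cons, nodup_append, mem_append, mem_cons] at hn
    have hu : ∀ r ∈ u, r ≠ q ∧ r ≠ q.partner ∧ r ≠ p ∧ r ≠ p.partner := by grind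
    have hv : ∀ r ∈ v, r ≠ q ∧ r ≠ q.partner ∧ r ≠ p ∧ r ≠ p.partner := by grind
    have hm : (q :: u ++ [q.partner] ++ v.reverse).map (exch q p.partner)
        = p.partner :: u ++ [p] ++ v.reverse := by
      simp only [map_append, map_cons, exch_left, exch_left', Pass.partner_partner, map_reverse,
        map_nil]
      rw [map_exch (w := u), map_exch (w := v)]
      all_goals grind [Pass.partner_partner]
    have pq : p ≠ q := by grind
    have pq' : p ≠ q.partner := by grind
    have qv : q ∉ v := by grind
    have qv' : q.partner ∉ v := by grind
    have pu : p ∉ u := by grind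
    have pu' : p.partner ∉ u := by grind
    have pv : p ∉ v := by grind
    have pv' : p.partner ∉ v := by grind
    rw [← hm]
    symm
    refine flatWrithe_exch (isJump_mixedSign hj _ _) (isJump_mixedSign hj _ _) c1 ?_ ?_ ?_
    · intro _
      simp [mixedSign, qv, qv', pu, pu', hj p, hq]
    · intro h
      exfalso
      simp [pv', pu', pq, Pass.partner_eq_comm, pq'] at h
    · intro r hr h1 h2 h3 h4
      rw [Pass.partner_partner] at h4
      simp [mixedSign, h1, h2, h3, h4, Pass.partner_eq_comm]

/-- The contributions of the two crossings of a bigon to the span at another crossing cancel. -/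
theorem Bigon.spanTerm_add (hj : IsJump j) {p q : Pass} {u v w w' : List Pass}
    (h : Bigon j p q w w') (hw : Closed w) (hs : BigonShape p q u v w) {c : Pass} (hc : c ∈ w') :
    VirtualKnot.spanTerm k m j w c p + VirtualKnot.spanTerm k m j w c q = 0 := by
  have hw' := h.closed hw
  have hc' := hw'.2 c hc
  have hcw : c ∈ w := h.perm.mem_iff.2 (by simp [hc])
  have hpw : p ∈ w := h.perm.mem_iff.2 (by simp)
  have hl : Linked w c p ↔ Linked w c q := by
    unfold Linked
    rw [(h.arc_mem_self hw hc' hc c.partner_ne).1, (h.arc_mem_self hw hc hc' c.ne_partner).2]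
  unfold VirtualKnot.spanTerm
  by_cases l : Linked w c p
  · rw [if_pos l, if_pos (hl.1 l), h.1]
    obtain ⟨l1, f1⟩ := l.symm (n := k) hj hw hcw
    obtain ⟨l2, f2⟩ := (hl.1 l).symm (n := k) hj hw hcw
    obtain ⟨-, e2, -, e4, -⟩ := h.ne hw hc'
    rw [f1, f2, (hs.linked hj hw h.1 l1 e2 e4).2]
    ring
  · rw [if_neg l, if_neg (mt hl.2 l), add_zero]

theorem Bigon.smoothSpan (hj : IsJump j) {p q : Pass} {u v w w' : List Pass}
    (h : Bigon j p q w w') (hw : Closed w) (hs : BigonShape p q u v w) {c : Pass} (hc : c ∈ w') :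
    smoothSpan k m j w c = smoothSpan k m j w' c := by
  have hw' := h.closed hw
  have hcw : c ∈ w := h.perm.mem_iff.2 (by simp [hc])
  have t1 := h.spanTerm_add (k := k) (m := m) hj hw hs hc
  have t2 := h.spanTerm_add (k := k) (m := m) hj hw hs (hw'.2 c hc)
  have s1 := spanTerm_partner (k := k) (m := m) (d := p) hj hw (hw.2 c hcw)
  have s2 := spanTerm_partner (k := k) (m := m) (d := q) hj hw (hw.2 c hcw)
  rw [Pass.partner_partner] at s1 s2
  unfold VirtualKnot.smoothSpan
  rw [sum_toFinset_perm hw.1 h.perm, List.sum_toFinset _ hw'.1]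
  simp only [map_cons, sum_cons]
  rw [s1, s2, map_congr_left fun d hd => h.spanTerm hj hw hc hd]
  linarith

theorem Linked.not_self {w : List Pass} (hw : Closed w) {c : Pass} (hc : c ∈ w) :
    ¬ Linked w c c ∧ ¬ Linked w c c.partner :=
  ⟨fun h => (h.ne hw hc).1 rfl, fun h => (h.ne hw hc).2 rfl⟩

theorem BigonShape.smoothSpan (hj : IsJump j) {p q : Pass} {u v w : List Pass}
    (hw : Closed w) (hs : BigonShape p q u v w) (hq : j q = -j p) :
    smoothSpan k m j w p = smoothSpan k m j w q := by
  have hperm : w ~ p :: p.partner :: q :: q.partner :: (u ++ v) := by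
    have e : ∀ x y z : Pass, x :: (u ++ [y, z] ++ v) ~ y :: x :: z :: (u ++ v) := by
      intro x y z
      have : u ++ [y, z] ++ v ~ [y, z] ++ (u ++ v) := by
        rw [← append_assoc]; exact perm_append_comm.append_right v
      exact (this.cons x).trans (Perm.swap _ _ _)
    rcases hs with hr | hr
    · exact hr.perm.trans ((e _ _ _).cons _)
    · exact hr.perm.trans (((e _ _ _).trans
        ((((Perm.swap _ _ _).cons _).trans (Perm.swap _ _ _)).trans
          ((Perm.swap _ _ _).cons _))).cons _)
  have hpw : p ∈ w := hperm.mem_iff.2 (by simp)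
  have hqw : q ∈ w := hperm.mem_iff.2 (by simp)
  have hn := hperm.nodup_iff.1 hw.1
  simp only [nodup_cons, mem_cons, not_or] at hn
  have np := Linked.not_self hw hpw
  have nq := Linked.not_self hw hqw
  -- The two crossings of the bigon contribute equal amounts to the span of each other.
  have sp : VirtualKnot.spanTerm k m j w p q + VirtualKnot.spanTerm k m j w p q.partner
      = VirtualKnot.spanTerm k m j w q p + VirtualKnot.spanTerm k m j w q p.partner := by
    rcases hs with hr | hr
    · have f1 := smoothTwo_eq (c := p) (d := q.partner) (a₁ := []) (a₂ := u) (b₁ := []) (b₂ := v)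
        hw.1 (by simpa using hr)
      have f2 := smoothTwo_eq (c := q) (d := p) (a₁ := u) (a₂ := []) (b₁ := v) (b₂ := [])
        hw.1 (hr.trans (isRotated_append_of_eq [p]
        (q :: (u ++ [p.partner, q.partner] ++ v)) (by simp) (by simp)))
      have hd1 := (nodup_arcs hw.1 hpw (hw.2 p hpw) p.ne_partner).2.2.1
      have hd2 := (nodup_arcs hw.1 hqw (hw.2 q hqw) q.ne_partner).2.2.1
      have g1 : ¬ Linked w p q := fun l => hd1 (by simpa using f1.1.2) l.1
      have g2 : ¬ Linked w q p.partner := fun l => hd2 f2.1.2 l.1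
      simp only [VirtualKnot.spanTerm, if_neg g1, if_neg g2, if_pos f1.1, if_pos f2.1, f1.2, f2.2,
        hj q, hq]
      simp
    · have hp : w ~r p :: ((q :: u ++ [q.partner]) ++ p.partner :: v) := by simpa using hr
      have hq : w ~r q :: (u ++ q.partner :: (p.partner :: v ++ [p])) :=
        hr.trans (isRotated_append_of_eq [p] (q :: (u ++ [q.partner, p.partner] ++ v))
          (by simp) (by simp))
      have a1 := arc_eq' hw.1 hp
      have a2 := arc_eq hw.1 hq
      have g1 : ¬ Linked w p q := fun l => by have := l.1; rw [a1] at this; simp_all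
      have g2 : ¬ Linked w p q.partner := fun l => by have := l.1; rw [a1] at this; simp_all
      have g3 : ¬ Linked w q p := fun l => by have := l.2; rw [a2] at this; simp_all
      have g4 : ¬ Linked w q p.partner := fun l => by have := l.2; rw [a2] at this; simp_all
      simp only [VirtualKnot.spanTerm, if_neg g1, if_neg g2, if_neg g3, if_neg g4]
  have hrest : ∀ d ∈ u ++ v, VirtualKnot.spanTerm k m j w p d
      = VirtualKnot.spanTerm k m j w q d := by
    intro d hd
    have d1 : d ≠ q := fun e => hn.2.2.1.2 (e ▸ hd)
    have d2 : d ≠ q.partner := fun e => hn.2.2.2.1 (e ▸ hd)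
    have hl : Linked w p d ↔ Linked w q d := by
      have d3 : d ≠ p := fun e => hn.1.2.2.2 (e ▸ hd)
      have d4 : d ≠ p.partner := fun e => hn.2.1.2.2 (e ▸ hd)
      unfold Linked
      rcases hs with hr | hr
      · have hp : w ~r p :: ((q :: u) ++ p.partner :: (q.partner :: v)) := by simpa using hr
        have hq : w ~r q :: ((u ++ [p.partner]) ++ q.partner :: (v ++ [p])) :=
          hr.trans (isRotated_append_of_eq [p] (q :: (u ++ [p.partner, q.partner] ++ v))
            (by simp) (by simp))
        rw [arc_eq hw.1 hp, arc_eq' hw.1 hp, arc_eq hw.1 hq, arc_eq' hw.1 hq]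
        simp [d1, d2, d3, d4, Pass.partner_eq_comm (p := d)]
      · have hp : w ~r p :: ((q :: u ++ [q.partner]) ++ p.partner :: v) := by simpa using hr
        have hq : w ~r q :: (u ++ q.partner :: (p.partner :: v ++ [p])) :=
          hr.trans (isRotated_append_of_eq [p] (q :: (u ++ [q.partner, p.partner] ++ v))
            (by simp) (by simp))
        rw [arc_eq hw.1 hp, arc_eq' hw.1 hp, arc_eq hw.1 hq, arc_eq' hw.1 hq]
        simp [d1, d2, d3, d4, Pass.partner_eq_comm (p := d)]
    unfold VirtualKnot.spanTerm
    by_cases l : Linked w p d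
    · rw [if_pos l, if_pos (hl.1 l), (hs.linked hj hw hq l d1 d2).2]
    · rw [if_neg l, if_neg (mt hl.2 l)]
  unfold VirtualKnot.smoothSpan
  rw [sum_toFinset_perm hw.1 hperm, sum_toFinset_perm hw.1 hperm]
  simp only [map_cons, sum_cons]
  rw [map_congr_left hrest]
  have z1 : VirtualKnot.spanTerm k m j w p p = 0 := if_neg np.1
  have z2 : VirtualKnot.spanTerm k m j w p p.partner = 0 := if_neg np.2
  have z3 : VirtualKnot.spanTerm k m j w q q = 0 := if_neg nq.1
  have z4 : VirtualKnot.spanTerm k m j w q q.partner = 0 := if_neg nq.2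
  rw [z1, z2, z3, z4]
  linarith

end

section

variable {j : Pass → ℤ} {n k m : ℤ}

/-! ### Triangles: crossings away from the triangle -/

/-- The passage `x` does not belong to the crossings of `a`, `b`, `c`. -/
def Away (a b c x : Pass) : Prop :=
  x ≠ a ∧ x ≠ a.partner ∧ x ≠ b ∧ x ≠ b.partner ∧ x ≠ c ∧ x ≠ c.partner

theorem Away.partner {a b c x : Pass} (h : Away a b c x) : Away a b c x.partner := by
  unfold Away at *
  simp only [ne_eq, Pass.partner_eq_comm, Pass.partner_partner]
  tauto

theorem Triangle.arc_mem_iff {a b c : Pass} {o₁ o₂ o₃ : ℤ} {w w' : List Pass}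
    (h : Triangle j a b c o₁ o₂ o₃ w w') (hw : w.Nodup) {x y : Pass} (hx : x ∈ w) (hy : y ∈ w)
    (hxy : x ≠ y) (ax : Away a b c x) (ay : Away a b c y) {r : Pass} :
    r ∈ arc w x y ↔ r ∈ arc w' x y := by
  obtain ⟨w₁, w₂, s₁, s₂, s₃⟩ := h.swaps
  obtain ⟨x1, x2, x3, x4, x5, x6⟩ := ax
  obtain ⟨y1, y2, y3, y4, y5, y6⟩ := ay
  have n₁ := s₁.nodup hw
  have n₂ := s₂.nodup n₁
  rw [s₁.arc_mem_iff hw hx hy hxy x1 x6 y1 y6,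
    s₂.arc_mem_iff n₁ (s₁.perm.mem_iff.1 hx) (s₁.perm.mem_iff.1 hy) hxy x3 x2 y3 y2,
    s₃.arc_mem_iff n₂ (s₂.perm.mem_iff.1 (s₁.perm.mem_iff.1 hx))
      (s₂.perm.mem_iff.1 (s₁.perm.mem_iff.1 hy)) hxy x5 x4 y5 y4]

/-- A triangle remains a triangle if another crossing is smoothed: the reversal of a strand changes
the order on this strand and the jumps at both of its crossings. -/
theorem Triangle.smooth {a b c : Pass} {o₁ o₂ o₃ : ℤ} {w w' : List Pass}
    (h : Triangle j a b c o₁ o₂ o₃ w w') (hw : w.Nodup) {x y : Pass} (hx : x ∈ w) (hy : y ∈ w)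
    (hxy : x ≠ y) (ax : Away a b c x) (ay : Away a b c y) :
    ∃ p₁ p₂ p₃, Triangle (mixedSign (arc w x y) (arc w y x) j) a b c p₁ p₂ p₃
      (arc w x y ++ (arc w y x).reverse) (arc w' x y ++ (arc w' y x).reverse) := by
  obtain ⟨-, -, hdis, -⟩ := nodup_arcs hw hx hy hxy
  obtain ⟨⟨w₁, w₂, s₁, s₂, s₃⟩, h₁₂, h₂₃, h₃₁, ab, ab', bc, bc', ca, ca'⟩ := h
  obtain ⟨x1, x2, x3, x4, x5, x6⟩ := ax
  obtain ⟨y1, y2, y3, y4, y5, y6⟩ := ay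
  have n₁ := s₁.nodup hw
  have n₂ := s₂.nodup n₁
  have hx₁ := s₁.perm.mem_iff.1 hx
  have hy₁ := s₁.perm.mem_iff.1 hy
  have hx₂ := s₂.perm.mem_iff.1 hx₁
  have hy₂ := s₂.perm.mem_iff.1 hy₁
  have t₁ := s₁.smooth hw hx hy hxy x1 x6 y1 y6
  have t₂ := s₂.smooth n₁ hx₁ hy₁ hxy x3 x2 y3 y2
  have t₃ := s₃.smooth n₂ hx₂ hy₂ hxy x5 x4 y5 y4
  have m₁ : ∀ r, r ∈ arc w₁ x y ↔ r ∈ arc w x y := fun r =>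
    (s₁.arc_mem_iff hw hx hy hxy x1 x6 y1 y6).symm
  have m₁' : ∀ r, r ∈ arc w₁ y x ↔ r ∈ arc w y x := fun r =>
    (s₁.arc_mem_iff hw hy hx hxy.symm y1 y6 x1 x6).symm
  have m₂ : ∀ r, r ∈ arc w₂ x y ↔ r ∈ arc w x y := fun r =>
    ((m₁ r).symm.trans (s₂.arc_mem_iff n₁ hx₁ hy₁ hxy x3 x2 y3 y2)).symm
  have m₂' : ∀ r, r ∈ arc w₂ y x ↔ r ∈ arc w y x := fun r =>
    ((m₁' r).symm.trans (s₂.arc_mem_iff n₁ hy₁ hx₁ hxy.symm y3 y2 x3 x2)).symm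
  simp only [m₁, m₁'] at t₂
  simp only [m₂, m₂'] at t₃
  have notB : ∀ {r}, r ∈ arc w x y → r ∉ arc w y x := fun h1 h2 => hdis h1 h2
  have notA : ∀ {r}, r ∈ arc w y x → r ∉ arc w x y := fun h1 h2 => hdis h2 h1
  rcases t₁ with ⟨u1, u2, u3⟩ | ⟨u1, u2, u3⟩ <;> rcases t₂ with ⟨v1, v2, v3⟩ | ⟨v1, v2, v3⟩ <;>
    rcases t₃ with ⟨z1, z2, z3⟩ | ⟨z1, z2, z3⟩ <;>
    refine ⟨_, _, _, ⟨_, _, u3, v3, z3⟩, ?_, ?_, ?_, ab, ab', bc, bc', ca, ca'⟩ <;>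
    simp [mixedSign, u1, u2, v1, v2, z1, z2, notA, notB, h₁₂, h₂₃, h₃₁]

theorem Triangle.smoothTwo {a b c : Pass} {o₁ o₂ o₃ : ℤ} {w w' : List Pass}
    (h : Triangle j a b c o₁ o₂ o₃ w w') (hw : w.Nodup) {x d : Pass} (hx : x ∈ w)
    (hx' : x.partner ∈ w) (ax : Away a b c x) (ad : Away a b c d) (hl : Linked w x d) :
    Triangle j a b c o₁ o₂ o₃ (smoothTwo w x d) (smoothTwo w' x d) := by
  obtain ⟨⟨w₁, w₂, s₁, s₂, s₃⟩, h₁₂, h₂₃, h₃₁, ab, ab', bc, bc', ca, ca'⟩ := h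
  obtain ⟨y1, y2, y3, y4, y5, y6⟩ := ax.partner
  obtain ⟨x1, x2, x3, x4, x5, x6⟩ := ax
  obtain ⟨e1, e2, e3, e4, e5, e6⟩ := ad.partner
  obtain ⟨d1, d2, d3, d4, d5, d6⟩ := ad
  have n₁ := s₁.nodup hw
  have n₂ := s₂.nodup n₁
  have hx₁ := s₁.perm.mem_iff.1 hx
  have hy₁ := s₁.perm.mem_iff.1 hx'
  have hx₂ := s₂.perm.mem_iff.1 hx₁
  have hy₂ := s₂.perm.mem_iff.1 hy₁
  have l₁ := (s₁.linked_iff hw hx hx' x1 x6 y1 y6).1 hl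
  have l₂ := (s₂.linked_iff n₁ hx₁ hy₁ x3 x2 y3 y2).1 l₁
  exact ⟨⟨_, _, s₁.smoothTwo hw hx hx' x1 x6 y1 y6 hl d1 d6 e1 e6,
    s₂.smoothTwo n₁ hx₁ hy₁ x3 x2 y3 y2 l₁ d3 d2 e3 e2,
    s₃.smoothTwo n₂ hx₂ hy₂ x5 x4 y5 y4 l₂ d5 d4 e5 e4⟩, h₁₂, h₂₃, h₃₁, ab, ab', bc, bc', ca, ca'⟩

theorem Triangle.smoothWrithe (hj : IsJump j) {a b c : Pass} {o₁ o₂ o₃ : ℤ} {w w' : List Pass}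
    (h : Triangle j a b c o₁ o₂ o₃ w w') (hw : Closed w) {x : Pass} (hx : x ∈ w)
    (ax : Away a b c x) : smoothWrithe n j w x = smoothWrithe n j w' x := by
  have hx' := hw.2 x hx
  obtain ⟨p₁, p₂, p₃, ht⟩ := h.smooth hw.1 hx hx' x.ne_partner ax ax.partner
  unfold VirtualKnot.smoothWrithe
  rw [ht.flatWrithe (isJump_mixedSign hj _ _) (closed_smooth hw hx).1]
  congr 1
  exact mixedSign_congr (fun r => h.arc_mem_iff hw.1 hx hx' x.ne_partner ax ax.partner)
    (fun r => h.arc_mem_iff hw.1 hx' hx x.partner_ne ax.partner ax)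

theorem Triangle.linked_iff {a b c : Pass} {o₁ o₂ o₃ : ℤ} {w w' : List Pass}
    (h : Triangle j a b c o₁ o₂ o₃ w w') (hw : Closed w) {x d : Pass} (hx : x ∈ w)
    (ax : Away a b c x) : Linked w x d ↔ Linked w' x d := by
  have hx' := hw.2 x hx
  unfold Linked
  rw [h.arc_mem_iff hw.1 hx hx' x.ne_partner ax ax.partner,
    h.arc_mem_iff hw.1 hx' hx x.partner_ne ax.partner ax]

theorem Triangle.spanTerm (hj : IsJump j) {a b c : Pass} {o₁ o₂ o₃ : ℤ} {w w' : List Pass}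
    (h : Triangle j a b c o₁ o₂ o₃ w w') (hw : Closed w) {x d : Pass} (hx : x ∈ w)
    (ax : Away a b c x) (ad : Away a b c d) :
    spanTerm k m j w x d = spanTerm k m j w' x d := by
  have hl := h.linked_iff hw hx ax (d := d)
  unfold VirtualKnot.spanTerm
  by_cases l : Linked w x d
  · rw [if_pos l, if_pos (hl.1 l), (h.smoothTwo hw.1 hx (hw.2 x hx) ax ad l).flatWrithe hj
      (closed_smoothTwo hw hx l).1]
  · rw [if_neg l, if_neg (mt hl.2 l)]

/-! ### Triangles: smoothing of a crossing of the triangle -/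

/-- The crossings of `a`, `b`, `c` and the rest `U ++ V ++ Z` of a word are distinct. -/
theorem away_of_perm {a b c : Pass} {w U V Z : List Pass} (hw : Closed w)
    (hp : w ~ a :: a.partner :: b :: b.partner :: c :: c.partner :: (U ++ V ++ Z)) :
    (∀ r ∈ U ++ V ++ Z, Away a b c r) ∧ Away b c c a ∧ Away a c c b ∧ Away a b b c := by
  have hn := hp.nodup_iff.1 hw.1
  simp only [nodup_cons, mem_cons, not_or] at hn
  unfold Away
  refine ⟨fun r hr => ?_, ?_⟩
  · refine ⟨?_, ?_, ?_, ?_, ?_, ?_⟩ <;> rintro rfl <;> tauto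
  · have sym : ∀ x y : Pass, x.partner = y ↔ x = y.partner := fun _ _ => Pass.partner_eq_comm
    grind

/-- The exchange of the names `b` and `c.partner` reverses the third strand of the triangle. -/
theorem exch_pair {b c : Pass} {s : List Pass} (hs : s ~ [c, b.partner]) :
    s.map (exch b c.partner) = s.reverse := by
  have h1 : exch b c.partner c = b.partner := by
    simpa using exch_right' b c.partner
  rcases perm_pair.1 hs with rfl | rfl <;> simp [h1]

section Positive

/-! The strand through `a` and `c.partner` meets the crossing of `a` first, and the strand through
`b` and `a.partner` meets the crossing of `b` first. -/

variable {a b c : Pass} {U V Z s w w' : List Pass}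

theorem pos_arcs (hw : w.Nodup)
    (hr : w ~r [a, c.partner] ++ U ++ [b, a.partner] ++ V ++ s ++ Z) :
    arc w a a.partner = c.partner :: U ++ [b] ∧ arc w a.partner a = V ++ s ++ Z := by
  have h : w ~r a :: ((c.partner :: U ++ [b]) ++ a.partner :: (V ++ s ++ Z)) := by simpa using hr
  exact ⟨arc_eq hw h, arc_eq' hw h⟩

theorem pos_arcs' (hw : w'.Nodup)
    (hr : w' ~r [c.partner, a] ++ U ++ [a.partner, b] ++ V ++ s ++ Z) :
    arc w' a a.partner = U ∧ arc w' a.partner a = b :: V ++ s ++ Z ++ [c.partner] := by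
  have h : w' ~r a :: (U ++ a.partner :: (b :: V ++ s ++ Z ++ [c.partner])) :=
    hr.trans (isRotated_append_of_eq [c.partner] (a :: U ++ [a.partner, b] ++ V ++ s ++ Z)
      (by simp) (by simp))
  exact ⟨arc_eq hw h, arc_eq' hw h⟩

/-- In this position the two smoothed knots differ only in the names of the crossings of `b` and
`c`. -/
theorem pos_smoothWrithe (hj : IsJump j) (hs : s ~ [c, b.partner]) (hbc : j c = j b)
    (hw : Closed w) (hw' : Closed w')
    (hp : w ~ a :: a.partner :: b :: b.partner :: c :: c.partner :: (U ++ V ++ Z))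
    (hr : w ~r [a, c.partner] ++ U ++ [b, a.partner] ++ V ++ s ++ Z)
    (hr' : w' ~r [c.partner, a] ++ U ++ [a.partner, b] ++ V ++ s.reverse ++ Z) :
    smoothWrithe n j w a = smoothWrithe n j w' a := by
  obtain ⟨a1, a2⟩ := pos_arcs hw.1 hr
  obtain ⟨b1, b2⟩ := pos_arcs' hw'.1 hr'
  obtain ⟨hout, -, hb, hc⟩ := away_of_perm hw hp
  have c1 := closed_smooth hw (c := a) (hp.mem_iff.2 (by simp))
  have c2 := closed_smooth hw' (c := a) (hr'.mem_iff.2 (by simp))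
  unfold smoothWrithe
  rw [a1, a2] at c1 ⊢
  rw [b1, b2] at c2 ⊢
  rw [flatWrithe_isRotated (isJump_mixedSign hj _ _) c2
    (w' := b :: U ++ [c.partner] ++ (Z.reverse ++ s ++ V.reverse))
    (isRotated_append_of_eq (U ++ [c.partner] ++ (Z.reverse ++ s ++ V.reverse)) [b]
      (by simp) (by simp))]
  simp only [mem_append] at hout
  have hU : b ∉ U ∧ b.partner ∉ U ∧ c ∉ U ∧ c.partner ∉ U := by unfold Away at hout; grind
  have hV : b ∉ V ∧ b.partner ∉ V ∧ c ∉ V ∧ c.partner ∉ V := by unfold Away at hout; grind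
  have hZ : b ∉ Z ∧ b.partner ∉ Z ∧ c ∉ Z ∧ c.partner ∉ Z := by unfold Away at hout; grind
  obtain ⟨-, -, c3, c4, -, -⟩ := hc
  have c5 : b ≠ c.partner := hb.2.2.2.1
  have hm : (c.partner :: U ++ [b] ++ (V ++ s ++ Z).reverse).map (exch b c.partner)
      = b :: U ++ [c.partner] ++ (Z.reverse ++ s ++ V.reverse) := by
    simp only [map_append, map_cons, map_reverse, reverse_append, exch_left, exch_right, map_nil,
      exch_pair hs, reverse_reverse]
    rw [map_exch (w := U), map_exch (w := V), map_exch (w := Z)]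
    · simp
    all_goals simp [hU, hV, hZ]
  rw [← hm]
  symm
  refine flatWrithe_exch (isJump_mixedSign hj _ _) (isJump_mixedSign hj _ _) c1 ?_ ?_ ?_
  · intro _
    simp [mixedSign, hU, hV, hZ, hs.mem_iff, hj c, hbc]
  · intro _
    simp [mixedSign, hU, hV, hZ, hs.mem_iff, hj c, hbc, c5]
  · intro r hr h1 h2 h3 h4
    rw [Pass.partner_partner] at h4
    simp [mixedSign, hs.mem_iff, h1, h2, h3, h4, Pass.partner_eq_comm]

end Positive

end

section

variable {j : Pass → ℤ} {n k m : ℤ}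

theorem bigon_of_pairs (hj : IsJump j) {b c : Pass} (hbc : j c = j b) {u v z s t : List Pass}
    (hs : s ~ [b, c.partner]) (ht : t ~ [c, b.partner]) :
    Bigon j b c.partner (u ++ s ++ v ++ t ++ z) (u ++ v ++ z) ∧
      Bigon j b c.partner (u ++ t ++ v ++ s ++ z) (u ++ v ++ z) := by
  have ht' : t ~ [b.partner, c.partner.partner] := by
    rw [Pass.partner_partner]; exact ht.trans (Perm.swap _ _ _)
  have hq : j c.partner = -j b := by rw [hj, hbc]
  constructor
  · exact ⟨hq, u ++ v ++ t ++ z, ⟨s, hs, u, v ++ t ++ z, by simp, by simp⟩,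
      ⟨t, ht', u ++ v, z, by simp, by simp⟩⟩
  · exact ⟨hq, u ++ t ++ v ++ z, ⟨s, hs, u ++ t ++ v, z, by simp, by simp⟩,
      ⟨t, ht', u, v ++ z, by simp, by simp⟩⟩

theorem flatWrithe_bigon_of_pairs (hj : IsJump j) {b c : Pass} (hbc : j c = j b)
    {u v z s t : List Pass} (hs : s ~ [b, c.partner]) (ht : t ~ [c, b.partner])
    (hc : (u ++ s ++ v ++ t ++ z).Nodup) :
    flatWrithe n j (u ++ s ++ v ++ t ++ z) = flatWrithe n j (u ++ v ++ z) :=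
  (bigon_of_pairs hj hbc hs ht).1.flatWrithe hj hc

theorem flatWrithe_bigon_of_pairs' (hj : IsJump j) {b c : Pass} (hbc : j c = j b)
    {u v z s t : List Pass} (hs : s ~ [b, c.partner]) (ht : t ~ [c, b.partner])
    (hc : (u ++ t ++ v ++ s ++ z).Nodup) :
    flatWrithe n j (u ++ t ++ v ++ s ++ z) = flatWrithe n j (u ++ v ++ z) :=
  (bigon_of_pairs hj hbc hs ht).2.flatWrithe hj hc

/-- The passages of the triangle do not occur in the rest of the word. -/
theorem not_mem_of_away {a b c : Pass} {L : List Pass} (h : ∀ r ∈ L, Away a b c r) :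
    b ∉ L ∧ b.partner ∉ L ∧ c ∉ L ∧ c.partner ∉ L := by
  unfold Away at h
  refine ⟨fun hb => ?_, fun hb => ?_, fun hb => ?_, fun hb => ?_⟩ <;> have := h _ hb <;> tauto

section Positive

variable {a b c : Pass} {U V Z s w w' : List Pass}

theorem pos_linked (hs : s ~ [c, b.partner]) (hw : Closed w) (hw' : Closed w')
    (hr : w ~r [a, c.partner] ++ U ++ [b, a.partner] ++ V ++ s ++ Z)
    (hr' : w' ~r [c.partner, a] ++ U ++ [a.partner, b] ++ V ++ s.reverse ++ Z)
    {d : Pass} (hd : Away a b c d) : (Linked w a d ↔ d.partner ∈ U ∧ (d ∈ V ∨ d ∈ Z)) ∧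
      (Linked w' a d ↔ d.partner ∈ U ∧ (d ∈ V ∨ d ∈ Z)) := by
  obtain ⟨a1, a2⟩ := pos_arcs hw.1 hr
  obtain ⟨b1, b2⟩ := pos_arcs' hw'.1 hr'
  obtain ⟨d1, d2, d3, d4, d5, d6⟩ := hd
  unfold Linked
  rw [a1, a2, b1, b2]
  simp [hs.mem_iff, d3, d4, d5, d6, Pass.partner_eq_comm (p := d), and_comm]

/-- In this position the crossings of `b` and `c` form a bigon after the smoothing of `a` and `d`,
on both sides of the move. -/
theorem pos_smoothTwo (hj : IsJump j) (hs : s ~ [c, b.partner]) (hbc : j c = j b)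
    (hw : Closed w) (hw' : Closed w')
    (hr : w ~r [a, c.partner] ++ U ++ [b, a.partner] ++ V ++ s ++ Z)
    (hr' : w' ~r [c.partner, a] ++ U ++ [a.partner, b] ++ V ++ s.reverse ++ Z)
    {d : Pass} (hd : Away a b c d) (hl : Linked w a d) :
    flatWrithe n j (smoothTwo w a d) = flatWrithe n j (smoothTwo w' a d) := by
  obtain ⟨l1, l2⟩ := pos_linked hs hw hw' hr hr' hd
  have c1 := (closed_smoothTwo hw (c := a) (hr.mem_iff.2 (by simp)) hl).1
  have c2 := (closed_smoothTwo hw' (c := a) (hr'.mem_iff.2 (by simp)) (l2.2 (l1.1 hl))).1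
  obtain ⟨hU, hVZ⟩ := l1.1 hl
  obtain ⟨U₁, U₂, rfl⟩ := append_of_mem hU
  have hs' : s.reverse ~ [c, b.partner] := (reverse_perm s).trans hs
  rcases hVZ with hV | hV <;> obtain ⟨V₁, V₂, rfl⟩ := append_of_mem hV
  · have f1 := smoothTwo_eq (c := a) (d := d) (a₁ := c.partner :: U₁) (a₂ := U₂ ++ [b])
      (b₁ := V₁) (b₂ := V₂ ++ s ++ Z) hw.1 (by simpa using hr)
    have f2 := smoothTwo_eq (c := a) (d := d) (a₁ := U₁) (a₂ := U₂)
      (b₁ := b :: V₁) (b₂ := V₂ ++ s.reverse ++ Z ++ [c.partner]) hw'.1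
      (hr'.trans (isRotated_append_of_eq [c.partner] (a :: (U₁ ++ d.partner :: U₂) ++
        [a.partner, b] ++ (V₁ ++ d :: V₂) ++ s.reverse ++ Z) (by simp) (by simp)))
    have g1 : smoothTwo w a d = V₂ ++ s ++ (Z ++ V₁ ++ U₂) ++ [b, c.partner] ++ U₁ := by
      simpa using f1.2
    have g2 : smoothTwo w' a d = V₂ ++ s.reverse ++ Z ++ [c.partner, b] ++ (V₁ ++ U₂ ++ U₁) := by
      simpa using f2.2
    rw [g1] at c1 ⊢
    rw [g2] at c2 ⊢
    rw [flatWrithe_bigon_of_pairs' hj hbc (Perm.refl _) hs c1,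
      flatWrithe_bigon_of_pairs' hj hbc (Perm.swap _ _ _) hs' c2]
    simp
  · have f1 := smoothTwo_eq (c := a) (d := d) (a₁ := c.partner :: U₁) (a₂ := U₂ ++ [b])
      (b₁ := V ++ s ++ V₁) (b₂ := V₂) hw.1 (by simpa using hr)
    have f2 := smoothTwo_eq (c := a) (d := d) (a₁ := U₁) (a₂ := U₂)
      (b₁ := b :: V ++ s.reverse ++ V₁) (b₂ := V₂ ++ [c.partner]) hw'.1
      (hr'.trans (isRotated_append_of_eq [c.partner] (a :: (U₁ ++ d.partner :: U₂) ++
        [a.partner, b] ++ V ++ s.reverse ++ (V₁ ++ d :: V₂)) (by simp) (by simp)))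
    have g1 : smoothTwo w a d = (V₂ ++ V) ++ s ++ (V₁ ++ U₂) ++ [b, c.partner] ++ U₁ := by
      simpa using f1.2
    have g2 : smoothTwo w' a d = V₂ ++ [c.partner, b] ++ V ++ s.reverse ++ (V₁ ++ U₂ ++ U₁) := by
      simpa using f2.2
    rw [g1] at c1 ⊢
    rw [g2] at c2 ⊢
    rw [flatWrithe_bigon_of_pairs' hj hbc (Perm.refl _) hs c1,
      flatWrithe_bigon_of_pairs hj hbc (Perm.swap _ _ _) hs' c2]
    simp

/-- The contributions of the other two crossings of the triangle cancel on one side of the move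
and vanish on the other side. -/
theorem pos_spanTerm (hj : IsJump j) (hs : s ~ [c, b.partner]) (hbc : j c = j b)
    (hw : Closed w) (hw' : Closed w')
    (hp : w ~ a :: a.partner :: b :: b.partner :: c :: c.partner :: (U ++ V ++ Z))
    (hr : w ~r [a, c.partner] ++ U ++ [b, a.partner] ++ V ++ s ++ Z)
    (hr' : w' ~r [c.partner, a] ++ U ++ [a.partner, b] ++ V ++ s.reverse ++ Z) :
    spanTerm k m j w a b + spanTerm k m j w a b.partner + spanTerm k m j w a c +
      spanTerm k m j w a c.partner =
    spanTerm k m j w' a b + spanTerm k m j w' a b.partner + spanTerm k m j w' a c +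
      spanTerm k m j w' a c.partner := by
  obtain ⟨a1, a2⟩ := pos_arcs hw.1 hr
  obtain ⟨b1, b2⟩ := pos_arcs' hw'.1 hr'
  obtain ⟨hout, -, hb, hc⟩ := away_of_perm hw hp
  obtain ⟨U1, U2, U3, U4⟩ := not_mem_of_away (L := U) fun r hr => hout r (by simp [hr])
  obtain ⟨V1, V2, V3, V4⟩ := not_mem_of_away (L := V) fun r hr => hout r (by simp [hr])
  obtain ⟨Z1, Z2, Z3, Z4⟩ := not_mem_of_away (L := Z) fun r hr => hout r (by simp [hr])
  have c5 : b ≠ c.partner := hb.2.2.2.1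
  have c6 : b ≠ c := hb.2.2.1
  have c5' : c.partner ≠ b := c5.symm
  have c8 : c ≠ b := c6.symm
  have hs' : s.reverse ~ [c, b.partner] := (reverse_perm s).trans hs
  have n1 : ¬ Linked w a b := by
    unfold Linked; rw [a1, a2]; simp [hs.mem_iff, *]
  have n2 : ¬ Linked w a c.partner := by
    unfold Linked; rw [a1, a2]; simp [hs.mem_iff, *]
  have m1 : ¬ Linked w' a b := by
    unfold Linked; rw [b1, b2]; simp [hs.mem_iff, *]
  have m2 : ¬ Linked w' a b.partner := by
    unfold Linked; rw [b1, b2]; simp [hs.mem_iff, *]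
  have m3 : ¬ Linked w' a c := by
    unfold Linked; rw [b1, b2]; simp [hs.mem_iff, *]
  have m4 : ¬ Linked w' a c.partner := by
    unfold Linked; rw [b1, b2]; simp [hs.mem_iff, *]
  have l1 : Linked w a b.partner := by
    unfold Linked; rw [a1, a2]; simp [hs.mem_iff]
  have l2 : Linked w a c := by
    unfold Linked; rw [a1, a2]; simp [hs.mem_iff]
  have ha : a ∈ w := hr.mem_iff.2 (by simp)
  have k1 := closed_smoothTwo hw ha l1
  have k2 := closed_smoothTwo hw ha l2
  have key : flatWrithe k j (smoothTwo w a b.partner) = flatWrithe k j (smoothTwo w a c) := by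
    rcases perm_pair.1 hs with rfl | rfl
    · have f1 := smoothTwo_eq (c := a) (d := b.partner) (a₁ := c.partner :: U) (a₂ := [])
        (b₁ := V ++ [c]) (b₂ := Z) hw.1 (by simpa using hr)
      have f2 := smoothTwo_eq (c := a) (d := c) (a₁ := []) (a₂ := U ++ [b])
        (b₁ := V) (b₂ := b.partner :: Z) hw.1 (by simpa using hr)
      have d1 : Del c c.partner (smoothTwo w a b.partner) (Z ++ V ++ U) :=
        ⟨[c, c.partner], Perm.refl _, Z ++ V, U, by simp [f1.2], by simp⟩
      have r2 : smoothTwo w a c ~r [b, b.partner] ++ (Z ++ V ++ U) :=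
        isRotated_append_of_eq (b.partner :: Z ++ V ++ U) [b] (by simp [f2.2]) (by simp)
      have d2 : Del b b.partner ([b, b.partner] ++ (Z ++ V ++ U)) (Z ++ V ++ U) :=
        ⟨[b, b.partner], Perm.refl _, [], Z ++ V ++ U, by simp, by simp⟩
      rw [d1.flatWrithe_kink hj k1.1, flatWrithe_isRotated hj k2 r2,
        d2.flatWrithe_kink hj (r2.nodup_iff.1 k2.1)]
    · have f1 := smoothTwo_eq (c := a) (d := b.partner) (a₁ := c.partner :: U) (a₂ := [])
        (b₁ := V) (b₂ := c :: Z) hw.1 (by simpa using hr)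
      have f2 := smoothTwo_eq (c := a) (d := c) (a₁ := []) (a₂ := U ++ [b])
        (b₁ := V ++ [b.partner]) (b₂ := Z) hw.1 (by simpa using hr)
      have r2 : smoothTwo w a c ~r b :: Z ++ V ++ [b.partner] ++ U :=
        isRotated_append_of_eq (Z ++ V ++ [b.partner] ++ U) [b] (by simp [f2.2]) (by simp)
      have e : b :: Z ++ V ++ [b.partner] ++ U = (smoothTwo w a b.partner).map (exch b c) := by
        rw [f1.2]
        simp only [map_append, map_cons, exch_right, exch_right', map_nil]
        rw [map_exch (w := U), map_exch (w := V), map_exch (w := Z)] <;> simp [*]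
      rw [flatWrithe_isRotated hj k2 r2, e,
        flatWrithe_exch hj hj k1 (by simp [hbc]) (by simp [hbc]) (by simp)]
  simp only [spanTerm, if_neg n1, if_neg n2, if_neg m1, if_neg m2, if_neg m3, if_neg m4, if_pos l1,
    if_pos l2, key, hj b, hbc]
  ring

end Positive

section Negative

/-! The strand through `a` and `c.partner` meets the crossing of `a` first, and the strand through
`b` and `a.partner` meets the crossing of `a` first. -/

variable {a b c : Pass} {U V Z s w w' : List Pass}

theorem neg_arcs (hw : w.Nodup)
    (hr : w ~r [a, c.partner] ++ U ++ [a.partner, b] ++ V ++ s ++ Z) :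
    arc w a a.partner = c.partner :: U ∧ arc w a.partner a = b :: V ++ s ++ Z := by
  have h : w ~r a :: ((c.partner :: U) ++ a.partner :: (b :: V ++ s ++ Z)) := by simpa using hr
  exact ⟨arc_eq hw h, arc_eq' hw h⟩

theorem neg_arcs' (hw : w'.Nodup)
    (hr : w' ~r [c.partner, a] ++ U ++ [b, a.partner] ++ V ++ s ++ Z) :
    arc w' a a.partner = U ++ [b] ∧ arc w' a.partner a = V ++ s ++ Z ++ [c.partner] := by
  have h : w' ~r a :: ((U ++ [b]) ++ a.partner :: (V ++ s ++ Z ++ [c.partner])) :=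
    hr.trans (isRotated_append_of_eq [c.partner] (a :: U ++ [b, a.partner] ++ V ++ s ++ Z)
      (by simp) (by simp))
  exact ⟨arc_eq hw h, arc_eq' hw h⟩

/-- In this position the crossings of `b` and `c` form a bigon in the smoothed knot, on both sides
of the move. -/
theorem neg_smoothWrithe (hj : IsJump j) (hs : s ~ [c, b.partner]) (hbc : j c = -j b)
    (hw : Closed w) (hw' : Closed w')
    (hp : w ~ a :: a.partner :: b :: b.partner :: c :: c.partner :: (U ++ V ++ Z))
    (hr : w ~r [a, c.partner] ++ U ++ [a.partner, b] ++ V ++ s ++ Z)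
    (hr' : w' ~r [c.partner, a] ++ U ++ [b, a.partner] ++ V ++ s.reverse ++ Z) :
    smoothWrithe n j w a = smoothWrithe n j w' a := by
  obtain ⟨a1, a2⟩ := neg_arcs hw.1 hr
  obtain ⟨b1, b2⟩ := neg_arcs' hw'.1 hr'
  obtain ⟨hout, -, hb, hc⟩ := away_of_perm hw hp
  have c1 := closed_smooth hw (c := a) (hp.mem_iff.2 (by simp))
  have c2 := closed_smooth hw' (c := a) (hr'.mem_iff.2 (by simp))
  obtain ⟨U1, U2, U3, U4⟩ := not_mem_of_away (L := U) fun r hr => hout r (by simp [hr])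
  obtain ⟨V1, V2, V3, V4⟩ := not_mem_of_away (L := V) fun r hr => hout r (by simp [hr])
  obtain ⟨Z1, Z2, Z3, Z4⟩ := not_mem_of_away (L := Z) fun r hr => hout r (by simp [hr])
  have c5 : b ≠ c.partner := hb.2.2.2.1
  have c6 : b ≠ c := hb.2.2.1
  have c5' : c.partner ≠ b := c5.symm
  have c7 : c ≠ b.partner := hc.2.2.2.1
  have c8 : c ≠ b := c6.symm
  have hs' : s.reverse ~ [c, b.partner] := (reverse_perm s).trans hs
  unfold smoothWrithe
  rw [a1, a2] at c1 ⊢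
  rw [b1, b2] at c2 ⊢
  have r1 : c.partner :: U ++ (b :: V ++ s ++ Z).reverse ~r
      [] ++ [b, c.partner] ++ (U ++ Z.reverse) ++ s.reverse ++ V.reverse :=
    isRotated_append_of_eq (c.partner :: U ++ (V ++ s ++ Z).reverse) [b] (by simp) (by simp)
  have e2 : U ++ [b] ++ (V ++ s.reverse ++ Z ++ [c.partner]).reverse =
      U ++ [b, c.partner] ++ Z.reverse ++ s ++ V.reverse := by simp
  have c1' := c1.perm r1.perm
  rw [e2] at c2 ⊢
  rw [flatWrithe_isRotated (isJump_mixedSign hj _ _) c1 r1,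
    flatWrithe_bigon_of_pairs (isJump_mixedSign hj _ _) _ (Perm.refl _) hs' c1'.1,
    flatWrithe_bigon_of_pairs (isJump_mixedSign hj _ _) _ (Perm.refl _) hs c2.1]
  · have hcl : Closed (U ++ Z.reverse ++ V.reverse) :=
      (bigon_of_pairs (isJump_mixedSign hj (c.partner :: U) (b :: V ++ s ++ Z))
        (u := []) (v := U ++ Z.reverse) (z := V.reverse)
        (by simp [mixedSign, hs.mem_iff, *]) (Perm.refl _) hs').1.closed c1'
    refine flatWrithe_congr hcl.2 fun r hr => ?_
    obtain ⟨-, -, q1, q2, q3, q4⟩ := hout r (by simp at hr ⊢; tauto)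
    simp [mixedSign, hs.mem_iff, q1, q2, q3, q4, Pass.partner_eq_comm (p := r)]
  · simp [mixedSign, hs.mem_iff, *]
  · simp [mixedSign, hs.mem_iff, *]

theorem neg_linked (hs : s ~ [c, b.partner]) (hw : Closed w) (hw' : Closed w')
    (hr : w ~r [a, c.partner] ++ U ++ [a.partner, b] ++ V ++ s ++ Z)
    (hr' : w' ~r [c.partner, a] ++ U ++ [b, a.partner] ++ V ++ s.reverse ++ Z)
    {d : Pass} (hd : Away a b c d) : (Linked w a d ↔ d.partner ∈ U ∧ (d ∈ V ∨ d ∈ Z)) ∧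
      (Linked w' a d ↔ d.partner ∈ U ∧ (d ∈ V ∨ d ∈ Z)) := by
  obtain ⟨a1, a2⟩ := neg_arcs hw.1 hr
  obtain ⟨b1, b2⟩ := neg_arcs' hw'.1 hr'
  obtain ⟨d1, d2, d3, d4, d5, d6⟩ := hd
  unfold Linked
  rw [a1, a2, b1, b2]
  simp [hs.mem_iff, d3, d4, d5, d6, Pass.partner_eq_comm (p := d), and_comm]

/-- In this position the knots that remain after the smoothing of `a` and `d` differ only in the
names of the crossings of `b` and `c`. -/
theorem neg_smoothTwo (hj : IsJump j) (hs : s ~ [c, b.partner]) (hbc : j c = -j b)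
    (hw : Closed w) (hw' : Closed w')
    (hp : w ~ a :: a.partner :: b :: b.partner :: c :: c.partner :: (U ++ V ++ Z))
    (hr : w ~r [a, c.partner] ++ U ++ [a.partner, b] ++ V ++ s ++ Z)
    (hr' : w' ~r [c.partner, a] ++ U ++ [b, a.partner] ++ V ++ s.reverse ++ Z)
    {d : Pass} (hd : Away a b c d) (hl : Linked w a d) :
    flatWrithe n j (smoothTwo w a d) = flatWrithe n j (smoothTwo w' a d) := by
  obtain ⟨l1, l2⟩ := neg_linked hs hw hw' hr hr' hd
  have c1 := closed_smoothTwo hw (c := a) (hr.mem_iff.2 (by simp)) hl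
  obtain ⟨hU, hVZ⟩ := l1.1 hl
  have hout := (away_of_perm hw hp).1
  obtain ⟨U1, U2, U3, U4⟩ := not_mem_of_away (L := U) fun r hr => hout r (by simp [hr])
  obtain ⟨V1, V2, V3, V4⟩ := not_mem_of_away (L := V) fun r hr => hout r (by simp [hr])
  obtain ⟨Z1, Z2, Z3, Z4⟩ := not_mem_of_away (L := Z) fun r hr => hout r (by simp [hr])
  obtain ⟨U₁, U₂, rfl⟩ := append_of_mem hU
  simp only [mem_append, mem_cons, not_or] at U1 U2 U3 U4
  suffices e : smoothTwo w' a d = (smoothTwo w a d).map (exch b c.partner) by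
    rw [e, flatWrithe_exch hj hj c1 (by simp [hj c, hbc]) (by simp [hj c, hbc]) (by simp)]
  rcases hVZ with hV | hV <;> obtain ⟨V₁, V₂, rfl⟩ := append_of_mem hV
  · have f1 := smoothTwo_eq (c := a) (d := d) (a₁ := c.partner :: U₁) (a₂ := U₂)
      (b₁ := b :: V₁) (b₂ := V₂ ++ s ++ Z) hw.1 (by simpa using hr)
    have f2 := smoothTwo_eq (c := a) (d := d) (a₁ := U₁) (a₂ := U₂ ++ [b])
      (b₁ := V₁) (b₂ := V₂ ++ s.reverse ++ Z ++ [c.partner]) hw'.1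
      (hr'.trans (isRotated_append_of_eq [c.partner] (a :: (U₁ ++ d.partner :: U₂) ++
        [b, a.partner] ++ (V₁ ++ d :: V₂) ++ s.reverse ++ Z) (by simp) (by simp)))
    simp only [mem_append, mem_cons, not_or] at V1 V2 V3 V4
    rw [f1.2, f2.2]
    simp only [map_append, map_cons, exch_left, exch_right, exch_pair hs]
    rw [map_exch (w := U₁), map_exch (w := U₂), map_exch (w := V₁), map_exch (w := V₂),
      map_exch (w := Z)]
    all_goals simp [*]
  · have f1 := smoothTwo_eq (c := a) (d := d) (a₁ := c.partner :: U₁) (a₂ := U₂)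
      (b₁ := b :: V ++ s ++ V₁) (b₂ := V₂) hw.1 (by simpa using hr)
    have f2 := smoothTwo_eq (c := a) (d := d) (a₁ := U₁) (a₂ := U₂ ++ [b])
      (b₁ := V ++ s.reverse ++ V₁) (b₂ := V₂ ++ [c.partner]) hw'.1
      (hr'.trans (isRotated_append_of_eq [c.partner] (a :: (U₁ ++ d.partner :: U₂) ++
        [b, a.partner] ++ V ++ s.reverse ++ (V₁ ++ d :: V₂)) (by simp) (by simp)))
    simp only [mem_append, mem_cons, not_or] at Z1 Z2 Z3 Z4
    rw [f1.2, f2.2]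
    simp only [map_append, map_cons, exch_left, exch_right, exch_pair hs]
    rw [map_exch (w := U₁), map_exch (w := U₂), map_exch (w := V₁), map_exch (w := V₂),
      map_exch (w := V)]
    all_goals simp [*]

/-- On either side of the move exactly one of the other two crossings of the triangle contributes,
and both contributions agree. -/
theorem neg_spanTerm (hj : IsJump j) (hs : s ~ [c, b.partner]) (hbc : j c = -j b)
    (hw : Closed w) (hw' : Closed w')
    (hp : w ~ a :: a.partner :: b :: b.partner :: c :: c.partner :: (U ++ V ++ Z))
    (hr : w ~r [a, c.partner] ++ U ++ [a.partner, b] ++ V ++ s ++ Z)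
    (hr' : w' ~r [c.partner, a] ++ U ++ [b, a.partner] ++ V ++ s.reverse ++ Z) :
    spanTerm k m j w a b + spanTerm k m j w a b.partner + spanTerm k m j w a c +
      spanTerm k m j w a c.partner =
    spanTerm k m j w' a b + spanTerm k m j w' a b.partner + spanTerm k m j w' a c +
      spanTerm k m j w' a c.partner := by
  obtain ⟨a1, a2⟩ := neg_arcs hw.1 hr
  obtain ⟨b1, b2⟩ := neg_arcs' hw'.1 hr'
  obtain ⟨hout, -, hb, hc⟩ := away_of_perm hw hp
  obtain ⟨U1, U2, U3, U4⟩ := not_mem_of_away (L := U) fun r hr => hout r (by simp [hr])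
  obtain ⟨V1, V2, V3, V4⟩ := not_mem_of_away (L := V) fun r hr => hout r (by simp [hr])
  obtain ⟨Z1, Z2, Z3, Z4⟩ := not_mem_of_away (L := Z) fun r hr => hout r (by simp [hr])
  have c5 : b ≠ c.partner := hb.2.2.2.1
  have c6 : b ≠ c := hb.2.2.1
  have c5' : c.partner ≠ b := c5.symm
  have c7 : c ≠ b.partner := hc.2.2.2.1
  have c7' : b.partner ≠ c := c7.symm
  have c8 : c ≠ b := c6.symm
  have n1 : ¬ Linked w a b := by
    unfold Linked; rw [a1, a2]; simp [hs.mem_iff, *]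
  have n2 : ¬ Linked w a c.partner := by
    unfold Linked; rw [a1, a2]; simp [hs.mem_iff, *]
  have n3 : ¬ Linked w a b.partner := by
    unfold Linked; rw [a1, a2]; simp [hs.mem_iff, *]
  have m1 : ¬ Linked w' a b := by
    unfold Linked; rw [b1, b2]; simp [hs.mem_iff, *]
  have m3 : ¬ Linked w' a c := by
    unfold Linked; rw [b1, b2]; simp [hs.mem_iff, *]
  have m4 : ¬ Linked w' a c.partner := by
    unfold Linked; rw [b1, b2]; simp [hs.mem_iff, *]
  have l1 : Linked w' a b.partner := by
    unfold Linked; rw [b1, b2]; simp [hs.mem_iff]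
  have l2 : Linked w a c := by
    unfold Linked; rw [a1, a2]; simp [hs.mem_iff]
  have ha : a ∈ w := hr.mem_iff.2 (by simp)
  have k2 := closed_smoothTwo hw ha l2
  have key : flatWrithe k j (smoothTwo w' a b.partner) = flatWrithe k j (smoothTwo w a c) := by
    have k1 := closed_smoothTwo hw' (hr'.mem_iff.2 (by simp)) l1
    rcases perm_pair.1 hs with rfl | rfl
    · have f1 := smoothTwo_eq (c := a) (d := c) (a₁ := []) (a₂ := U)
        (b₁ := b :: V) (b₂ := b.partner :: Z) hw.1 (by simpa using hr)
      have f2 := smoothTwo_eq (c := a) (d := b.partner) (a₁ := U) (a₂ := [])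
        (b₁ := V) (b₂ := c :: Z ++ [c.partner]) hw'.1 (hr'.trans (isRotated_append_of_eq
          [c.partner] (a :: U ++ [b, a.partner] ++ V ++ [b.partner, c] ++ Z) (by simp) (by simp)))
      have e : smoothTwo w' a b.partner = (smoothTwo w a c).map (exch b c.partner) := by
        rw [f1.2, f2.2]
        simp only [map_append, map_cons, exch_left, exch_left', Pass.partner_partner, map_nil]
        rw [map_exch (w := U), map_exch (w := V), map_exch (w := Z)] <;> simp [*]
      rw [e, flatWrithe_exch hj hj k2 (by simp [hj c, hbc]) (by simp [hj c, hbc]) (by simp)]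
    · have f1 := smoothTwo_eq (c := a) (d := c) (a₁ := []) (a₂ := U)
        (b₁ := b :: V ++ [b.partner]) (b₂ := Z) hw.1 (by simpa using hr)
      have f2 := smoothTwo_eq (c := a) (d := b.partner) (a₁ := U) (a₂ := [])
        (b₁ := V ++ [c]) (b₂ := Z ++ [c.partner]) hw'.1 (hr'.trans (isRotated_append_of_eq
          [c.partner] (a :: U ++ [b, a.partner] ++ V ++ [c, b.partner] ++ Z) (by simp) (by simp)))
      have e : smoothTwo w' a b.partner = (smoothTwo w a c).map (exch b c.partner) := by
        rw [f1.2, f2.2]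
        simp only [map_append, map_cons, exch_left, exch_left', Pass.partner_partner, map_nil]
        rw [map_exch (w := U), map_exch (w := V), map_exch (w := Z)] <;> simp [*]
      rw [e, flatWrithe_exch hj hj k2 (by simp [hj c, hbc]) (by simp [hj c, hbc]) (by simp)]
  simp only [spanTerm, if_neg n1, if_neg n2, if_neg n3, if_neg m1, if_neg m3, if_neg m4, if_pos l1,
    if_pos l2, key, hj b, hbc]
  ring

end Negative

end

section

variable {j : Pass → ℤ} {n k m : ℤ}

/-! ### Third moves -/

/-- The neighbouring passages `x`, `y` in this order if `o = 1`, and in the opposite order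
otherwise. -/
def pair (o : ℤ) (x y : Pass) : List Pass := if o = 1 then [x, y] else [y, x]

theorem pair_perm (o : ℤ) (x y : Pass) : pair o x y ~ [x, y] := by
  unfold pair; split_ifs <;> simp [perm_pair]

theorem pair_neg {o : ℤ} (ho : o = 1 ∨ o = -1) (x y : Pass) :
    pair (-o) x y = (pair o x y).reverse := by
  rcases ho with rfl | rfl <;> simp [pair]

/-- A word with a triangle whose crossings are those of `a`, `b`, `c`; its strands carry the
passages `a` and `c.partner`, `b` and `a.partner`, `c` and `b.partner`. -/
def triWord (o₁ o₂ o₃ : ℤ) (a b c : Pass) (U V Z : List Pass) : List Pass :=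
  pair o₁ a c.partner ++ U ++ pair o₂ b a.partner ++ V ++ pair o₃ c b.partner ++ Z

/-- The orders on the strands and the jumps of the crossings of a triangle. -/
structure TriSigns (j : Pass → ℤ) (o₁ o₂ o₃ : ℤ) (a b c : Pass) : Prop where
  s₁ : o₁ = 1 ∨ o₁ = -1
  s₂ : o₂ = 1 ∨ o₂ = -1
  s₃ : o₃ = 1 ∨ o₃ = -1
  h₁₂ : o₁ * j c = o₂ * j b
  h₂₃ : o₂ * j a = o₃ * j c
  h₃₁ : o₃ * j b = o₁ * j a

theorem TriSigns.neg {o₁ o₂ o₃ : ℤ} {a b c : Pass} (h : TriSigns j o₁ o₂ o₃ a b c) :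
    TriSigns j (-o₁) (-o₂) (-o₃) a b c := by
  obtain ⟨s₁, s₂, s₃, h₁₂, h₂₃, h₃₁⟩ := h
  exact ⟨by omega, by omega, by omega, by linarith, by linarith, by linarith⟩

theorem TriSigns.rotate {o₁ o₂ o₃ : ℤ} {a b c : Pass} (h : TriSigns j o₁ o₂ o₃ a b c) :
    TriSigns j o₂ o₃ o₁ b c a := ⟨h.s₂, h.s₃, h.s₁, h.h₂₃, h.h₃₁, h.h₁₂⟩

theorem triWord_rotate (o₁ o₂ o₃ : ℤ) (a b c : Pass) (U V Z : List Pass) :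
    triWord o₁ o₂ o₃ a b c U V Z ~r triWord o₂ o₃ o₁ b c a V Z U :=
  isRotated_append_of_eq (pair o₁ a c.partner ++ U)
    (pair o₂ b a.partner ++ V ++ pair o₃ c b.partner ++ Z) (by simp [triWord]) (by simp [triWord])

theorem triWord_perm (o₁ o₂ o₃ : ℤ) (a b c : Pass) (U V Z : List Pass) :
    triWord o₁ o₂ o₃ a b c U V Z ~
      a :: a.partner :: b :: b.partner :: c :: c.partner :: (U ++ V ++ Z) := by
  unfold triWord
  refine ((((((pair_perm _ _ _).append_right U).append (pair_perm _ _ _)).append_right V).append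
    (pair_perm _ _ _)).append_right Z).trans ?_
  rw [perm_iff_count]
  intro x
  simp only [count_append, count_cons, count_nil]
  omega

/-- What a third move preserves at its crossing of `a`. -/
structure SameAt (n k m : ℤ) (j : Pass → ℤ) (w w' : List Pass) (a b c : Pass) : Prop where
  smoothWrithe : smoothWrithe n j w a = smoothWrithe n j w' a
  linked : ∀ d, Away a b c d → (Linked w a d ↔ Linked w' a d)
  smoothTwo : ∀ d, Away a b c d → Linked w a d →
    flatWrithe k j (smoothTwo w a d) = flatWrithe k j (smoothTwo w' a d)
  smoothSpan : smoothSpan k m j w a = smoothSpan k m j w' a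

theorem SameAt.symm {w w' : List Pass} {a b c : Pass} (h : SameAt n k m j w w' a b c) :
    SameAt n k m j w' w a b c :=
  ⟨h.1.symm, fun d hd => (h.2 d hd).symm,
    fun d hd hl => (h.3 d hd ((h.2 d hd).2 hl)).symm, h.4.symm⟩

theorem smoothSpan_eq_of_perm {w L : List Pass} (hw : Closed w) {a b c : Pass}
    (hp : w ~ a :: a.partner :: b :: b.partner :: c :: c.partner :: L) :
    smoothSpan k m j w a = spanTerm k m j w a b + spanTerm k m j w a b.partner +
      spanTerm k m j w a c + spanTerm k m j w a c.partner + (L.map (spanTerm k m j w a)).sum := by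
  have ha : a ∈ w := hp.mem_iff.2 (by simp)
  have z1 : spanTerm k m j w a a = 0 := if_neg (Linked.not_self hw ha).1
  have z2 : spanTerm k m j w a a.partner = 0 := if_neg (Linked.not_self hw ha).2
  rw [smoothSpan, sum_toFinset_perm hw.1 hp]
  simp only [map_cons, sum_cons, z1, z2]
  ring

/-- The order on the second strand decides between the two positions of the triangle. -/
theorem sameAt_of_pos (hj : IsJump j) {o₂ o₃ : ℤ} {a b c : Pass} {U V Z w w' : List Pass}
    (hs : TriSigns j 1 o₂ o₃ a b c) (hw : Closed w) (hw' : Closed w')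
    (hr : w ~r triWord 1 o₂ o₃ a b c U V Z) (hr' : w' ~r triWord (-1) (-o₂) (-o₃) a b c U V Z) :
    SameAt n k m j w w' a b c := by
  have hp := hr.perm.trans (triWord_perm _ _ _ _ _ _ _ _ _)
  have hp' := hr'.perm.trans (triWord_perm _ _ _ _ _ _ _ _ _)
  have h1 := pair_perm o₃ c b.partner
  have hbc := hs.h₁₂
  have hout := (away_of_perm hw hp).1
  unfold triWord at hr hr'
  rw [pair_neg hs.s₃] at hr'
  have span : (∀ d, Away a b c d → (Linked w a d ↔ Linked w' a d)) →
      (∀ d, Away a b c d → Linked w a d →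
        flatWrithe k j (smoothTwo w a d) = flatWrithe k j (smoothTwo w' a d)) →
      spanTerm k m j w a b + spanTerm k m j w a b.partner + spanTerm k m j w a c +
        spanTerm k m j w a c.partner =
      spanTerm k m j w' a b + spanTerm k m j w' a b.partner + spanTerm k m j w' a c +
        spanTerm k m j w' a c.partner → smoothSpan k m j w a = smoothSpan k m j w' a := by
    intro hl ht he
    rw [smoothSpan_eq_of_perm hw hp, smoothSpan_eq_of_perm hw' hp', he]
    congr 2
    refine map_congr_left fun d hd => ?_
    have hd := hout d hd
    unfold spanTerm
    by_cases l : Linked w a d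
    · rw [if_pos l, if_pos ((hl d hd).1 l), ht d hd l]
    · rw [if_neg l, if_neg (mt (hl d hd).2 l)]
  rcases hs.s₂ with rfl | rfl
  · replace hbc : j c = j b := by linarith
    replace hr : w ~r [a, c.partner] ++ U ++ [b, a.partner] ++ V ++ pair o₃ c b.partner ++ Z := hr
    replace hr' : w' ~r [c.partner, a] ++ U ++ [a.partner, b] ++ V ++
      (pair o₃ c b.partner).reverse ++ Z := hr'
    have hl : ∀ d, Away a b c d → (Linked w a d ↔ Linked w' a d) := fun d hd =>
      have := pos_linked h1 hw hw' hr hr' hd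
      this.1.trans this.2.symm
    have ht : ∀ d, Away a b c d → Linked w a d →
        flatWrithe k j (smoothTwo w a d) = flatWrithe k j (smoothTwo w' a d) := fun d hd l =>
      pos_smoothTwo hj h1 hbc hw hw' hr hr' hd l
    exact ⟨pos_smoothWrithe hj h1 hbc hw hw' hp hr hr', hl, ht,
      span hl ht (pos_spanTerm hj h1 hbc hw hw' hp hr hr')⟩
  · replace hbc : j c = -j b := by linarith
    replace hr : w ~r [a, c.partner] ++ U ++ [a.partner, b] ++ V ++ pair o₃ c b.partner ++ Z := hr
    replace hr' : w' ~r [c.partner, a] ++ U ++ [b, a.partner] ++ V ++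
      (pair o₃ c b.partner).reverse ++ Z := hr'
    have hl : ∀ d, Away a b c d → (Linked w a d ↔ Linked w' a d) := fun d hd =>
      have := neg_linked h1 hw hw' hr hr' hd
      this.1.trans this.2.symm
    have ht : ∀ d, Away a b c d → Linked w a d →
        flatWrithe k j (smoothTwo w a d) = flatWrithe k j (smoothTwo w' a d) := fun d hd l =>
      neg_smoothTwo hj h1 hbc hw hw' hp hr hr' hd l
    exact ⟨neg_smoothWrithe hj h1 hbc hw hw' hp hr hr', hl, ht,
      span hl ht (neg_spanTerm hj h1 hbc hw hw' hp hr hr')⟩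

/-- The case `o₁ = -1` is the case `o₁ = 1` with both sides of the move exchanged. -/
theorem sameAt (hj : IsJump j) {o₁ o₂ o₃ : ℤ} {a b c : Pass} {U V Z w w' : List Pass}
    (hs : TriSigns j o₁ o₂ o₃ a b c) (hw : Closed w) (hw' : Closed w')
    (hr : w ~r triWord o₁ o₂ o₃ a b c U V Z)
    (hr' : w' ~r triWord (-o₁) (-o₂) (-o₃) a b c U V Z) : SameAt n k m j w w' a b c := by
  rcases hs.s₁ with rfl | rfl
  · exact sameAt_of_pos hj hs hw hw' hr hr'
  · refine (sameAt_of_pos hj (o₂ := -o₂) (o₃ := -o₃) (U := U) (V := V) (Z := Z) ?_ hw' hw ?_ ?_).symm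
    · simpa using hs.neg
    · simpa using hr'
    · simpa using hr

theorem triangle_of_triWord {o₁ o₂ o₃ : ℤ} {a b c : Pass} {U V Z : List Pass}
    (hs : TriSigns j o₁ o₂ o₃ a b c) (hw : Closed (triWord o₁ o₂ o₃ a b c U V Z)) :
    Triangle j a b c o₁ o₂ o₃ (triWord o₁ o₂ o₃ a b c U V Z)
      (triWord (-o₁) (-o₂) (-o₃) a b c U V Z) := by
  obtain ⟨-, ⟨g1, g2, -⟩, ⟨-, -, q1, q2, -⟩, ⟨p1, p2, -⟩⟩ :=
    away_of_perm hw (triWord_perm _ _ _ _ _ _ _ _ _)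
  have sw : ∀ {o : ℤ} {x y : Pass} (u v : List Pass), o = 1 ∨ o = -1 →
      Swap o x y (u ++ pair o x y ++ v) (u ++ pair (-o) x y ++ v) := by
    intro o x y u v ho
    refine ⟨pair o x y, pair (-o) x y, ?_, u, v, rfl, rfl⟩
    rcases ho with rfl | rfl <;> simp [pair]
  refine ⟨⟨triWord (-o₁) o₂ o₃ a b c U V Z, triWord (-o₁) (-o₂) o₃ a b c U V Z, ?_, ?_, ?_⟩,
    hs.h₁₂, hs.h₂₃, hs.h₃₁, g1, g2, q1, q2, p1, p2⟩
  · simpa [triWord] using sw (x := a) (y := c.partner) []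
      (U ++ pair o₂ b a.partner ++ V ++ pair o₃ c b.partner ++ Z) hs.s₁
  · simpa [triWord] using sw (x := b) (y := a.partner) (pair (-o₁) a c.partner ++ U)
      (V ++ pair o₃ c b.partner ++ Z) hs.s₂
  · exact sw _ _ hs.s₃

/-- The contribution of a crossing of the triangle to the span of another crossing. -/
theorem SameAt.spanTerm (hj : IsJump j) {w w' : List Pass} {a b c : Pass} (hw : Closed w)
    (hw' : Closed w') (h : SameAt n k m j w w' a b c) (ha : a ∈ w) (ha' : a ∈ w') {x : Pass}
    (hx : x ∈ w) (hx' : x ∈ w') (hax : Away a b c x) :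
    spanTerm k m j w x a = spanTerm k m j w' x a := by
  have eqv : ∀ {w : List Pass}, Closed w → a ∈ w → x ∈ w →
      (Linked w x a ↔ Linked w a x.partner) := by
    intro w hw ha hx
    refine ⟨fun l => (l.symm (n := 0) hj hw hx).1, fun l => ?_⟩
    exact linked_partner.1 (l.symm (n := 0) hj hw ha).1
  have hl : Linked w x a ↔ Linked w' x a := by
    rw [eqv hw ha hx, eqv hw' ha' hx', h.linked _ hax.partner]
  unfold VirtualKnot.spanTerm
  by_cases l : Linked w x a
  · have l' := hl.1 l
    rw [if_pos l, if_pos l', (l.symm hj hw hx).2, (l'.symm hj hw' hx').2,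
      h.smoothTwo _ hax.partner ((eqv hw ha hx).1 l)]
  · rw [if_neg l, if_neg (mt hl.2 l)]

/-- A third move preserves the flat data of every crossing. -/
theorem third_move (hj : IsJump j) {o₁ o₂ o₃ : ℤ} {a b c : Pass} {U V Z : List Pass}
    (hs : TriSigns j o₁ o₂ o₃ a b c) (hw : Closed (triWord o₁ o₂ o₃ a b c U V Z)) {x : Pass}
    (hx : x ∈ triWord o₁ o₂ o₃ a b c U V Z) :
    smoothWrithe n j (triWord o₁ o₂ o₃ a b c U V Z) x
      = smoothWrithe n j (triWord (-o₁) (-o₂) (-o₃) a b c U V Z) x ∧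
    smoothSpan k m j (triWord o₁ o₂ o₃ a b c U V Z) x
      = smoothSpan k m j (triWord (-o₁) (-o₂) (-o₃) a b c U V Z) x := by
  have ht := triangle_of_triWord hs hw
  have hw' := hw.perm ht.perm
  have sa : SameAt n k m j (triWord o₁ o₂ o₃ a b c U V Z)
    (triWord (-o₁) (-o₂) (-o₃) a b c U V Z) a b c := sameAt hj hs hw hw' (IsRotated.refl _)
      (IsRotated.refl _)
  have sb : SameAt n k m j (triWord o₁ o₂ o₃ a b c U V Z)
    (triWord (-o₁) (-o₂) (-o₃) a b c U V Z) b c a := sameAt hj hs.rotate hw hw'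
      (triWord_rotate _ _ _ _ _ _ _ _ _) (triWord_rotate _ _ _ _ _ _ _ _ _)
  have sc : SameAt n k m j (triWord o₁ o₂ o₃ a b c U V Z)
    (triWord (-o₁) (-o₂) (-o₃) a b c U V Z) c a b := sameAt hj hs.rotate.rotate hw hw'
      ((triWord_rotate _ _ _ _ _ _ _ _ _).trans (triWord_rotate _ _ _ _ _ _ _ _ _))
      ((triWord_rotate _ _ _ _ _ _ _ _ _).trans (triWord_rotate _ _ _ _ _ _ _ _ _))
  have hp := triWord_perm o₁ o₂ o₃ a b c U V Z
  have hp' := triWord_perm (-o₁) (-o₂) (-o₃) a b c U V Z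
  obtain ⟨hout, -⟩ := away_of_perm hw hp
  generalize triWord o₁ o₂ o₃ a b c U V Z = w at *
  generalize triWord (-o₁) (-o₂) (-o₃) a b c U V Z = w' at *
  have same : ∀ {a b c : Pass}, a ∈ w → SameAt n k m j w w' a b c →
      (smoothWrithe n j w a = smoothWrithe n j w' a ∧
        smoothSpan k m j w a = smoothSpan k m j w' a) ∧
      smoothWrithe n j w a.partner = smoothWrithe n j w' a.partner ∧
        smoothSpan k m j w a.partner = smoothSpan k m j w' a.partner := by
    intro a b c ha hs
    have ha' := ht.perm.mem_iff.1 ha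
    refine ⟨⟨hs.1, hs.4⟩, ?_, ?_⟩
    · rw [smoothWrithe_partner hj hw ha, smoothWrithe_partner hj hw' ha', hs.1]
    · rw [smoothSpan_partner hj hw ha, smoothSpan_partner hj hw' ha', hs.4]
  have ma : a ∈ w := hp.mem_iff.2 (by simp)
  have mb : b ∈ w := hp.mem_iff.2 (by simp)
  have mc : c ∈ w := hp.mem_iff.2 (by simp)
  have hx1 := hp.mem_iff.1 hx
  simp only [mem_cons] at hx1
  rcases hx1 with rfl | rfl | rfl | rfl | rfl | rfl | hx1
  · exact (same hx sa).1
  · exact (same ma sa).2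
  · exact (same hx sb).1
  · exact (same mb sb).2
  · exact (same hx sc).1
  · exact (same mc sc).2
  have ax := hout x hx1
  refine ⟨ht.smoothWrithe hj hw hx ax, ?_⟩
  have hx' := ht.perm.mem_iff.1 hx
  have ax2 : Away b c a x := by unfold Away at *; tauto
  have ax3 : Away c a b x := by unfold Away at *; tauto
  have ma' := ht.perm.mem_iff.1 ma
  have mb' := ht.perm.mem_iff.1 mb
  have mc' := ht.perm.mem_iff.1 mc
  have par : ∀ d, spanTerm k m j w x.partner d = spanTerm k m j w' x.partner d →
      spanTerm k m j w x d.partner = spanTerm k m j w' x d.partner := by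
    intro d h
    have e := spanTerm_partner (k := k) (m := m) (d := d) hj hw (hw.2 x hx)
    have e' := spanTerm_partner (k := k) (m := m) (d := d) hj hw' (hw'.2 x hx')
    rw [Pass.partner_partner] at e e'
    rw [e, e', h]
  have px := hw.2 x hx
  have px' := hw'.2 x hx'
  unfold smoothSpan
  rw [sum_toFinset_perm hw.1 hp, sum_toFinset_perm hw'.1 hp']
  simp only [map_cons, sum_cons]
  rw [map_congr_left fun d hd => ht.spanTerm hj hw hx ax (hout d hd),
    sa.spanTerm hj hw hw' ma ma' hx hx' ax, sb.spanTerm hj hw hw' mb mb' hx hx' ax2,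
    sc.spanTerm hj hw hw' mc mc' hx hx' ax3,
    par a (sa.spanTerm hj hw hw' ma ma' px px' ax.partner),
    par b (sb.spanTerm hj hw hw' mb mb' px px' ax2.partner),
    par c (sc.spanTerm hj hw hw' mc mc' px px' ax3.partner)]

end

section

variable {j : Pass → ℤ} {n k m : ℤ}

/-! ### The polynomial in terms of the flat data -/

/-- The contribution of a crossing with index `i`, where `x` is the difference writhe of the
smoothed knot, `s` is the flat span of the smoothed link, and `J` is the difference writhe of the
knot. -/
noncomputable def crossingTerm (J i x s : ℤ) : Laurent3 :=
  mono3 i x s - if (x = J ∨ x = -J) ∧ s = 0 then mono3 0 x s else mono3 0 J s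

/-- The contribution of the passage `c` (zero unless it is an over passage). -/
noncomputable def contribution (n k m : ℤ) (w : List Pass) (c : Pass) : Laurent3 :=
  if c.isOver then c.sgn • crossingTerm (flatWrithe n Pass.jump w) (flatInd Pass.jump w c)
    (smoothWrithe n Pass.jump w c) (smoothSpan k m Pass.jump w c) else 0

/-- The three-variable polynomial of a word in terms of the flat data. -/
noncomputable def flatPoly (n k m : ℤ) (w : List Pass) : Laurent3 :=
  ∑ c ∈ w.toFinset, contribution n k m w c

theorem flatPoly_eq_of_perm {w L : List Pass} (hw : w.Nodup) (h : w ~ L) :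
    flatPoly n k m w = (L.map (contribution n k m w)).sum := by
  rw [flatPoly, List.sum_toFinset _ hw, (h.map _).sum_eq]

theorem contribution_congr {w w' : List Pass} {c : Pass}
    (h0 : flatWrithe n Pass.jump w = flatWrithe n Pass.jump w')
    (h1 : flatInd Pass.jump w c = flatInd Pass.jump w' c)
    (h2 : smoothWrithe n Pass.jump w c = smoothWrithe n Pass.jump w' c)
    (h3 : smoothSpan k m Pass.jump w c = smoothSpan k m Pass.jump w' c) :
    contribution n k m w c = contribution n k m w' c := by
  unfold contribution; rw [h0, h1, h2, h3]

theorem flatPoly_isRotated {w w' : List Pass} (hw : Closed w) (hr : w ~r w') :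
    flatPoly n k m w = flatPoly n k m w' := by
  rw [flatPoly, flatPoly, toFinset_eq_of_perm _ _ hr.perm]
  refine Finset.sum_congr rfl fun c hc => ?_
  have hc : c ∈ w := hr.mem_iff.2 (by simpa using hc)
  exact contribution_congr (flatWrithe_isRotated isJump_jump hw hr)
    (flatInd_isRotated isJump_jump hw hr hc) (smoothWrithe_isRotated hw hr hc)
    (smoothSpan_isRotated hw hr hc)

theorem Del.symm {p q : Pass} {w w' : List Pass} (h : Del p q w w') : Del q p w w' := by
  obtain ⟨s, hs, h⟩ := h
  exact ⟨s, hs.trans (Perm.swap _ _ _), h⟩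

theorem Pass.sgn_partner (p : Pass) : p.partner.sgn = p.sgn := rfl

/-- At a kink the flat index and the flat span vanish and the smoothed knot has the writhe of the
knot up to sign, so that the two parts of the contribution cancel. -/
theorem contribution_kink_self {p : Pass} {w w' : List Pass} (hw : Closed w)
    (h : Del p p.partner w w') : contribution n k m w p = 0 := by
  unfold contribution
  split_ifs
  · obtain ⟨h1, h2⟩ := h.kink_self (n := n) (k := k) (m := m) isJump_jump hw
    rw [← h.flatWrithe_kink isJump_jump hw.1] at h1
    simp [crossingTerm, h2, h1, h.flatInd_kink_self isJump_jump hw.1]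
  · rfl

theorem flatPoly_kink {p : Pass} {w w' : List Pass} (hw : Closed w)
    (h : Del p p.partner w w') : flatPoly n k m w = flatPoly n k m w' := by
  have h' : Del p.partner p.partner.partner w w' := by simpa using h.symm
  have hn := h.not_mem hw.1
  rw [flatPoly_eq_of_perm hw.1 h.perm, flatPoly_eq_of_perm (h.nodup hw.1) (Perm.refl _), map_cons,
    map_cons, contribution_kink_self hw h, contribution_kink_self hw h', sum_cons, sum_cons,
    zero_add, zero_add]
  congr 1
  refine map_congr_left fun c hc => ?_
  exact contribution_congr (h.flatWrithe_kink isJump_jump hw.1)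
    (h.flatInd_kink isJump_jump (fun e => hn.1 (e ▸ hc)) (fun e => hn.2 (e ▸ hc))).symm
    (h.smoothWrithe_kink isJump_jump hw hc) (h.smoothSpan_kink isJump_jump hw hc)

theorem isOver_of_mirror {p q : Pass} (hl : q.left = !p.left) (hk : q.kind = p.kind.mirror) :
    q.isOver = p.isOver := by
  obtain ⟨a, b, c⟩ := p
  obtain ⟨a', b', c'⟩ := q
  simp only at hl hk
  subst hl hk
  cases c <;> simp [Pass.isOver, CrossingKind.mirror]

theorem sgn_of_mirror {p q : Pass} (hk : q.kind = p.kind.mirror) : q.sgn = -p.sgn := by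
  obtain ⟨a, b, c⟩ := p
  obtain ⟨a', b', c'⟩ := q
  simp only at hk
  subst hk
  cases c <;> simp [Pass.sgn, CrossingKind.sign, CrossingKind.mirror]

theorem jump_of_mirror {p q : Pass} (hl : q.left = !p.left) (hk : q.kind = p.kind.mirror) :
    q.jump = -p.jump := by
  obtain ⟨a, b, c⟩ := p
  obtain ⟨a', b', c'⟩ := q
  simp only at hl hk
  subst hl hk
  cases c <;> cases b <;> simp [Pass.jump, Pass.classical, CrossingKind.mirror]

/-- The crossings of a bigon have opposite signs and equal data, so their contributions cancel. -/
theorem flatPoly_bigon {p q : Pass} {u v w w' : List Pass} (hw : Closed w)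
    (hl : q.left = !p.left) (hk : q.kind = p.kind.mirror) (h : Bigon Pass.jump p q w w')
    (hs : BigonShape p q u v w) : flatPoly n k m w = flatPoly n k m w' := by
  have hp : p ∈ w := h.perm.mem_iff.2 (by simp)
  have hq : q ∈ w := h.perm.mem_iff.2 (by simp)
  have e0 := h.flatInd_self isJump_jump hw.1
  have e1 : smoothWrithe n _ w p = smoothWrithe n _ w q := hs.smoothWrithe isJump_jump hw h.1
  have e2 : smoothSpan k m _ w p = smoothSpan k m _ w q := hs.smoothSpan isJump_jump hw h.1
  have ho := isOver_of_mirror hl hk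
  have ho' : q.partner.isOver = p.partner.isOver :=
    isOver_of_mirror (by simp [Pass.partner, hl]) hk
  have hsg := sgn_of_mirror hk
  have k1 : contribution n k m w p + contribution n k m w q = 0 := by
    unfold contribution
    rw [ho, hsg, e0, e1, e2]
    split_ifs <;> simp
  have k2 : contribution n k m w p.partner + contribution n k m w q.partner = 0 := by
    unfold contribution
    rw [ho', Pass.sgn_partner, Pass.sgn_partner, hsg, flatInd_partner isJump_jump,
      flatInd_partner isJump_jump, smoothWrithe_partner isJump_jump hw hp,
      smoothWrithe_partner isJump_jump hw hq, smoothSpan_partner isJump_jump hw hp,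
      smoothSpan_partner isJump_jump hw hq, e0, e1, e2]
    split_ifs <;> simp
  rw [flatPoly_eq_of_perm hw.1 h.perm, flatPoly_eq_of_perm (h.closed hw).1 (Perm.refl _)]
  simp only [map_cons, sum_cons]
  rw [← add_assoc, ← add_assoc, ← add_assoc, k1, zero_add, k2, zero_add]
  congr 1
  refine map_congr_left fun c hc => ?_
  exact contribution_congr (h.flatWrithe isJump_jump hw.1) (h.flatInd isJump_jump hw.1 hc)
    (h.smoothWrithe isJump_jump hw hc) (h.smoothSpan isJump_jump hw hs hc)

theorem flatPoly_third {o₁ o₂ o₃ : ℤ} {a b c : Pass} {U V Z : List Pass}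
    (hs : TriSigns Pass.jump o₁ o₂ o₃ a b c) (hw : Closed (triWord o₁ o₂ o₃ a b c U V Z)) :
    flatPoly n k m (triWord o₁ o₂ o₃ a b c U V Z)
      = flatPoly n k m (triWord (-o₁) (-o₂) (-o₃) a b c U V Z) := by
  have ht := triangle_of_triWord hs hw
  rw [flatPoly, flatPoly, toFinset_eq_of_perm _ _ ht.perm]
  refine Finset.sum_congr rfl fun x hx => ?_
  have hx : x ∈ triWord o₁ o₂ o₃ a b c U V Z := ht.perm.mem_iff.2 (by simpa using hx)
  obtain ⟨h2, h3⟩ := third_move (n := n) (k := k) (m := m) isJump_jump hs hw hx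
  exact contribution_congr (ht.flatWrithe isJump_jump hw.1) (ht.flatInd isJump_jump hw.1 x).symm
    h2 h3

/-! ### Change of names -/

section Map

variable {φ : Pass → Pass}

theorem after_map (hφ : Function.Injective φ) (w : List Pass) (c : Pass) :
    after (w.map φ) (φ c) = (after w c).map φ := by
  have : ((fun x => decide (x ≠ φ c)) ∘ φ) = fun x => decide (x ≠ c) := by
    funext x; simp [hφ.eq_iff]
  simp only [after, dropWhile_map, takeWhile_map, this, map_append, map_tail]

theorem arc_map (hφ : Function.Injective φ) (w : List Pass) (c d : Pass) :
    arc (w.map φ) (φ c) (φ d) = (arc w c d).map φ := by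
  have : ((fun x => decide (x ≠ φ d)) ∘ φ) = fun x => decide (x ≠ d) := by
    funext x; simp [hφ.eq_iff]
  simp only [arc, after_map hφ, takeWhile_map, this]

theorem smoothWrithe_map (hφ : Function.Injective φ)
    (hp : ∀ p, φ p.partner = (φ p).partner) (hj : ∀ p, j (φ p) = j p)
    {w : List Pass} (hw : Closed w) {c : Pass} (hc : c ∈ w) :
    smoothWrithe n j (w.map φ) (φ c) = smoothWrithe n j w c := by
  unfold smoothWrithe
  rw [← hp, arc_map hφ, arc_map hφ, ← map_reverse, ← map_append]
  refine flatWrithe_map (closed_smooth hw hc).2 (fun p _ q _ e => hφ e) (fun p _ => hp p) ?_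
  intro p _
  simp only [mixedSign, ← hp, mem_map_of_injective hφ, hj]

theorem linked_map (hφ : Function.Injective φ)
    (hp : ∀ p, φ p.partner = (φ p).partner)
    {w : List Pass} {c d : Pass} :
    Linked (w.map φ) (φ c) (φ d) ↔ Linked w c d := by
  unfold Linked
  rw [← hp, ← hp, arc_map hφ, arc_map hφ, mem_map_of_injective hφ, mem_map_of_injective hφ]

theorem smoothSpan_map (hφ : Function.Injective φ)
    (hp : ∀ p, φ p.partner = (φ p).partner) (hj : ∀ p, j (φ p) = j p)
    {w : List Pass} (hw : Closed w) {c : Pass} (hc : c ∈ w) :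
    smoothSpan k m j (w.map φ) (φ c) = smoothSpan k m j w c := by
  unfold smoothSpan
  rw [List.sum_toFinset _ (hw.1.map hφ), List.sum_toFinset _ hw.1, map_map]
  congr 1
  refine map_congr_left fun d _ => ?_
  have hl := linked_map hφ hp (w := w) (c := c) (d := d)
  simp only [Function.comp, spanTerm]
  by_cases l : Linked w c d
  · rw [if_pos l, if_pos (hl.2 l), hj]
    congr 2
    unfold smoothTwo
    rw [← hp, ← hp, arc_map hφ, arc_map hφ, after_map hφ, after_map hφ, ← map_append]
    exact flatWrithe_map (closed_smoothTwo hw hc l).2 (fun p _ q _ e => hφ e) (fun p _ => hp p)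
      fun p _ => hj p
  · rw [if_neg l, if_neg (mt hl.1 l)]

end Map

theorem Pass.relabel_injective {f : ℕ → ℕ} (hf : Function.Injective f) :
    Function.Injective (Pass.relabel f) := by
  rintro ⟨a, b, c⟩ ⟨a', b', c'⟩ h
  simp only [Pass.relabel, Pass.mk.injEq] at h
  simp [hf h.1, h.2]

theorem flatPoly_relabel {f : ℕ → ℕ} (hf : Function.Injective f) {w : List Pass} (hw : Closed w) :
    flatPoly n k m (w.map (Pass.relabel f)) = flatPoly n k m w := by
  have hφ := Pass.relabel_injective hf
  have hp : ∀ p : Pass, p.partner.relabel f = (p.relabel f).partner := fun p => rfl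
  have hj : ∀ p : Pass, (p.relabel f).jump = p.jump := fun p => rfl
  rw [flatPoly_eq_of_perm (hw.1.map hφ) (Perm.refl _), flatPoly_eq_of_perm hw.1 (Perm.refl _),
    map_map]
  congr 1
  refine map_congr_left fun c hc => ?_
  have h0 : flatWrithe n Pass.jump (w.map (Pass.relabel f)) = flatWrithe n Pass.jump w :=
    flatWrithe_map hw.2 (fun p _ q _ e => hφ e) (fun p _ => hp p) (fun p _ => hj p)
  have h1 : flatInd Pass.jump (w.map (Pass.relabel f)) (c.relabel f) = flatInd Pass.jump w c :=
    flatInd_map hw.2 (fun p _ q _ e => hφ e) (fun p _ => hp p) (fun p _ => hj p) hc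
  have h2 : smoothWrithe n Pass.jump (w.map (Pass.relabel f)) (c.relabel f)
      = smoothWrithe n Pass.jump w c := smoothWrithe_map hφ hp hj hw hc
  have h3 : smoothSpan k m Pass.jump (w.map (Pass.relabel f)) (c.relabel f)
      = smoothSpan k m Pass.jump w c := smoothSpan_map hφ hp hj hw hc
  simp only [Function.comp, contribution, h0, h1, h2, h3]
  rfl

/-! ### Invariance under the moves -/

/-- The word without the passages through virtual crossings. -/
def classicalWord (w : List Pass) : List Pass := w.filter Pass.classical

@[simp] theorem classicalWord_append (u v : List Pass) :
    classicalWord (u ++ v) = classicalWord u ++ classicalWord v := filter_append ..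

theorem Pass.classical_partner (p : Pass) : p.partner.classical = p.classical := rfl

theorem Closed.classicalWord {w : List Pass} (h : Closed w) : Closed (classicalWord w) := by
  refine ⟨h.1.filter _, fun p hp => ?_⟩
  simp only [VirtualKnot.classicalWord, mem_filter] at hp ⊢
  exact ⟨h.2 p hp.1, hp.2⟩

theorem classicalWord_ordered (b : Bool) {p q : Pass} (hp : p.classical = true)
    (hq : q.classical = true) : classicalWord (ordered b p q) = pair (if b then 1 else -1) p q := by
  cases b <;> simp [ordered, pair, classicalWord, hp, hq]

theorem classicalWord_ordered_virtual (b b' : Bool) {p q : Pass}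
    (h : p.classical = false ∨ q.classical = false) : classicalWord (ordered b p q) = classicalWord (ordered b' p q) := by
  rcases h with h | h <;> cases b <;> cases b' <;> simp [ordered, classicalWord, filter_cons, h]

theorem classical_of_isOver {p : Pass} (h : p.isOver = true) : p.classical = true := by
  obtain ⟨a, b, c⟩ := p
  cases c <;> simp_all [Pass.isOver, Pass.classical]

theorem jump_of_classical {p : Pass} (h : p.classical = true) :
    p.jump = if p.left then -1 else 1 := by simp [Pass.jump, h]

/-- The sign conditions at a triangle, for a cyclic run through the strands 1, 2, 3. -/
theorem triSigns (e : Bool) {x y z : Pass} (hx : x.classical = true) (hy : y.classical = true)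
    (hz : z.classical = true) : TriSigns Pass.jump (if z.left == e then 1 else -1)
      (if (!y.left) == e then 1 else -1) (if x.left == e then 1 else -1) x z y.partner := by
  have h1 := jump_of_classical hx
  have h2 := jump_of_classical hy
  have h3 := jump_of_classical hz
  have h4 := isJump_jump y
  refine ⟨?_, ?_, ?_, ?_, ?_, ?_⟩
  · split_ifs <;> simp
  · split_ifs <;> simp
  · split_ifs <;> simp
  all_goals
    simp only [h4, h1, h2, h3]
    cases x.left <;> cases y.left <;> cases z.left <;> cases e <;> simp

/-- The sign conditions at a triangle, for a cyclic run through the strands 1, 3, 2. -/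
theorem triSigns' (e : Bool) {x y z : Pass} (hx : x.classical = true) (hy : y.classical = true)
    (hz : z.classical = true) : TriSigns Pass.jump (-if (!y.left) == e then 1 else -1)
      (-if z.left == e then 1 else -1) (-if x.left == e then 1 else -1)
      x.partner y z.partner := by
  have h1 := jump_of_classical hx
  have h2 := jump_of_classical hy
  have h3 := jump_of_classical hz
  have h4 := isJump_jump x
  have h5 := isJump_jump z
  refine ⟨?_, ?_, ?_, ?_, ?_, ?_⟩
  · split_ifs <;> simp
  · split_ifs <;> simp
  · split_ifs <;> simp
  all_goals
    simp only [h4, h5, h1, h2, h3]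
    cases x.left <;> cases y.left <;> cases z.left <;> cases e <;> simp

theorem pair_comm {o : ℤ} (ho : o = 1 ∨ o = -1) (x y : Pass) : pair o x y = pair (-o) y x := by
  rcases ho with rfl | rfl <;> simp [pair]

theorem beq_not_sign (b e : Bool) : (if b == !e then (1 : ℤ) else -1) = -if b == e then 1 else -1 := by
  cases b <;> cases e <;> simp

theorem kind_virt_classical {p : Pass} (h : p.kind = CrossingKind.virt) : p.classical = false := by
  simp [Pass.classical, h]

/-- After removal of the virtual crossings, the moves that involve virtual crossings are trivial, and
the others are a kink, a bigon or a triangle. -/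
theorem flatPoly_move {w w' : List Pass} (h : Move w w') (hw : Closed w) (hw' : Closed w') :
    flatPoly n k m (classicalWord w) = flatPoly n k m (classicalWord w') := by
  have hc := hw.classicalWord
  have hc' := hw'.classicalWord
  cases h with
  | rotate u v =>
    rw [classicalWord_append, classicalWord_append]
    rw [classicalWord_append] at hc
    exact flatPoly_isRotated hc isRotated_append
  | relabel f hf w =>
    have : classicalWord (w.map (Pass.relabel f)) = (classicalWord w).map (Pass.relabel f) := by
      simp only [classicalWord, filter_map]
      rfl
    rw [this, flatPoly_relabel hf hc]
  | first p w =>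
    by_cases hp : p.classical
    · have e : classicalWord (p :: p.partner :: w) = p :: p.partner :: classicalWord w := by
        simp [classicalWord, hp, Pass.classical_partner]
      rw [e] at hc' ⊢
      exact (flatPoly_kink hc' ⟨[p, p.partner], Perm.refl _, [], classicalWord w, rfl, rfl⟩).symm
    · have e : classicalWord (p :: p.partner :: w) = classicalWord w := by
        simp [classicalWord, hp, Pass.classical_partner]
      rw [e]
  | secondParallel p q hl hk u v =>
    have hcl : q.classical = p.classical := by
      simp only [Pass.classical, hk]; cases p.kind <;> rfl
    by_cases hp : p.classical
    · rw [hp] at hcl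
      have e : classicalWord ([p, q] ++ u ++ [p.partner, q.partner] ++ v) =
          [p, q] ++ classicalWord u ++ [p.partner, q.partner] ++ classicalWord v := by
        simp [classicalWord, hp, hcl, Pass.classical_partner]
      rw [e] at hc' ⊢
      rw [classicalWord_append]
      refine (flatPoly_bigon hc' hl hk (u := classicalWord u) (v := classicalWord v)
        ⟨jump_of_mirror hl hk, classicalWord u ++ [p.partner, q.partner] ++ classicalWord v,
          ⟨[p, q], Perm.refl _, [], _, by simp; rfl, by simp⟩,
          ⟨[p.partner, q.partner], Perm.refl _, _, _, rfl, by simp⟩⟩ (Or.inl ?_)).symm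
      simp [IsRotated.refl]
    · have hq : ¬ q.classical := by rwa [hcl]
      have e : classicalWord ([p, q] ++ u ++ [p.partner, q.partner] ++ v) =
          classicalWord (u ++ v) := by
        simp [classicalWord, hp, hq, Pass.classical_partner]
      rw [e]
  | secondAntiparallel p q hl hk u v =>
    have hcl : q.classical = p.classical := by
      simp only [Pass.classical, hk]; cases p.kind <;> rfl
    by_cases hp : p.classical
    · rw [hp] at hcl
      have e : classicalWord ([p, q] ++ u ++ [q.partner, p.partner] ++ v) =
          [p, q] ++ classicalWord u ++ [q.partner, p.partner] ++ classicalWord v := by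
        simp [classicalWord, hp, hcl, Pass.classical_partner]
      rw [e] at hc' ⊢
      rw [classicalWord_append]
      refine (flatPoly_bigon hc' hl hk (u := classicalWord u) (v := classicalWord v)
        ⟨jump_of_mirror hl hk, classicalWord u ++ [q.partner, p.partner] ++ classicalWord v,
          ⟨[p, q], Perm.refl _, [], _, by simp; rfl, by simp⟩,
          ⟨[q.partner, p.partner], Perm.swap _ _ _, _, _, rfl, by simp⟩⟩ (Or.inr ?_)).symm
      simp [IsRotated.refl]
    · have hq : ¬ q.classical := by rwa [hcl]
      have e : classicalWord ([p, q] ++ u ++ [q.partner, p.partner] ++ v) =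
          classicalWord (u ++ v) := by
        simp [classicalWord, hp, hq, Pass.classical_partner]
      rw [e]
  | third e x y z hk u v w =>
    simp only [classicalWord_append] at hc ⊢
    rcases hk with ⟨hx, hy, hz⟩ | ⟨hx, hy⟩
    · replace hx := classical_of_isOver hx
      replace hy := classical_of_isOver hy
      replace hz := classical_of_isOver hz
      have t : ∀ e, classicalWord (triangle1 e x y z) ++ classicalWord u ++
          classicalWord (triangle2 e x y z) ++ classicalWord v ++
          classicalWord (triangle3 e x y z) ++ classicalWord w =
          triWord (if z.left == e then 1 else -1) (if (!y.left) == e then 1 else -1)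
            (if x.left == e then 1 else -1) x z y.partner (classicalWord u) (classicalWord v)
            (classicalWord w) := by
        intro e
        rw [triangle1, triangle2, triangle3, classicalWord_ordered _ hx hy,
          classicalWord_ordered _ hz (q := x.partner) hx,
          classicalWord_ordered _ (p := y.partner) (q := z.partner) hy hz, triWord,
          Pass.partner_partner]
      rw [t] at hc
      rw [t, t, flatPoly_third (triSigns e hx hy hz) hc, beq_not_sign, beq_not_sign, beq_not_sign]
    · replace hx := kind_virt_classical hx
      replace hy := kind_virt_classical hy
      rw [triangle1, triangle2, triangle3, triangle1, triangle2, triangle3,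
        classicalWord_ordered_virtual _ (z.left == !e) (Or.inl hx),
        classicalWord_ordered_virtual _ ((!y.left) == !e) (q := x.partner) (Or.inr hx),
        classicalWord_ordered_virtual _ (x.left == !e) (p := y.partner) (Or.inl hy)]
  | third' e x y z hk u v w =>
    simp only [classicalWord_append] at hc hc' ⊢
    rcases hk with ⟨hx, hy, hz⟩ | ⟨hx, hy⟩
    · replace hx := classical_of_isOver hx
      replace hy := classical_of_isOver hy
      replace hz := classical_of_isOver hz
      have sg : ∀ b : Bool, (if b then (1 : ℤ) else -1) = 1 ∨ (if b then (1 : ℤ) else -1) = -1 := by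
        decide
      have t : ∀ e, classicalWord (triangle1 e x y z) ++ classicalWord u ++
          classicalWord (triangle3 e x y z) ++ classicalWord v ++
          classicalWord (triangle2 e x y z) ++ classicalWord w ~r
          triWord (-if (!y.left) == e then 1 else -1) (-if z.left == e then 1 else -1)
            (-if x.left == e then 1 else -1) x.partner y z.partner (classicalWord w)
            (classicalWord u) (classicalWord v) := by
        intro e
        rw [triangle1, triangle2, triangle3, classicalWord_ordered _ hx hy,
          classicalWord_ordered _ hz (q := x.partner) hx,
          classicalWord_ordered _ (p := y.partner) (q := z.partner) hy hz, triWord,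
          Pass.partner_partner, Pass.partner_partner, pair_comm (sg _), pair_comm (sg _) z,
          pair_comm (sg _) y.partner]
        exact isRotated_append_of_eq (pair (-if z.left == e then 1 else -1) y x ++
          classicalWord u ++ pair (-if x.left == e then 1 else -1) z.partner y.partner ++
          classicalWord v) (pair (-if (!y.left) == e then 1 else -1) x.partner z ++
          classicalWord w) (by simp) (by simp)
      rw [flatPoly_isRotated hc (t e), flatPoly_isRotated hc' (t (!e)),
        flatPoly_third (triSigns' e hx hy hz) (hc.perm (t e).perm), beq_not_sign, beq_not_sign,
        beq_not_sign]
    · replace hx := kind_virt_classical hx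
      replace hy := kind_virt_classical hy
      rw [triangle1, triangle2, triangle3, triangle1, triangle2, triangle3,
        classicalWord_ordered_virtual _ (z.left == !e) (Or.inl hx),
        classicalWord_ordered_virtual _ ((!y.left) == !e) (q := x.partner) (Or.inr hx),
        classicalWord_ordered_virtual _ (x.left == !e) (p := y.partner) (Or.inl hy)]

end

section

variable {j : Pass → ℤ} {n k m : ℤ}

/-! ### Flat description of the writhes and spans -/

theorem mem_crossings {w : List Pass} {c : Pass} :
    c ∈ crossings w ↔ c ∈ w ∧ c.left = true ∧ c.classical = true := by
  simp [crossings]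

/-- A sum over all passages as a sum over the crossings. -/
theorem sum_eq_sum_crossings {M : Type*} [AddCommMonoid M] {w : List Pass} (hw : Closed w)
    {g : Pass → M} (hg : ∀ p, p.classical = false → g p = 0) :
    ∑ p ∈ w.toFinset, g p = ∑ c ∈ crossings w, (g c + g c.partner) := by
  have e : crossings w = {p ∈ w.toFinset | p.left = true ∧ p.classical = true} := by
    ext p; simp [mem_crossings]
  have h1 : ∑ p ∈ w.toFinset, g p = ∑ p ∈ w.toFinset with p.classical = true, g p := by
    rw [Finset.sum_filter]
    refine Finset.sum_congr rfl fun p _ => ?_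
    by_cases h : p.classical = true
    · rw [if_pos h]
    · rw [if_neg h, hg p (by simpa using h)]
  rw [h1, ← Finset.sum_filter_add_sum_filter_not _ (fun p => p.left = true), Finset.sum_add_distrib]
  congr 1
  · rw [e, Finset.filter_filter]
    simp only [and_comm]
  · refine Finset.sum_nbij' Pass.partner Pass.partner ?_ ?_ (by simp) (by simp) (by simp)
    · intro p hp
      simp only [Finset.mem_filter, mem_toFinset] at hp
      rw [mem_crossings]
      exact ⟨hw.2 p hp.1.1, by simp [Pass.partner, hp.2], hp.1.2⟩
    · intro p hp
      rw [mem_crossings] at hp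
      simp only [Finset.mem_filter, mem_toFinset]
      exact ⟨⟨hw.2 p hp.1, hp.2.2⟩, by simp [Pass.partner, hp.2.1]⟩

theorem isOver_of_virtual {p : Pass} (h : p.classical = false) : p.isOver = false := by
  by_contra h'
  rw [classical_of_isOver (by simpa using h')] at h
  exact absurd h (by simp)

theorem isOver_partner {p : Pass} (h : p.classical = true) : p.partner.isOver = !p.isOver := by
  obtain ⟨a, b, c⟩ := p
  cases c <;> simp_all [Pass.isOver, Pass.classical, Pass.partner]

theorem sgn_cases {p : Pass} (h : p.classical = true) : p.sgn = 1 ∨ p.sgn = -1 := by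
  obtain ⟨a, b, c⟩ := p
  cases c <;> simp_all [Pass.sgn, Pass.classical, CrossingKind.sign]

theorem sgn_of_left {p : Pass} (h : p.classical = true) (hl : p.left = true) :
    p.sgn = if p.isOver then 1 else -1 := by
  obtain ⟨a, b, c⟩ := p
  cases c <;> simp_all [Pass.sgn, Pass.classical, CrossingKind.sign, Pass.isOver]

theorem sum_over_eq_sum_crossings {M : Type*} [AddCommMonoid M] {w : List Pass} (hw : Closed w)
    (g : Pass → M) :
    ∑ p ∈ w.toFinset, (if p.isOver then g p else 0) = ∑ c ∈ crossings w, g c.overPass := by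
  rw [sum_eq_sum_crossings hw fun p hp => by simp [isOver_of_virtual hp]]
  refine Finset.sum_congr rfl fun c hc => ?_
  rw [isOver_partner (mem_crossings.1 hc).2.2, Pass.overPass]
  cases c.isOver <;> simp

theorem ind_eq {w : List Pass} {c : Pass} (hc : c ∈ crossings w) :
    ind w c = c.sgn * flatInd Pass.jump w c := by
  obtain ⟨-, hl, hk⟩ := mem_crossings.1 hc
  rw [ind, flatInd, jump_of_classical hk, if_pos hl]
  rfl

theorem ind_eq_flatInd_overPass {w : List Pass} {c : Pass} (hc : c ∈ crossings w) :
    ind w c = flatInd Pass.jump w c.overPass := by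
  obtain ⟨-, hl, hk⟩ := mem_crossings.1 hc
  rw [ind_eq hc, sgn_of_left hk hl, Pass.overPass]
  split_ifs
  · ring
  · rw [flatInd_partner isJump_jump]; ring

theorem dwrithe_eq_flatWrithe {w : List Pass} (hw : Closed w) :
    dwrithe n w = flatWrithe n Pass.jump w := by
  have h0 : ∀ p : Pass, p.classical = false →
      (if flatInd Pass.jump w p = n then p.jump else 0) = 0 := fun p hp => by
    simp [Pass.jump, hp]
  rw [dwrithe, writhe, writhe, flatWrithe, sum_eq_sum_crossings hw h0, Finset.sum_filter,
    Finset.sum_filter, ← Finset.sum_sub_distrib, ← Finset.sum_neg_distrib]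
  refine Finset.sum_congr rfl fun c hc => ?_
  obtain ⟨-, hl, hk⟩ := mem_crossings.1 hc
  rw [ind_eq hc, flatInd_partner isJump_jump, isJump_jump, jump_of_classical hk, if_pos hl]
  rcases sgn_cases hk with h | h <;> rw [h] <;> split_ifs <;> first | rfl | omega

/-! ### Smoothings with change of names -/

theorem WellFormed.of_subset {w w' : List Pass} (h : WellFormed w) (hc : Closed w')
    (hs : ∀ p ∈ w', p ∈ w) : WellFormed w' :=
  ⟨hc.1, fun p hp => ⟨hc.2 p hp, fun q hq => (h.2 p (hs p hp)).2 q (hs q hq)⟩⟩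

section Flip

variable {A B : List Pass}

/-- The crossing of `p` is a crossing between the strings `A` and `B`. -/
def Mixed (A B : List Pass) (p : Pass) : Prop := (p ∈ A ∧ p.partner ∈ B) ∨ (p ∈ B ∧ p.partner ∈ A)

theorem mixed_partner {p : Pass} : Mixed A B p.partner ↔ Mixed A B p := by
  simp only [Mixed, Pass.partner_partner]; tauto

theorem flipMixed_of_mixed {p : Pass} (h : Mixed A B p) : flipMixed A B p = p.flip := if_pos h

theorem flipMixed_of_not_mixed {p : Pass} (h : ¬ Mixed A B p) : flipMixed A B p = p := if_neg h

theorem jump_flip (p : Pass) : p.flip.jump = -p.jump := by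
  obtain ⟨a, b, c⟩ := p
  cases c <;> cases b <;>
    simp [Pass.jump, Pass.classical, Pass.flip, CrossingKind.mirror]

theorem isOver_flip (p : Pass) : p.flip.isOver = p.isOver := isOver_of_mirror rfl rfl

theorem sgn_flip (p : Pass) : p.flip.sgn = -p.sgn := sgn_of_mirror rfl

theorem label_flipMixed (p : Pass) : (flipMixed A B p).label = p.label := by
  unfold flipMixed; split_ifs <;> rfl

theorem flipMixed_partner (p : Pass) : flipMixed A B p.partner = (flipMixed A B p).partner := by
  by_cases h : Mixed A B p
  · rw [flipMixed_of_mixed h, flipMixed_of_mixed (mixed_partner.2 h)]; rfl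
  · rw [flipMixed_of_not_mixed h, flipMixed_of_not_mixed (mt mixed_partner.1 h)]

theorem jump_flipMixed (p : Pass) : (flipMixed A B p).jump = mixedSign A B Pass.jump p := by
  by_cases h : Mixed A B p
  · rw [flipMixed_of_mixed h, jump_flip]; exact (if_pos h).symm
  · rw [flipMixed_of_not_mixed h]; exact (if_neg h).symm

/-- Distinct crossings of a well-formed word have distinct labels, so the change of names at mixed
crossings cannot identify passages of distinct crossings. -/
theorem flipMixed_injOn {w : List Pass} (h : WellFormed w) {p q : Pass} (hp : p ∈ w) (hq : q ∈ w)
    (e : flipMixed A B p = flipMixed A B q) : p = q := by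
  have hl : q.label = p.label := by
    rw [← label_flipMixed (A := A) (B := B) p, e, label_flipMixed]
  rcases (h.2 p hp).2 q hq hl with rfl | rfl
  · rfl
  · rw [flipMixed_partner] at e
    exact absurd e (Pass.ne_partner _)

theorem WellFormed.flipMixed {w : List Pass} (h : WellFormed w) (A B : List Pass) :
    WellFormed (w.map (flipMixed A B)) := by
  refine ⟨(nodup_map_iff_inj_on h.1).2 fun p hp q hq => flipMixed_injOn h hp hq, fun p hp => ?_⟩
  obtain ⟨p, h1, rfl⟩ := mem_map.1 hp
  refine ⟨by rw [← flipMixed_partner]; exact mem_map_of_mem (h.2 p h1).1, fun q hq hl => ?_⟩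
  obtain ⟨q, h2, rfl⟩ := mem_map.1 hq
  rw [label_flipMixed, label_flipMixed] at hl
  rcases (h.2 p h1).2 q h2 hl with rfl | rfl
  · exact Or.inl rfl
  · exact Or.inr (flipMixed_partner _)

theorem dwrithe_map_flipMixed {w : List Pass} (h : WellFormed w) :
    dwrithe n (w.map (flipMixed A B)) = flatWrithe n (mixedSign A B Pass.jump) w := by
  rw [dwrithe_eq_flatWrithe (h.flipMixed A B).closed]
  exact flatWrithe_map h.closed.2 (fun p hp q hq => flipMixed_injOn h hp hq)
    (fun p _ => flipMixed_partner p) fun p _ => jump_flipMixed p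

end Flip

theorem overPass_mem {w : List Pass} (hw : Closed w) {c : Pass} (hc : c ∈ crossings w) :
    c.overPass ∈ w := by
  have := (mem_crossings.1 hc).1
  unfold Pass.overPass
  split_ifs
  · exact this
  · exact hw.2 _ this

theorem underPass_eq (c : Pass) : c.underPass = c.overPass.partner := by
  unfold Pass.overPass Pass.underPass
  split_ifs <;> simp

theorem mem_of_mem_arcs {w : List Pass} (hw : Closed w) {c : Pass} (hc : c ∈ w) {p : Pass}
    (hp : p ∈ arc w c c.partner ++ arc w c.partner c) : p ∈ w :=
  (perm_arcs hw hc).mem_iff.2 (mem_cons_of_mem _ (mem_cons_of_mem _ hp))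

theorem dwrithe_smooth1 {w : List Pass} (hw : WellFormed w) {c : Pass} (hc : c ∈ crossings w) :
    dwrithe n (smooth1 w c) = smoothWrithe n Pass.jump w c.overPass := by
  have ho := overPass_mem hw.closed hc
  have hs := closed_smooth hw.closed ho
  have hW : WellFormed (arc w c.overPass c.overPass.partner ++
      (arc w c.overPass.partner c.overPass).reverse) :=
    hw.of_subset hs fun p hp => mem_of_mem_arcs hw.closed ho (by simpa using hp)
  rw [smoothWrithe, ← dwrithe_map_flipMixed hW, smooth1, reverseSecond, overLoop, underLoop,
    underPass_eq, map_append, map_reverse]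

theorem after_reverse {w : List Pass} (hw : w.Nodup) {c : Pass} (hc : c ∈ w) :
    after w.reverse c = (after w c).reverse := by
  refine after_eq (nodup_reverse.2 hw) ?_
  have h := (isRotated_cons_after hw hc).reverse
  rw [reverse_cons] at h
  exact h.trans (isRotated_append_of_eq _ [c] rfl rfl)

theorem after_map_of_injOn {φ : Pass → Pass} {w : List Pass} (hw : w.Nodup)
    (hφ : (w.map φ).Nodup) {c : Pass} (hc : c ∈ w) :
    after (w.map φ) (φ c) = (after w c).map φ := by
  refine after_eq hφ ?_
  simpa using (isRotated_cons_after hw hc).map φ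

theorem mem_after {w : List Pass} (hw : w.Nodup) {c : Pass} (hc : c ∈ w) {p : Pass} :
    p ∈ after w c ↔ p ∈ w ∧ p ≠ c := by
  have h1 := (perm_cons_after hw hc)
  have h2 := nodup_after hw hc
  rw [h1.mem_iff, mem_cons]
  simp only [nodup_cons] at h2
  constructor
  · intro h
    exact ⟨Or.inr h, fun e => h2.1 (e ▸ h)⟩
  · rintro ⟨h | h, h'⟩
    · exact absurd h h'
    · exact h

/-- The two reversals of orientation that come from a smoothing of type 2 and a subsequent
smoothing of type 3 cancel up to a global reversal, which changes the sign of the writhe. -/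
theorem dwrithe_smooth3 {w : List Pass} (hw : WellFormed w) {o d : Pass} (ho : o ∈ w)
    (hd : Linked w o d) :
    dwrithe k (smooth3 (reverseSecond (arc w o.partner o) (arc w o o.partner))
      (flipMixed (arc w o.partner o) (arc w o o.partner) d)) =
      (if d.isOver then 1 else -1) * flatWrithe k Pass.jump (smoothTwo w o d) := by
  obtain ⟨nA, nB⟩ := nodup_arc hw.closed ho
  have hAB := closed_arcs hw.closed ho
  have hcl := closed_smoothTwo hw.closed ho hd
  have hp2 := (perm_smoothTwo hw.closed ho hd)
  have hwW : WellFormed (smoothTwo w o d) := hw.of_subset hcl fun p hp => hp2.mem_iff.2 (by simp [hp])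
  have hn2 := hp2.nodup_iff.1 hw.1
  have hdd : ∀ p ∈ smoothTwo w o d, p ≠ d ∧ p ≠ d.partner := by
    intro p hp
    simp only [nodup_cons, mem_cons, not_or] at hn2
    exact ⟨fun e => hn2.2.2.1.2 (e ▸ hp), fun e => hn2.2.2.2.1 (e ▸ hp)⟩
  obtain ⟨hdB, hdA⟩ := hd
  have hwAB : WellFormed (arc w o o.partner ++ arc w o.partner o) :=
    hw.of_subset hAB fun p hp => mem_of_mem_arcs hw.closed ho hp
  unfold smoothTwo at hcl hwW hdd ⊢
  generalize arc w o o.partner = A at *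
  generalize arc w o.partner o = B at *
  set φ := flipMixed B A with hφ
  have inj : ∀ p ∈ A ++ B, ∀ q ∈ A ++ B, φ p = φ q → p = q := fun p hp q hq =>
    flipMixed_injOn hwAB hp hq
  have hmA : (A.map φ).Nodup := (nodup_map_iff_inj_on nA).2 fun p hp q hq =>
    inj p (by simp [hp]) q (by simp [hq])
  have hmB : (B.map φ).Nodup := (nodup_map_iff_inj_on nB).2 fun p hp q hq =>
    inj p (by simp [hp]) q (by simp [hq])
  have e1 : after (B.map φ) (φ d) = (after B d).map φ := after_map_of_injOn nB hmB hdB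
  have e2 : after (A.map φ).reverse (φ d).partner = ((after A d.partner).map φ).reverse := by
    rw [← flipMixed_partner, after_reverse hmA (mem_map_of_mem hdA),
      after_map_of_injOn nA hmA hdA]
  have ov : (φ d).isOver = d.isOver := by
    rw [hφ, flipMixed_of_mixed (Or.inl ⟨hdB, hdA⟩), isOver_flip]
  set X := after B d with hX
  set Y := after A d.partner with hY
  have hXY : ∀ p ∈ X ++ Y, Mixed (X.map φ) (Y.map φ).reverse (φ p) ↔ Mixed B A p := by
    intro p hp
    obtain ⟨h1, h2⟩ := hdd p hp
    have hp' := hcl.2 p hp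
    obtain ⟨h3, h4⟩ := hdd _ hp'
    have mB : ∀ q ∈ X ++ Y, q ≠ d → (φ q ∈ X.map φ ↔ q ∈ B) := by
      intro q hq hqd
      rw [mem_map]
      constructor
      · rintro ⟨r, hr, e⟩
        have hrB := ((mem_after nB hdB).1 hr).1
        have hqw : q ∈ A ++ B := by
          rcases mem_append.1 hq with h | h
          · exact mem_append_right _ ((mem_after nB hdB).1 h).1
          · exact mem_append_left _ ((mem_after nA hdA).1 h).1
        rwa [← inj r (by simp [hrB]) q hqw e]
      · exact fun hqB => ⟨q, (mem_after nB hdB).2 ⟨hqB, hqd⟩, rfl⟩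
    have mA : ∀ q ∈ X ++ Y, q ≠ d.partner → (φ q ∈ (Y.map φ).reverse ↔ q ∈ A) := by
      intro q hq hqd
      rw [mem_reverse, mem_map]
      constructor
      · rintro ⟨r, hr, e⟩
        have hrA := ((mem_after nA hdA).1 hr).1
        have hqw : q ∈ A ++ B := by
          rcases mem_append.1 hq with h | h
          · exact mem_append_right _ ((mem_after nB hdB).1 h).1
          · exact mem_append_left _ ((mem_after nA hdA).1 h).1
        rwa [← inj r (by simp [hrA]) q hqw e]
      · exact fun hqA => ⟨q, (mem_after nA hdA).2 ⟨hqA, hqd⟩, rfl⟩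
    rw [Mixed, ← flipMixed_partner, mB p hp h1, mB _ hp' h3, mA p hp h2, mA _ hp' h4]
    rfl
  have hXYw : WellFormed ((X ++ Y).map φ) := hwW.flipMixed B A
  have hjj : ∀ p ∈ X ++ Y, mixedSign (X.map φ) (Y.map φ).reverse Pass.jump (φ p) = p.jump := by
    intro p hp
    by_cases h : Mixed B A p
    · refine (if_pos ((hXY p hp).2 h)).trans ?_
      rw [hφ, flipMixed_of_mixed h, jump_flip, neg_neg]
    · refine (if_neg (mt (hXY p hp).1 h)).trans ?_
      rw [hφ, flipMixed_of_not_mixed h]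
  have key : flatWrithe k (mixedSign (X.map φ) (Y.map φ).reverse Pass.jump) ((X ++ Y).map φ) =
      flatWrithe k Pass.jump (X ++ Y) :=
    flatWrithe_map hcl.2 (fun p hp q hq => flipMixed_injOn hwW hp hq)
      (fun p _ => flipMixed_partner p) hjj
  simp only [smooth3, reverseSecond, ov]
  rw [e1, e2]
  split_ifs
  · rw [one_mul, ← key, ← dwrithe_map_flipMixed hXYw]
    simp only [map_append, map_reverse, reverse_reverse]
  · have hr : WellFormed ((X ++ Y).map φ).reverse :=
      hXYw.of_subset (hXYw.closed.perm (reverse_perm _).symm) fun p hp => mem_reverse.1 hp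
    rw [neg_one_mul, ← key, ← flatWrithe_reverse (isJump_mixedSign isJump_jump _ _) hXYw.closed,
      mixedSign_comm, ← dwrithe_map_flipMixed hr]
    simp only [map_append, map_reverse, reverse_append]

theorem fspan_eq_sum {L : List Pass × List Pass} (hL : L.1.Nodup) :
    fspan k m L = (L.1.map fun p => if p.classical = true ∧ p.partner ∈ L.2 then
      (if p.isOver then 1 else -1) * p.sgn * weight m (dwrithe k (smooth3 L p)) else 0).sum := by
  have h1 : overCrossings L = {p ∈ L.1.toFinset | p.classical = true ∧ p.isOver = true ∧
      p.partner ∈ L.2} := by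
    ext p; simp [overCrossings, and_assoc]
  have h2 : underCrossings L = {p ∈ L.1.toFinset | p.classical = true ∧ p.isOver = false ∧
      p.partner ∈ L.2} := by
    ext p; simp [underCrossings, and_assoc]
  rw [← List.sum_toFinset _ hL, fspan, span, span, h1, h2]
  simp only [Finset.filter_filter]
  simp only [Finset.sum_filter]
  rw [← Finset.sum_sub_distrib, ← Finset.sum_sub_distrib, ← Finset.sum_add_distrib]
  refine Finset.sum_congr rfl fun p _ => ?_
  unfold weight
  by_cases c1 : p.classical = true <;> by_cases c2 : p.partner ∈ L.2 <;>
    by_cases c3 : p.isOver = true <;> simp [c1, c2, c3] <;> split_ifs <;> simp <;> ring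

/-- The sign changes that distinguish over and under crossings in the span, the reversal of the over
loop and the sign ambiguity of `smooth3` combine to the jump of the passage on the under loop. -/
theorem fspan_smooth2 {w : List Pass} (hw : WellFormed w) {c : Pass} (hc : c ∈ crossings w) :
    fspan k m (smooth2 w c) = smoothSpan k m Pass.jump w c.overPass := by
  have ho := overPass_mem hw.closed hc
  rw [smooth2, underLoop, overLoop, underPass_eq]
  generalize c.overPass = o at *
  obtain ⟨nA, nB⟩ := nodup_arc hw.closed ho
  have hAB := closed_arcs hw.closed ho
  have hwAB : WellFormed (arc w o o.partner ++ arc w o.partner o) :=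
    hw.of_subset hAB fun p hp => mem_of_mem_arcs hw.closed ho hp
  have inj : ∀ p ∈ arc w o o.partner ++ arc w o.partner o, ∀ q ∈ arc w o o.partner ++
      arc w o.partner o, flipMixed (arc w o.partner o) (arc w o o.partner) p =
      flipMixed (arc w o.partner o) (arc w o o.partner) q → p = q := fun p hp q hq =>
    flipMixed_injOn hwAB hp hq
  rw [fspan_eq_sum, reverseSecond]
  · rw [map_map]
    have h3 : ∀ p ∈ w.toFinset, p ∉ (arc w o.partner o).toFinset →
        spanTerm k m Pass.jump w o p = 0 := fun p _ hp => by
      simp only [mem_toFinset] at hp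
      simp [spanTerm, Linked, hp]
    have h4 : (arc w o.partner o).toFinset ⊆ w.toFinset := fun p hp => by
      simp only [mem_toFinset] at hp ⊢
      exact mem_of_mem_arcs hw.closed ho (by simp [hp])
    rw [smoothSpan, ← Finset.sum_subset h4 h3, List.sum_toFinset _ nB]
    congr 1
    refine map_congr_left fun d hd => ?_
    have hm : (flipMixed (arc w o.partner o) (arc w o o.partner) d).partner ∈
        ((arc w o o.partner).map (flipMixed (arc w o.partner o) (arc w o o.partner))).reverse ↔
        d.partner ∈ arc w o o.partner := by
      rw [← flipMixed_partner, mem_reverse, mem_map]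
      constructor
      · rintro ⟨q, hq, e⟩
        rwa [← inj q (by simp [hq]) _ (hAB.2 d (by simp [hd])) e]
      · exact fun h => ⟨_, h, rfl⟩
    simp only [Function.comp, hm, spanTerm]
    by_cases hl : Linked w o d
    · have h5 := dwrithe_smooth3 (k := k) hw ho hl
      rw [reverseSecond] at h5
      rw [h5, if_pos hl, flipMixed_of_mixed (Or.inl ⟨hd, hl.2⟩), isOver_flip, sgn_flip]
      have hk : d.flip.classical = d.classical := by
        obtain ⟨a, b, c⟩ := d
        cases c <;> simp [Pass.classical, Pass.flip, CrossingKind.mirror]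
      rw [hk]
      have hj : d.classical = true → (if d.isOver then 1 else -1) * -d.sgn = d.jump := by
        obtain ⟨a, b, c⟩ := d
        cases c <;> cases b <;>
          simp [Pass.classical, Pass.isOver, Pass.sgn, Pass.jump, CrossingKind.sign]
      by_cases hcl : d.classical = true
      · rw [if_pos ⟨hcl, hl.2⟩, hj hcl]
        split_ifs
        · rw [one_mul]
        · rw [neg_one_mul, weight_neg]
      · rw [if_neg (fun h => hcl h.1)]
        simp [Pass.jump, hcl]
    · rw [if_neg hl, if_neg]
      exact fun h => hl ⟨hd, h.2⟩
  · exact (nodup_map_iff_inj_on nB).2 fun p hp q hq => inj p (by simp [hp]) q (by simp [hq])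

/-! ### Removal of virtual crossings -/

theorem takeWhile_filter_comm {P Q : Pass → Bool} (h : ∀ x, Q x = false → P x = true)
    (w : List Pass) : (w.filter P).takeWhile Q = (w.takeWhile Q).filter P := by
  induction w with
  | nil => rfl
  | cons a w ih => by_cases hq : Q a = true <;> by_cases hp : P a = true <;> simp_all

theorem tail_dropWhile_filter_comm {P Q : Pass → Bool} (h : ∀ x, Q x = false → P x = true)
    (w : List Pass) : ((w.filter P).dropWhile Q).tail = (w.dropWhile Q).tail.filter P := by
  induction w with
  | nil => rfl
  | cons a w ih => by_cases hq : Q a = true <;> by_cases hp : P a = true <;> simp_all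

section Filter

variable {P : Pass → Bool}

theorem of_decide_ne_eq_false {c : Pass} (hc : P c = true) (x : Pass)
    (h : decide (x ≠ c) = false) : P x = true := by
  have : x = c := by simpa using h
  rwa [this]

theorem after_filter {c : Pass} (hc : P c = true) (w : List Pass) :
    after (w.filter P) c = (after w c).filter P := by
  rw [after, after, filter_append, takeWhile_filter_comm (of_decide_ne_eq_false hc),
    tail_dropWhile_filter_comm (of_decide_ne_eq_false hc)]

theorem arc_filter {c d : Pass} (hc : P c = true) (hd : P d = true) (w : List Pass) :
    arc (w.filter P) c d = (arc w c d).filter P := by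
  rw [arc, arc, after_filter hc, takeWhile_filter_comm (of_decide_ne_eq_false hd)]

theorem height_filter (hj : ∀ p, P p = false → j p = 0) {c : Pass} (hc : P c = true)
    (w : List Pass) : height j (w.filter P) c = height j w c := by
  rw [height, height, takeWhile_filter_comm (of_decide_ne_eq_false hc)]
  generalize w.takeWhile (fun x => decide (x ≠ c)) = v
  induction v with
  | nil => rfl
  | cons a v ih =>
    by_cases ha : P a = true
    · simp [ha, ih]
    · simp [ha, ih, hj a (by simpa using ha)]

theorem flatInd_filter (hP : ∀ p, P p.partner = P p) (hj : ∀ p, P p = false → j p = 0) {c : Pass}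
    (hc : P c = true) (w : List Pass) : flatInd j (w.filter P) c = flatInd j w c := by
  rw [flatInd, flatInd, height_filter hj hc, height_filter hj (by rwa [hP])]

theorem flatWrithe_filter (hP : ∀ p, P p.partner = P p) (hj : ∀ p, P p = false → j p = 0)
    (w : List Pass) : flatWrithe n j (w.filter P) = flatWrithe n j w := by
  rw [flatWrithe, flatWrithe, toFinset_filter, Finset.sum_filter]
  congr 1
  refine Finset.sum_congr rfl fun p _ => ?_
  by_cases h : P p = true
  · rw [if_pos h, flatInd_filter hP hj h]
  · rw [if_neg h, hj p (by simpa using h), ite_self]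

theorem smoothWrithe_filter (hP : ∀ p, P p.partner = P p) (hj : ∀ p, P p = false → j p = 0)
    {w : List Pass} (hw : Closed w) {c : Pass} (hcw : c ∈ w) (hc : P c = true) :
    smoothWrithe n j (w.filter P) c = smoothWrithe n j w c := by
  have hc' : P c.partner = true := by rwa [hP]
  have hs := closed_smooth hw hcw
  rw [smoothWrithe, smoothWrithe, arc_filter hc hc', arc_filter hc' hc, ← filter_reverse,
    ← filter_append]
  generalize arc w c c.partner = A at hs ⊢
  generalize arc w c.partner c = B at hs ⊢
  rw [← flatWrithe_filter (j := mixedSign A B j) hP fun p hp => by simp [mixedSign, hj p hp]]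
  refine flatWrithe_congr (fun p hp => ?_) fun p hp => ?_
  · rw [mem_filter] at hp ⊢
    exact ⟨hs.2 p hp.1, by rw [hP, hp.2]⟩
  · have h : P p = true := (mem_filter.1 hp).2
    simp only [mixedSign, mem_filter, hP, h, and_true]

theorem smoothSpan_filter (hP : ∀ p, P p.partner = P p) (hj : ∀ p, P p = false → j p = 0)
    {w : List Pass} {c : Pass} (hc : P c = true) :
    smoothSpan k m j (w.filter P) c = smoothSpan k m j w c := by
  have hc' : P c.partner = true := by rwa [hP]
  rw [smoothSpan, smoothSpan, toFinset_filter, Finset.sum_filter]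
  refine Finset.sum_congr rfl fun d _ => ?_
  by_cases h : P d = true
  · have h' : P d.partner = true := by rwa [hP]
    rw [if_pos h, spanTerm, spanTerm, smoothTwo, arc_filter hc hc', arc_filter hc' hc,
      after_filter h, after_filter h', ← filter_append, flatWrithe_filter hP hj]
    simp only [Linked, arc_filter hc hc', arc_filter hc' hc, mem_filter, h, h', and_true]
    rfl
  · rw [if_neg h, spanTerm, hj d (by simpa using h), zero_mul, ite_self]

end Filter

theorem jump_of_virtual (p : Pass) (h : p.classical = false) : p.jump = 0 := by
  simp [Pass.jump, h]

/-- A sum over the crossings of a diagram as a sum over the over passages of the word without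
virtual crossings. -/
theorem sum_crossings_eq {M : Type*} [AddCommMonoid M] {w : List Pass} (hw : WellFormed w)
    (g : ℤ → ℤ → ℤ → ℤ → M) :
    ∑ c ∈ crossings w, g c.sgn (ind w c) (dwrithe n (smooth1 w c)) (fspan k m (smooth2 w c)) =
      ∑ p ∈ (classicalWord w).toFinset, if p.isOver then
        g p.sgn (flatInd Pass.jump (classicalWord w) p)
          (smoothWrithe n Pass.jump (classicalWord w) p)
          (smoothSpan k m Pass.jump (classicalWord w) p) else 0 := by
  have h1 : ∀ c ∈ crossings w,
      g c.sgn (ind w c) (dwrithe n (smooth1 w c)) (fspan k m (smooth2 w c)) =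
      g c.overPass.sgn (flatInd Pass.jump w c.overPass) (smoothWrithe n Pass.jump w c.overPass)
        (smoothSpan k m Pass.jump w c.overPass) := fun c hc => by
    rw [ind_eq_flatInd_overPass hc, dwrithe_smooth1 hw hc, fspan_smooth2 hw hc]
    congr 1
    unfold Pass.overPass; split_ifs <;> rfl
  rw [Finset.sum_congr rfl h1, ← sum_over_eq_sum_crossings hw.closed fun p =>
    g p.sgn (flatInd Pass.jump w p) (smoothWrithe n Pass.jump w p) (smoothSpan k m Pass.jump w p),
    classicalWord, toFinset_filter, Finset.sum_filter]
  refine Finset.sum_congr rfl fun p hp => ?_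
  by_cases h : p.classical = true
  · rw [if_pos h, flatInd_filter Pass.classical_partner jump_of_virtual h,
      smoothWrithe_filter Pass.classical_partner jump_of_virtual hw.closed (by simpa using hp) h,
      smoothSpan_filter Pass.classical_partner jump_of_virtual h]
  · rw [if_neg h, isOver_of_virtual (by simpa using h)]
    rfl

theorem dwrithe_eq_classicalWord {w : List Pass} (hw : Closed w) :
    dwrithe n w = flatWrithe n Pass.jump (classicalWord w) := by
  rw [dwrithe_eq_flatWrithe hw, classicalWord,
    flatWrithe_filter Pass.classical_partner jump_of_virtual]

theorem fTilde_eq_sum (D : Diagram) : fTilde n k m D = ∑ c ∈ crossings D.word, c.sgn •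
    crossingTerm (dwrithe n D.word) (ind D.word c) (dwrithe n (smooth1 D.word c))
      (fspan k m (smooth2 D.word c)) := by
  rw [fTilde, Finset.sum_filter, Finset.sum_filter, ← Finset.sum_sub_distrib,
    ← Finset.sum_sub_distrib]
  refine Finset.sum_congr rfl fun c _ => ?_
  unfold crossingTerm InT InTF
  split_ifs <;> simp_all [smul_sub]

theorem fTilde_eq_flatPoly (D : Diagram) :
    fTilde n k m D = flatPoly n k m (classicalWord D.word) := by
  rw [fTilde_eq_sum, dwrithe_eq_classicalWord D.wellFormed.closed]
  exact sum_crossings_eq D.wellFormed fun e i x s => e • crossingTerm _ i x s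

theorem fTilde_eq_of_equivalent {D D' : Diagram} (h : D.Equivalent D') :
    fTilde n k m D = fTilde n k m D' := by
  induction h with
  | rel D D' h =>
    rw [fTilde_eq_flatPoly, fTilde_eq_flatPoly,
      flatPoly_move h D.wellFormed.closed D'.wellFormed.closed]
  | refl D => rfl
  | symm D D' _ ih => exact ih.symm
  | trans D D' D'' _ _ ih ih' => exact ih.trans ih'

end

section

variable {n k m : ℤ}

/-! ### Comparison with the F-polynomial -/

theorem setVOne_mono3 (a b c : ℤ) : setVOne (mono3 a b c) = mono2 a b :=
  AddMonoidAlgebra.mapDomain_single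

theorem setVOne_crossingTerm (J i x s : ℤ) : setVOne (crossingTerm J i x s) =
    (mono2 i x - if x = J ∨ x = -J then mono2 0 x else mono2 0 J) +
      if x = -J ∧ s ≠ 0 then mono2 0 x - mono2 0 J else 0 := by
  unfold crossingTerm
  rw [map_sub, apply_ite setVOne, setVOne_mono3, setVOne_mono3, setVOne_mono3]
  by_cases h1 : x = J
  · subst h1
    simp
  · by_cases h2 : x = -J <;> by_cases h3 : s = 0 <;> simp [h1, h2, h3]

theorem fPoly_eq_sum (D : Diagram) : fPoly n D = ∑ c ∈ crossings D.word, c.sgn •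
    (mono2 (ind D.word c) (dwrithe n (smooth1 D.word c)) -
      if InTF n D.word c then mono2 0 (dwrithe n (smooth1 D.word c))
      else mono2 0 (dwrithe n D.word)) := by
  rw [fPoly, Finset.sum_filter, Finset.sum_filter, ← Finset.sum_sub_distrib,
    ← Finset.sum_sub_distrib]
  refine Finset.sum_congr rfl fun c _ => ?_
  split_ifs <;> simp [smul_sub]

theorem setVOne_fTilde (D : Diagram) : setVOne (fTilde n k m D) = fPoly n D +
    ∑ c ∈ crossings D.word with dwrithe n (smooth1 D.word c) = -dwrithe n D.word ∧
      fspan k m (smooth2 D.word c) ≠ 0,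
      c.sgn • (mono2 0 (dwrithe n (smooth1 D.word c)) - mono2 0 (dwrithe n D.word)) := by
  rw [fTilde_eq_sum, fPoly_eq_sum, map_sum, Finset.sum_filter, ← Finset.sum_add_distrib]
  refine Finset.sum_congr rfl fun c _ => ?_
  rw [map_zsmul, setVOne_crossingTerm, smul_add]
  congr 1
  split_ifs <;> simp

/-- The additive functional on Laurent polynomials with prescribed values on the monomials. -/
noncomputable def functional (g : ℤ → ℤ → ℤ → ℤ) : Laurent3 →+ ℤ :=
  (Finsupp.liftAddHom fun a : ℤ × ℤ × ℤ => AddMonoidHom.mulRight (g a.1 a.2.1 a.2.2)).comp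
    AddMonoidAlgebra.coeffAddEquiv.toAddMonoidHom

theorem functional_mono3 (g : ℤ → ℤ → ℤ → ℤ) (a b c : ℤ) :
    functional g (mono3 a b c) = g a b c := by
  simp [functional, mono3]

theorem functional_fTilde (g : ℤ → ℤ → ℤ → ℤ) (D : Diagram) : functional g (fTilde n k m D) =
    ∑ c ∈ crossings D.word, c.sgn * functional g (crossingTerm (dwrithe n D.word) (ind D.word c)
      (dwrithe n (smooth1 D.word c)) (fspan k m (smooth2 D.word c))) := by
  rw [fTilde_eq_sum, map_sum]
  refine Finset.sum_congr rfl fun c _ => ?_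
  rw [map_zsmul, smul_eq_mul]

theorem functional_crossingTerm (g : ℤ → ℤ → ℤ → ℤ) (J i x s : ℤ) :
    functional g (crossingTerm J i x s) =
      g i x s - if (x = J ∨ x = -J) ∧ s = 0 then g 0 x s else g 0 J s := by
  unfold crossingTerm
  rw [map_sub, apply_ite (functional g), functional_mono3, functional_mono3, functional_mono3]

/-- The writhe of index `i ≠ 0` is the coefficient of `t ^ i` for `ℓ = v = 1`. -/
theorem functional_fTilde_writhe {i : ℤ} (hi : i ≠ 0) (D : Diagram) :
    functional (fun a _ _ => if a = i then 1 else 0) (fTilde n k m D) = writhe i D.word := by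
  rw [functional_fTilde, writhe, Finset.sum_filter]
  refine Finset.sum_congr rfl fun c _ => ?_
  rw [functional_crossingTerm]
  simp [hi.symm]

theorem dwrithe_eq_of_fTilde_eq {D D' : Diagram} (h : fTilde n k m D = fTilde n k m D') :
    dwrithe n D.word = dwrithe n D'.word := by
  -- The coefficient of `t ^ 0` is not the writhe of index `0`, but `dwrithe 0` vanishes anyway.
  by_cases hn : n = 0
  · subst hn; simp [dwrithe]
  · rw [dwrithe, dwrithe, ← functional_fTilde_writhe (n := n) (k := k) (m := m) hn,
      ← functional_fTilde_writhe (n := n) (k := k) (m := m) (neg_ne_zero.2 hn), h,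
      functional_fTilde_writhe hn, functional_fTilde_writhe (neg_ne_zero.2 hn)]

/-- The signed number of the crossings that contribute to the correction term is a sum of
coefficients of the three-variable polynomial. -/
theorem functional_fTilde_correction (D : Diagram) (hJ : dwrithe n D.word ≠ 0) :
    functional (fun _ b c => if b = -dwrithe n D.word ∧ c ≠ 0 then 1 else 0) (fTilde n k m D) =
      ∑ c ∈ crossings D.word with dwrithe n (smooth1 D.word c) = -dwrithe n D.word ∧
        fspan k m (smooth2 D.word c) ≠ 0, c.sgn := by
  rw [functional_fTilde, Finset.sum_filter]
  refine Finset.sum_congr rfl fun c _ => ?_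
  rw [functional_crossingTerm]
  have h : dwrithe n D.word ≠ -dwrithe n D.word := by omega
  generalize dwrithe n D.word = J at *
  generalize dwrithe n (smooth1 D.word c) = x
  generalize fspan k m (smooth2 D.word c) = s
  by_cases h1 : s = 0 <;> simp [h1, h]

/-- The three-variable polynomial determines the difference writhe `J` of the knot and, unless `J`
vanishes, the signed number of the crossings that contribute to the correction term.  Hence it
determines the F-polynomial. -/
theorem fPoly_eq_of_fTilde_eq {D D' : Diagram} (h : fTilde n k m D = fTilde n k m D') :
    fPoly n D = fPoly n D' := by
  have hJ := dwrithe_eq_of_fTilde_eq h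
  have key : ∀ D : Diagram, ∑ c ∈ crossings D.word with dwrithe n (smooth1 D.word c) =
      -dwrithe n D.word ∧ fspan k m (smooth2 D.word c) ≠ 0,
      c.sgn • (mono2 0 (dwrithe n (smooth1 D.word c)) - mono2 0 (dwrithe n D.word)) =
      (∑ c ∈ crossings D.word with dwrithe n (smooth1 D.word c) = -dwrithe n D.word ∧
        fspan k m (smooth2 D.word c) ≠ 0, c.sgn) •
        (mono2 0 (-dwrithe n D.word) - mono2 0 (dwrithe n D.word)) := fun D => by
    rw [Finset.sum_smul]
    refine Finset.sum_congr rfl fun c hc => ?_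
    rw [(Finset.mem_filter.1 hc).2.1]
  have h1 := setVOne_fTilde (n := n) (k := k) (m := m) D
  have h2 := setVOne_fTilde (n := n) (k := k) (m := m) D'
  rw [key] at h1 h2
  -- If the difference writhe vanishes, both monomials of the correction term agree.
  by_cases h0 : dwrithe n D.word = 0
  · rw [h0] at h1
    rw [← hJ, h0] at h2
    rw [neg_zero, sub_self, smul_zero, add_zero] at h1 h2
    rw [← h1, ← h2, h]
  · rw [← functional_fTilde_correction D h0] at h1
    rw [← functional_fTilde_correction D' (hJ ▸ h0), ← hJ, ← h] at h2
    exact add_right_cancel (h1.symm.trans h2)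

end

section

variable {j : Pass → ℤ} {n k m : ℤ}

/-! ### Computation of flat writhes -/

/-- For every crossing that is passed twice by the word, the sum of the jumps between the two
passages, together with the jump at the first passage. -/
def chordProfile (j : Pass → ℤ) : List Pass → List (ℤ × ℤ)
  | [] => []
  | p :: w => if p.partner ∈ w then
      (((w.takeWhile (fun x => decide (x ≠ p.partner))).map j).sum, j p) :: chordProfile j w
    else chordProfile j w

/-- The `n`-th flat writhe in terms of a chord profile. -/
def evalProfile (n : ℤ) (l : List (ℤ × ℤ)) : ℤ :=
  (l.map fun a => (if a.1 = n then a.2 else 0) - if a.1 = -n then a.2 else 0).sum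

/-- The part of the flat writhe of `w` that comes from the crossings passed twice by the suffix `v`. -/
theorem sum_eq_neg_evalProfile (hj : IsJump j) {w : List Pass} (hw : w.Nodup) (v : List Pass) :
    ∀ u, w = u ++ v → (v.map fun p => if p.partner ∈ v then
      (if flatInd j w p = n then j p else 0) else 0).sum = -evalProfile n (chordProfile j v) := by
  induction v with
  | nil => intro u _; rfl
  | cons p v ih =>
    intro u hu
    have ih := ih (u ++ [p]) (by simp [hu])
    have hn : p ∉ u ∧ p ∉ v ∧ v.Nodup ∧ ∀ q ∈ v, q ∉ u := by
      rw [hu, nodup_append', nodup_cons, disjoint_cons_right] at hw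
      exact ⟨hw.2.2.1, hw.2.1.1, hw.2.1.2, fun q hq hq' => hw.2.2.2 hq' hq⟩
    -- Among the later passages only the partner of `p` gains a partner in `p :: v`.
    have h1 : (v.map fun q => if q.partner ∈ p :: v then
        (if flatInd j w q = n then j q else 0) else 0).sum =
        (if p.partner ∈ v then (if flatInd j w p.partner = n then j p.partner else 0) else 0) +
        (v.map fun q => if q.partner ∈ v then (if flatInd j w q = n then j q else 0) else 0).sum := by
      rw [← List.sum_toFinset _ hn.2.2.1, ← List.sum_toFinset _ hn.2.2.1]
      have h2 : (if p.partner ∈ v then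
          (if flatInd j w p.partner = n then j p.partner else 0) else 0) =
          ∑ q ∈ v.toFinset, if q = p.partner then
            (if flatInd j w q = n then j q else 0) else 0 := by
        rw [Finset.sum_ite_eq']
        simp only [mem_toFinset]
      rw [h2, ← Finset.sum_add_distrib]
      refine Finset.sum_congr rfl fun q _ => ?_
      by_cases h3 : q = p.partner
      · subst h3
        simp [hn.2.1]
      · have : q.partner ≠ p := by rwa [ne_eq, Pass.partner_eq_comm]
        simp [h3, this]
    rw [map_cons, sum_cons, h1, ih, chordProfile]
    by_cases hp : p.partner ∈ v
    · have e1 : height j w p = (u.map j).sum := by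
        rw [hu, height_append_of_not_mem hn.1]; simp [height]
      have e2 : height j w p.partner =
          (u.map j).sum + (j p + ((v.takeWhile (fun x => decide (x ≠ p.partner))).map j).sum) := by
        rw [hu, height_append_of_not_mem (hn.2.2.2 _ hp)]
        simp [height]
      have e3 : flatInd j w p =
          -((v.takeWhile (fun x => decide (x ≠ p.partner))).map j).sum := by
        rw [flatInd, e1, e2]; ring
      rw [if_pos (mem_cons_of_mem _ hp), if_pos hp, if_pos hp, flatInd_partner hj, hj, e3]
      generalize ((v.takeWhile (fun x => decide (x ≠ p.partner))).map j).sum = S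
      simp only [evalProfile, map_cons, sum_cons, neg_neg, neg_eq_iff_eq_neg (a := S)]
      split_ifs <;> ring
    · rw [if_neg (by simp [hp]), if_neg hp, if_neg hp]
      simp

theorem flatWrithe_eq_evalProfile (hj : IsJump j) {w : List Pass} (hw : Closed w) :
    flatWrithe n j w = evalProfile n (chordProfile j w) := by
  rw [flatWrithe_eq_sum hw.1, neg_eq_iff_eq_neg, ← sum_eq_neg_evalProfile hj hw.1 w [] rfl]
  congr 1
  exact map_congr_left fun p hp => by rw [if_pos (hw.2 p hp)]

/-- The even integers of absolute value at most `6`. -/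
def smallEven : List ℤ := [0, 2, -2, 4, -4, 6, -6]

/-- The odd function on the integers with the values `v` at `2`, `4`, `6`, and zero otherwise. -/
def oddExtension (v : ℤ × ℤ × ℤ) (n : ℤ) : ℤ :=
  if n = 2 then v.1 else if n = -2 then -v.1 else if n = 4 then v.2.1 else if n = -4 then -v.2.1
  else if n = 6 then v.2.2 else if n = -6 then -v.2.2 else 0

theorem oddExtension_zero : oddExtension 0 n = 0 := by simp [oddExtension]

theorem evalProfile_neg (l : List (ℤ × ℤ)) : evalProfile (-n) l = -evalProfile n l := by
  unfold evalProfile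
  induction l with
  | nil => rfl
  | cons a l ih =>
    rw [map_cons, sum_cons, map_cons, sum_cons, ih, neg_neg]
    ring

/-- Finitely many values of a profile with small even entries determine the writhes of all orders. -/
theorem evalProfile_eq_oddExtension {l : List (ℤ × ℤ)} (hl : ∀ a ∈ l, a.1 ∈ smallEven) :
    evalProfile n l = oddExtension (evalProfile 2 l, evalProfile 4 l, evalProfile 6 l) n := by
  unfold oddExtension
  rw [← evalProfile_neg, ← evalProfile_neg, ← evalProfile_neg]
  split_ifs with h1 h2 h3 h4 h5 h6
  any_goals (subst n; rfl)
  by_cases h0 : n = 0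
  · subst h0; simp [evalProfile]
  · rw [evalProfile]
    refine List.sum_eq_zero fun x hx => ?_
    obtain ⟨a, ha, rfl⟩ := mem_map.1 hx
    have h := hl a ha
    simp only [smallEven, mem_cons, not_mem_nil, or_false] at h
    rw [if_neg (by omega), if_neg (by omega), sub_zero]

/-- The chord profile of the knot whose flat writhe is `smoothWrithe`. -/
def smoothProfile (w : List Pass) (c : Pass) : List (ℤ × ℤ) :=
  chordProfile (mixedSign (arc w c c.partner) (arc w c.partner c) Pass.jump)
    (arc w c c.partner ++ (arc w c.partner c).reverse)

theorem smoothWrithe_eq_evalProfile {w : List Pass} (hw : Closed w) {c : Pass} (hc : c ∈ w) :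
    smoothWrithe n Pass.jump w c = evalProfile n (smoothProfile w c) :=
  flatWrithe_eq_evalProfile (isJump_mixedSign isJump_jump _ _) (closed_smooth hw hc)

/-- The jumps at the crossings that contribute to `smoothSpan`, with the writhes that decide
about their weight. -/
def spanProfile (k : ℤ) (w : List Pass) (c : Pass) : List (ℤ × ℤ) :=
  (w.filter fun d => decide (Linked w c d)).map fun d =>
    (d.jump, evalProfile k (chordProfile Pass.jump (smoothTwo w c d)))

theorem smoothSpan_eq_sum {w : List Pass} (hw : Closed w) {c : Pass} (hc : c ∈ w) :
    smoothSpan k m Pass.jump w c = ((spanProfile k w c).map fun a => a.1 * weight m a.2).sum := by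
  rw [spanProfile, map_map, ← List.sum_toFinset _ (hw.1.filter _), toFinset_filter,
    Finset.sum_filter, smoothSpan]
  refine Finset.sum_congr rfl fun d _ => ?_
  unfold spanTerm
  by_cases h : Linked w c d
  · rw [if_pos h, if_pos (by simpa using h), flatWrithe_eq_evalProfile isJump_jump
      (closed_smoothTwo hw hc h)]
    rfl
  · rw [if_neg h, if_neg (by simpa using h)]

/-! ### The virtual knots `VK_3` and `VK_4` -/

/-- The index of a crossing and the writhes of orders `2`, `4`, `6` of the smoothed knot. -/
def crossingData (w : List Pass) (c : Pass) : ℤ × ℤ × ℤ × ℤ :=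
  (flatInd Pass.jump w c, evalProfile 2 (smoothProfile w c), evalProfile 4 (smoothProfile w c),
    evalProfile 6 (smoothProfile w c))

/-- The nonzero data of the crossings of sign `e`. -/
def signedData (w : List Pass) (e : ℤ) : List (ℤ × ℤ × ℤ × ℤ) :=
  ((w.filter fun c => c.isOver && decide (c.sgn = e)).map (crossingData w)).filter
    fun d => decide (d ≠ 0)

theorem sum_eq_signed_sums {M α : Type*} [AddCommGroup M] [Zero α] [DecidableEq α] (f : Pass → α)
    {h : α → M} (h0 : h 0 = 0) (v : List Pass) :
    (v.map fun c => if c.isOver then c.sgn • h (f c) else 0).sum =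
      ((((v.filter fun c => c.isOver && decide (c.sgn = 1)).map f).filter
        fun d => decide (d ≠ 0)).map h).sum -
      ((((v.filter fun c => c.isOver && decide (c.sgn = -1)).map f).filter
        fun d => decide (d ≠ 0)).map h).sum := by
  induction v with
  | nil => simp
  | cons c v ih =>
    rw [map_cons, sum_cons, ih]
    by_cases hc : c.isOver = true
    · have e : ((1 : ℤ) = -1) = False := by simp
      have e' : ((-1 : ℤ) = 1) = False := by simp
      by_cases hf : f c = 0
      · rcases sgn_cases (classical_of_isOver hc) with hs | hs <;> simp [hc, hs, hf, h0]
      · rcases sgn_cases (classical_of_isOver hc) with hs | hs <;> simp [hc, hs, hf] <;> abel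
    · simp [hc]

/-- The F-polynomial of a diagram with vanishing difference writhes. -/
theorem fPoly_eq_of_signedData {D : Diagram} (hJ : dwrithe n D.word = 0)
    (hs : ∀ c ∈ classicalWord D.word, c.isOver = true →
      ∀ a ∈ smoothProfile (classicalWord D.word) c, a.1 ∈ smallEven) :
    fPoly n D =
      ((signedData (classicalWord D.word) 1).map fun d =>
        mono2 d.1 (oddExtension d.2 n) - mono2 0 0).sum -
      ((signedData (classicalWord D.word) (-1)).map fun d =>
        mono2 d.1 (oddExtension d.2 n) - mono2 0 0).sum := by
  have hw := D.wellFormed.closed.classicalWord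
  have h1 : fPoly n D = ∑ c ∈ crossings D.word, c.sgn •
      (mono2 (ind D.word c) (dwrithe n (smooth1 D.word c)) - mono2 0 0) := by
    rw [fPoly_eq_sum]
    refine Finset.sum_congr rfl fun c _ => ?_
    have hT : InTF n D.word c ↔ dwrithe n (smooth1 D.word c) = 0 := by
      unfold InTF; rw [hJ, neg_zero, or_self]
    simp only [hT, hJ]
    split_ifs with h
    · rw [h]
    · rfl
  have h2 := sum_crossings_eq (n := n) (k := 0) (m := 0) D.wellFormed
    fun e i x _ => e • (mono2 i x - mono2 0 0)
  rw [h1, h2, List.sum_toFinset _ hw.1, signedData, signedData, ← sum_eq_signed_sums]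
  · congr 1
    refine map_congr_left fun c hc => ?_
    by_cases ho : c.isOver = true
    · rw [if_pos ho, if_pos ho, smoothWrithe_eq_evalProfile hw hc,
        evalProfile_eq_oddExtension (hs c hc ho)]
      rfl
    · rw [if_neg ho, if_neg ho]
  · show mono2 0 (oddExtension 0 n) - mono2 0 0 = 0
    rw [oddExtension_zero, sub_self]

theorem dwrithe_eq_zero_of_profile {D : Diagram}
    (hs : ∀ a ∈ chordProfile Pass.jump (classicalWord D.word), a.1 ∈ smallEven)
    (h2 : evalProfile 2 (chordProfile Pass.jump (classicalWord D.word)) = 0)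
    (h4 : evalProfile 4 (chordProfile Pass.jump (classicalWord D.word)) = 0)
    (h6 : evalProfile 6 (chordProfile Pass.jump (classicalWord D.word)) = 0) :
    dwrithe n D.word = 0 := by
  rw [dwrithe_eq_classicalWord D.wellFormed.closed,
    flatWrithe_eq_evalProfile isJump_jump D.wellFormed.closed.classicalWord,
    evalProfile_eq_oddExtension hs, h2, h4, h6]
  exact oddExtension_zero

theorem dwrithe_VK3 : dwrithe n VK3.word = 0 :=
  dwrithe_eq_zero_of_profile (by decide +kernel) (by decide +kernel) (by decide +kernel)
    (by decide +kernel)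

theorem dwrithe_VK4 : dwrithe n VK4.word = 0 :=
  dwrithe_eq_zero_of_profile (by decide +kernel) (by decide +kernel) (by decide +kernel)
    (by decide +kernel)

theorem smoothProfile_VK3 : ∀ c ∈ classicalWord VK3.word, c.isOver = true →
    ∀ a ∈ smoothProfile (classicalWord VK3.word) c, a.1 ∈ smallEven := by decide +kernel

theorem smoothProfile_VK4 : ∀ c ∈ classicalWord VK4.word, c.isOver = true →
    ∀ a ∈ smoothProfile (classicalWord VK4.word) c, a.1 ∈ smallEven := by decide +kernel

theorem signedData_VK3_pos : signedData (classicalWord VK3.word) 1 =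
    [(2, 0, 0, 0), (2, -3, 3, -1), (0, 2, -1, 0), (0, 2, -1, 0), (0, -1, -1, 1), (0, -2, 1, 0),
      (0, 2, -1, 0)] := by decide +kernel

theorem signedData_VK3_neg : signedData (classicalWord VK3.word) (-1) =
    [(2, 0, 0, 0), (2, -2, 1, 0), (0, 2, -1, 0), (2, -4, 2, 0), (-2, 0, 0, 0)] := by
  decide +kernel

theorem signedData_VK4_pos : signedData (classicalWord VK4.word) 1 =
    [(2, 0, 0, 0), (2, -2, 1, 0), (2, -3, 3, -1), (0, 2, -1, 0), (0, 2, -1, 0), (0, -1, -1, 1),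
      (0, -2, 1, 0), (0, 2, -1, 0)] := by decide +kernel

theorem signedData_VK4_neg : signedData (classicalWord VK4.word) (-1) =
    [(2, 0, 0, 0), (2, -2, 1, 0), (2, -2, 1, 0), (0, 2, -1, 0), (2, -4, 2, 0), (-2, 0, 0, 0)] := by
  decide +kernel

/-- In `VK_4` one more pair of crossings with equal data and opposite signs occurs than in
`VK_3`. -/
theorem fPoly_VK3_eq_fPoly_VK4 : fPoly n VK3 = fPoly n VK4 := by
  rw [fPoly_eq_of_signedData dwrithe_VK3 smoothProfile_VK3,
    fPoly_eq_of_signedData dwrithe_VK4 smoothProfile_VK4, signedData_VK3_pos, signedData_VK3_neg,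
    signedData_VK4_pos, signedData_VK4_neg]
  simp only [map_cons, sum_cons, map_nil, sum_nil]
  abel

/-- The over passage of the crossing `(1, 1)`, whose coefficient distinguishes `VK_3` from
`VK_4`. -/
def specialPass : Pass := blockPass 1 1 true .pos

/-- The passages that contribute to the coefficient of `t ^ 2 * ℓ ^ (-3)`. -/
def contributing (w : List Pass) : List Pass :=
  w.filter fun c => c.isOver && decide (flatInd Pass.jump w c = 2) &&
    decide (evalProfile 2 (smoothProfile w c) = -3)

/-- If the special passage alone contributes to the coefficient of `t ^ 2 * ℓ ^ (-3)`, this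
coefficient is a power of `v`. -/
theorem functional_fTilde_of_contributing {D : Diagram} (s : ℤ)
    (h : contributing (classicalWord D.word) = [specialPass]) :
    functional (fun a b c => if a = 2 ∧ b = -3 ∧ c = s then 1 else 0) (fTilde 2 k m D) =
      if smoothSpan k m Pass.jump (classicalWord D.word) specialPass = s then 1 else 0 := by
  have hw := D.wellFormed.closed.classicalWord
  have h1 := sum_crossings_eq (n := 2) (k := k) (m := m) D.wellFormed
    fun e i x y => e * if i = 2 ∧ x = -3 ∧ y = s then 1 else 0
  have h2 : functional (fun a b c => if a = 2 ∧ b = -3 ∧ c = s then 1 else 0) (fTilde 2 k m D) =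
      ∑ c ∈ crossings D.word, c.sgn * if ind D.word c = 2 ∧ dwrithe 2 (smooth1 D.word c) = -3 ∧
        fspan k m (smooth2 D.word c) = s then 1 else 0 := by
    rw [functional_fTilde]
    refine Finset.sum_congr rfl fun c _ => ?_
    rw [functional_crossingTerm]
    simp
  have h3 : (if smoothSpan k m Pass.jump (classicalWord D.word) specialPass = s then (1 : ℤ)
      else 0) = ((contributing (classicalWord D.word)).map fun c => c.sgn *
      if smoothSpan k m Pass.jump (classicalWord D.word) c = s then 1 else 0).sum := by
    rw [h]
    simp [specialPass, blockPass, Pass.sgn, CrossingKind.sign]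
  rw [h2, h1, h3, contributing, ← List.sum_toFinset _ (hw.1.filter _), toFinset_filter,
    Finset.sum_filter]
  refine Finset.sum_congr rfl fun c hc => ?_
  rw [smoothWrithe_eq_evalProfile hw (by simpa using hc)]
  simp only [Bool.and_eq_true, decide_eq_true_eq]
  by_cases h4 : c.isOver = true <;>
    by_cases h5 : flatInd Pass.jump (classicalWord D.word) c = 2 <;>
    by_cases h6 : evalProfile 2 (smoothProfile (classicalWord D.word) c) = -3 <;>
    simp [h4, h5, h6]

theorem contributing_VK3 : contributing (classicalWord VK3.word) = [specialPass] := by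
  decide +kernel

theorem contributing_VK4 : contributing (classicalWord VK4.word) = [specialPass] := by
  decide +kernel

theorem spanProfile_VK3 : spanProfile 2 (classicalWord VK3.word) specialPass =
    [(-1, 2), (1, 0), (1, 0), (1, 0), (1, 2), (-1, 2), (1, 0), (-1, -2), (1, 0), (-1, 0)] := by
  decide +kernel

theorem spanProfile_VK4 : spanProfile 2 (classicalWord VK4.word) specialPass =
    [(-1, 0), (1, -2), (1, 0), (1, 0), (1, 2), (-1, 2), (1, 0), (-1, -2), (1, 0), (-1, 0)] := by
  decide +kernel

theorem fTilde_VK3_ne_fTilde_VK4 {s : ℤ}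
    (h3 : (((spanProfile k (classicalWord VK3.word) specialPass).map
      fun a => a.1 * weight m a.2).sum) = s)
    (h4 : (((spanProfile k (classicalWord VK4.word) specialPass).map
      fun a => a.1 * weight m a.2).sum) ≠ s) : fTilde 2 k m VK3 ≠ fTilde 2 k m VK4 := by
  intro h
  have e3 := functional_fTilde_of_contributing (k := k) (m := m) s contributing_VK3
  have e4 := functional_fTilde_of_contributing (k := k) (m := m) s contributing_VK4
  rw [smoothSpan_eq_sum VK3.wellFormed.closed.classicalWord (by decide +kernel), if_pos h3] at e3
  rw [smoothSpan_eq_sum VK4.wellFormed.closed.classicalWord (by decide +kernel), if_neg h4,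
    ← h, e3] at e4
  exact one_ne_zero e4

end

end VirtualKnot

theorem theorem6 :
    -- (i) the three-variable polynomial is an invariant of oriented virtual knots
    (∀ (n k m : ℤ) (D D' : VirtualKnot.Diagram), D.Equivalent D' →
      VirtualKnot.fTilde n k m D = VirtualKnot.fTilde n k m D') ∧
    -- (ii) the substitution `v = 1` gives the F-polynomial, up to an explicit correction
    (∀ (n k m : ℤ) (D : VirtualKnot.Diagram),
      VirtualKnot.setVOne (VirtualKnot.fTilde n k m D) =
        VirtualKnot.fPoly n D +
          ∑ c ∈ VirtualKnot.crossings D.word with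
            VirtualKnot.dwrithe n (VirtualKnot.smooth1 D.word c) =
                -VirtualKnot.dwrithe n D.word ∧
              VirtualKnot.fspan k m (VirtualKnot.smooth2 D.word c) ≠ 0,
            c.sgn •
              (VirtualKnot.mono2 0 (VirtualKnot.dwrithe n (VirtualKnot.smooth1 D.word c)) -
                VirtualKnot.mono2 0 (VirtualKnot.dwrithe n D.word))) ∧
    -- what an F-polynomial distinguishes, the three-variable polynomials distinguish
    (∀ (n k m : ℤ) (D D' : VirtualKnot.Diagram),
      VirtualKnot.fPoly n D ≠ VirtualKnot.fPoly n D' →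
        VirtualKnot.fTilde n k m D ≠ VirtualKnot.fTilde n k m D') ∧
    -- two virtual knots that the F-polynomials do not distinguish
    (∀ n : ℤ, VirtualKnot.fPoly n VirtualKnot.VK3 = VirtualKnot.fPoly n VirtualKnot.VK4) ∧
    VirtualKnot.fTilde 2 2 0 VirtualKnot.VK3 ≠ VirtualKnot.fTilde 2 2 0 VirtualKnot.VK4 ∧
    VirtualKnot.fTilde 2 2 2 VirtualKnot.VK3 ≠ VirtualKnot.fTilde 2 2 2 VirtualKnot.VK4 :=
  ⟨fun _ _ _ _ _ h => VirtualKnot.fTilde_eq_of_equivalent h,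
    fun _ _ _ D => VirtualKnot.setVOne_fTilde D,
    fun _ _ _ _ _ h h' => h (VirtualKnot.fPoly_eq_of_fTilde_eq h'),
    fun _ => VirtualKnot.fPoly_VK3_eq_fPoly_VK4,
    VirtualKnot.fTilde_VK3_ne_fTilde_VK4 (s := 8)
      (by rw [VirtualKnot.spanProfile_VK3]; decide) (by rw [VirtualKnot.spanProfile_VK4]; decide),
    VirtualKnot.fTilde_VK3_ne_fTilde_VK4 (s := -2)
      (by rw [VirtualKnot.spanProfile_VK3]; decide) (by rw [VirtualKnot.spanProfile_VK4]; decide)⟩
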